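/- **Theorem (local linear convergence of regularized gradient descent for MARCF; deterministic).** *Setting.* Let $\mathbf Y_0,\dots,\mathbf Y_T\in\mathbb R^{p_1\times p_2}$ be any matrices and let $0\le d_i\le r_i$ ($i=1,2$). A parameter is $\Theta=(\mathbf C_i,\mathbf R_i,\mathbf P_i,\mathbf D_i)_{i=1,2}$ with $\mathbf C_i\in\mathbb R^{p_i\times d_i}$, $\mathbf R_i,\mathbf P_i\in\mathbb R^{p_i\times(r_i-d_i)}$, $\mathbf D_i\in\mathbb R^{r_i\times r_i}$; it has coefficient matrices $\mathbf A_i=[\mathbf C_i\ \mathbf R_i]\mathbf D_i[\mathbf C_i\ \mathbf P_i]^\top$. Put $$\mathcal L(\Theta)=\tfrac1{2T}\sum_{t=1}^T\|\mathbf Y_t-\mathbf A_1\mathbf Y_{t-1}\mathbf A_2^\top\|_F^2,\qquad \widetilde{\mathcal L}(\mathbf A)=\tfrac1{2T}\sum_{t=1}^T\|\mathrm{vec}(\mathbf Y_t)-\mathbf A\,\mathrm{vec}(\mathbf Y_{t-1})\|_2^2,$$ $$\overline{\mathcal L}(\Theta)=\mathcal L(\Theta)+\tfrac{\lambda_1}4\big(\|\mathbf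 A_1\|_F^2-\|\mathbf A_2\|_F^2\big)^2+\tfrac{\lambda_2}2\sum_{i=1}^2\Big(\big\|[\mathbf C_i\,\mathbf R_i]^\top[\mathbf C_i\,\mathbf R_i]-b^2\mathbf I\big\|_F^2+\big\|[\mathbf C_i\,\mathbf P_i]^\top[\mathbf C_i\,\mathbf P_i]-b^2\mathbf I\big\|_F^2\Big).$$ Let $\Theta^{(j)}$ be the iterates of gradient descent on $\overline{\mathcal L}$ with step size $\eta$ from $\Theta^{(0)}$ (all components updated simultaneously), with coefficient matrices $\mathbf A_i^{(j)}$. Call $\Theta$ *identified* if $[\mathbf C_i\,\mathbf R_i]^\top[\mathbf C_i\,\mathbf R_i]=[\mathbf C_i\,\mathbf P_i]^\top[\mathbf C_i\,\mathbf P_i]=b^2\mathbf I_{r_i}$ for $i=1,2$. With $\mathbb O^k$ the orthogonal $k\times k$ matrices, let $$\mathrm{dist}(\Theta,\Theta')^2=\min_{\mathbf Q_{i,1}\in\mathbb O^{d_i},\ \mathbf Q_{i,2},\mathbf Q_{i,3}\in\mathbb O^{r_i-d_i}}\sum_{i=1}^2\Big\{\|\mathbf C_i-\mathbf C_i'\mathbf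 Q_{i,1}\|_F^2+\|\mathbf R_i-\mathbf R_i'\mathbf Q_{i,2}\|_F^2+\|\mathbf P_i-\mathbf P_i'\mathbf Q_{i,3}\|_F^2+\|\mathbf D_i-\mathrm{diag}(\mathbf Q_{i,1},\mathbf Q_{i,2})^\top\mathbf D_i'\,\mathrm{diag}(\mathbf Q_{i,1},\mathbf Q_{i,3})\|_F^2\Big\}.$$ *Truth.* Let $\Theta^*$ be identified with $\|\mathbf A_1^*\|_F=\|\mathbf A_2^*\|_F=\phi>0$ and $\mathrm{rank}(\mathbf A_i^*)=r_i$; let $\underline\sigma$ be the smallest nonzero singular value of $\mathbf A_1^*,\mathbf A_2^*$ and $\kappa=\phi/\underline\sigma$. Assume that, for a constant $g_{\min}>0$ and each $i$ with $d_i\ge1$, $\sin\theta_1(\mathbf R_i^*,\mathbf P_i^*)\ge g_{\min}$, where $\theta_1=\arccos s_{i,1}$ and $s_{i,1}$ is the largest singular value of $(\mathbf R_i^*/b)^\top(\mathbf P_i^*/b)$ (no condition if $d_i=r_i$). The deviation bound is $$\xi=\sup\big\langle\nabla\widetilde{\mathcal L}(\mathbf A_2^*\otimes\mathbf A_1^*),\,[\mathbf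 C_2\,\mathbf R_2]\mathbf D_2[\mathbf C_2\,\mathbf P_2]^\top\otimes[\mathbf C_1\,\mathbf R_1]\mathbf D_1[\mathbf C_1\,\mathbf P_1]^\top\big\rangle$$ over all $[\mathbf C_i\,\mathbf R_i]$, $[\mathbf C_i\,\mathbf P_i]$ with orthonormal columns and $\|\mathbf D_i\|_F=1$. *RSC/RSS.* Assume that for some $0<\alpha\le\beta$ and all $\mathbf A=\mathbf A_2\otimes\mathbf A_1$, $\mathbf A'=\mathbf A_2'\otimes\mathbf A_1'$ whose factors are coefficient matrices of parameters, $$\tfrac\alpha2\|\mathbf A-\mathbf A'\|_F^2\le\widetilde{\mathcal L}(\mathbf A)-\widetilde{\mathcal L}(\mathbf A')-\langle\nabla\widetilde{\mathcal L}(\mathbf A'),\mathbf A-\mathbf A'\rangle\le\tfrac\beta2\|\mathbf A-\mathbf A'\|_F^2.$$ *Claim.* For all $K\ge1$ and $g_{\min}>0$ there are constants $\bar\eta,c_0,c_\xi,c,C>0$ with $c\bar\eta<1$, depending only on $K$ and $g_{\min}$ (not on dimensions, data, or any other quantity), such that if $$K^{-1}\alpha\le\lambda_1\le K\alpha,\quad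 K^{-1}\kappa^{-2}\phi^{8/3}\alpha\le\lambda_2\le K\kappa^{-2}\phi^{8/3}\alpha,\quad K^{-1}\phi^{1/3}\le b\le K\phi^{1/3},\quad \eta=\eta_0\phi^{-10/3}\beta^{-1},\ 0<\eta_0\le\bar\eta,$$ $$\xi^2\le c_\xi\,\kappa^{-6}\phi^4\alpha^3\beta^{-1},\qquad \mathrm{dist}(\Theta^{(0)},\Theta^*)^2\le c_0\,\kappa^{-2}\phi^{2/3}\alpha\beta^{-1},$$ then, with $\rho=1-c\,\eta_0\alpha\beta^{-1}\kappa^{-2}\in(0,1)$, for all $j\ge1$: 1. $\mathrm{dist}(\Theta^{(j)},\Theta^*)^2\le\rho^j\,\mathrm{dist}(\Theta^{(0)},\Theta^*)^2+C\kappa^4\phi^{-10/3}\alpha^{-2}\xi^2$; 2. if $\Theta^{(0)}$ is identified, $\sum_{i}\|\mathbf A_i^{(j)}-\mathbf A_i^*\|_F^2\le C\big[\kappa^2\rho^j\sum_i\|\mathbf A_i^{(0)}-\mathbf A_i^*\|_F^2+\kappa^4\phi^{-2}\alpha^{-2}\xi^2\big]$; 3. if moreover $\|\mathbf A_1^{(0)}\|_F=\|\mathbf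 A_2^{(0)}\|_F$, $\ \|\mathbf A_2^{(j)}\otimes\mathbf A_1^{(j)}-\mathbf A_2^*\otimes\mathbf A_1^*\|_F^2\le C\big[\kappa^2\rho^j\|\mathbf A_2^{(0)}\otimes\mathbf A_1^{(0)}-\mathbf A_2^*\otimes\mathbf A_1^*\|_F^2+\kappa^4\alpha^{-2}\xi^2\big]$. -/

import Mathlib

open scoped Matrix Kronecker
open scoped Matrix.Norms.Frobenius

/-!
With the scope `Matrix.Norms.Frobenius`, `‖M‖` is the Frobenius norm of a matrix `M`.
The two modes `i = 1, 2` are indexed by `0, 1 : Fin 2`.  The rank is `r i = d i + s i`, where `d i`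
is the dimension of the common subspace and `s i = r i - d i` that of the specific subspaces; the
`r i` columns of `[C R]` and of `[C P]` are indexed by `Fin (d i) ⊕ Fin (s i)`.
-/

namespace MARCF

noncomputable section

/-- The Frobenius inner product `tr (Mᵀ N)`. -/
def frobInner {m n : Type*} [Fintype m] [Fintype n] (M N : Matrix m n ℝ) : ℝ :=
  (Mᵀ * N).trace

/-- The gradient of a real function of a matrix: the matrix of its partial derivatives. -/
def matGrad {m n : Type*} [DecidableEq m] [DecidableEq n] (f : Matrix m n ℝ → ℝ)
    (M : Matrix m n ℝ) : Matrix m n ℝ :=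
  Matrix.of fun i j => deriv (fun x : ℝ => f (M + Matrix.single i j x)) 0

/-- The components `C`, `R`, `P`, `D` of one coefficient matrix. -/
structure Comp (p d s : ℕ) where
  C : Matrix (Fin p) (Fin d) ℝ
  R : Matrix (Fin p) (Fin s) ℝ
  P : Matrix (Fin p) (Fin s) ℝ
  D : Matrix (Fin d ⊕ Fin s) (Fin d ⊕ Fin s) ℝ

namespace Comp

variable {p d s : ℕ}

/-- `[C R]` -/
def U (F : Comp p d s) : Matrix (Fin p) (Fin d ⊕ Fin s) ℝ := Matrix.fromCols F.C F.R

/-- `[C P]` -/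
def V (F : Comp p d s) : Matrix (Fin p) (Fin d ⊕ Fin s) ℝ := Matrix.fromCols F.C F.P

/-- The coefficient matrix `[C R] D [C P]ᵀ`. -/
def coef (F : Comp p d s) : Matrix (Fin p) (Fin p) ℝ := F.U * F.D * F.Vᵀ

/-- The identification constraints with balancing scalar `b`:
`[C R]ᵀ [C R] = b² I` and `[C P]ᵀ [C P] = b² I`. -/
def Identified (b : ℝ) (F : Comp p d s) : Prop :=
  F.Uᵀ * F.U = b ^ 2 • (1 : Matrix (Fin d ⊕ Fin s) (Fin d ⊕ Fin s) ℝ) ∧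
  F.Vᵀ * F.V = b ^ 2 • (1 : Matrix (Fin d ⊕ Fin s) (Fin d ⊕ Fin s) ℝ)

/-- `σ_r`, the `r`-th largest singular value of the coefficient matrix, where `r = d + s`
(Mathlib numbers singular values from `0`). -/
def sigmaR (F : Comp p d s) : ℝ :=
  (Matrix.toEuclideanLin F.coef).singularValues (d + s - 1)

/-- `sin θ₁(R, P)` for `R`, `P` with `Rᵀ R = Pᵀ P = b² I`: here `θ₁ = arccos s₁` is the smallest
canonical angle between the column spaces, `s₁` being the largest singular value of
`(R / b)ᵀ (P / b)`. -/
def sinTheta (b : ℝ) (F : Comp p d s) : ℝ :=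
  Real.sin (Real.arccos
    ((Matrix.toEuclideanLin ((b⁻¹ • F.R)ᵀ * (b⁻¹ • F.P))).singularValues 0))

end Comp

/-- The full parameter `Θ`. -/
abbrev Params (p d s : Fin 2 → ℕ) : Type := ∀ i : Fin 2, Comp (p i) (d i) (s i)

variable {p d s : Fin 2 → ℕ} {T : ℕ}

/-- The Kronecker product `A₂ ⊗ A₁` of the coefficient matrices of `Θ`. -/
def kron (Θ : Params p d s) : Matrix (Fin (p 1) × Fin (p 0)) (Fin (p 1) × Fin (p 0)) ℝ :=
  (Θ 1).coef ⊗ₖ (Θ 0).coef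

/-- Least-squares loss of `Θ` for the data `Y₀, …, Y_T`. -/
def loss (Y : Fin (T + 1) → Matrix (Fin (p 0)) (Fin (p 1)) ℝ) (Θ : Params p d s) : ℝ :=
  1 / (2 * (T : ℝ)) * ∑ t : Fin T,
    ‖Y t.succ - (Θ 0).coef * Y t.castSucc * (Θ 1).coefᵀ‖ ^ 2

/-- Least-squares loss as a function of the Kronecker product parameter `A` (`Matrix.vec` stacks
columns). -/
def lossKron (Y : Fin (T + 1) → Matrix (Fin (p 0)) (Fin (p 1)) ℝ)
    (A : Matrix (Fin (p 1) × Fin (p 0)) (Fin (p 1) × Fin (p 0)) ℝ) : ℝ :=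
  1 / (2 * (T : ℝ)) * ∑ t : Fin T,
    ‖WithLp.toLp 2 ((Y t.succ).vec - A *ᵥ (Y t.castSucc).vec)‖ ^ 2

/-- The regularizer that balances the norms of the two coefficient matrices. -/
def reg₁ (Θ : Params p d s) : ℝ := (‖(Θ 0).coef‖ ^ 2 - ‖(Θ 1).coef‖ ^ 2) ^ 2

/-- The regularizer that enforces the identification constraints. -/
def reg₂ (b : ℝ) (Θ : Params p d s) : ℝ :=
  ∑ i : Fin 2, (‖(Θ i).Uᵀ * (Θ i).U - b ^ 2 • 1‖ ^ 2 + ‖(Θ i).Vᵀ * (Θ i).V - b ^ 2 • 1‖ ^ 2)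

/-- The regularized objective. -/
def objective (Y : Fin (T + 1) → Matrix (Fin (p 0)) (Fin (p 1)) ℝ) (lam₁ lam₂ b : ℝ)
    (Θ : Params p d s) : ℝ :=
  loss Y Θ + lam₁ / 4 * reg₁ Θ + lam₂ / 2 * reg₂ b Θ

/-- One step of gradient descent on the objective: all components are updated simultaneously with
the partial gradients at the current parameter. -/
def gdStep (Y : Fin (T + 1) → Matrix (Fin (p 0)) (Fin (p 1)) ℝ) (lam₁ lam₂ b η : ℝ)
    (Θ : Params p d s) : Params p d s := fun i =>
  { C := (Θ i).C - η • matGrad (fun M =>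
      objective Y lam₁ lam₂ b (Function.update Θ i { Θ i with C := M })) (Θ i).C
    R := (Θ i).R - η • matGrad (fun M =>
      objective Y lam₁ lam₂ b (Function.update Θ i { Θ i with R := M })) (Θ i).R
    P := (Θ i).P - η • matGrad (fun M =>
      objective Y lam₁ lam₂ b (Function.update Θ i { Θ i with P := M })) (Θ i).P
    D := (Θ i).D - η • matGrad (fun M =>
      objective Y lam₁ lam₂ b (Function.update Θ i { Θ i with D := M })) (Θ i).D }

/-- The gradient-descent iterate `Θ⁽ʲ⁾` started at `Θ₀`. -/
def iterate (Y : Fin (T + 1) → Matrix (Fin (p 0)) (Fin (p 1)) ℝ) (lam₁ lam₂ b η : ℝ)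
    (Θ₀ : Params p d s) (j : ℕ) : Params p d s :=
  (gdStep Y lam₁ lam₂ b η)^[j] Θ₀

/-- `dist(Θ, Θ')²`: squared distance up to orthogonal rotations of the components. -/
def distSq (Θ Θ' : Params p d s) : ℝ :=
  ⨅ Q : ∀ i : Fin 2, Matrix.orthogonalGroup (Fin (d i)) ℝ ×
      Matrix.orthogonalGroup (Fin (s i)) ℝ × Matrix.orthogonalGroup (Fin (s i)) ℝ,
    ∑ i : Fin 2,
      (‖(Θ i).C - (Θ' i).C * ((Q i).1 : Matrix (Fin (d i)) (Fin (d i)) ℝ)‖ ^ 2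
        + ‖(Θ i).R - (Θ' i).R * ((Q i).2.1 : Matrix (Fin (s i)) (Fin (s i)) ℝ)‖ ^ 2
        + ‖(Θ i).P - (Θ' i).P * ((Q i).2.2 : Matrix (Fin (s i)) (Fin (s i)) ℝ)‖ ^ 2
        + ‖(Θ i).D
            - (Matrix.fromBlocks ((Q i).1 : Matrix (Fin (d i)) (Fin (d i)) ℝ) 0 0
                ((Q i).2.1 : Matrix (Fin (s i)) (Fin (s i)) ℝ))ᵀ
              * (Θ' i).D
              * Matrix.fromBlocks ((Q i).1 : Matrix (Fin (d i)) (Fin (d i)) ℝ) 0 0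
                ((Q i).2.2 : Matrix (Fin (s i)) (Fin (s i)) ℝ)‖ ^ 2)

/-- Restricted strong convexity with parameter `α` and restricted strong smoothness with parameter
`β` of the least-squares loss, over Kronecker products of matrices `[C R] D [C P]ᵀ`. -/
def RSCRSS (d s : Fin 2 → ℕ) (Y : Fin (T + 1) → Matrix (Fin (p 0)) (Fin (p 1)) ℝ)
    (α β : ℝ) : Prop :=
  0 < α ∧ α ≤ β ∧ ∀ Θ Θ' : Params p d s,
    α / 2 * ‖kron Θ - kron Θ'‖ ^ 2 ≤
        lossKron Y (kron Θ) - lossKron Y (kron Θ')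
          - frobInner (matGrad (lossKron Y) (kron Θ')) (kron Θ - kron Θ') ∧
      lossKron Y (kron Θ) - lossKron Y (kron Θ')
          - frobInner (matGrad (lossKron Y) (kron Θ')) (kron Θ - kron Θ') ≤
        β / 2 * ‖kron Θ - kron Θ'‖ ^ 2

/-- The deviation bound `ξ(r₁, r₂, d₁, d₂)` at the parameter matrix `A`. -/
def deviation (d s : Fin 2 → ℕ) (Y : Fin (T + 1) → Matrix (Fin (p 0)) (Fin (p 1)) ℝ)
    (A : Matrix (Fin (p 1) × Fin (p 0)) (Fin (p 1) × Fin (p 0)) ℝ) : ℝ :=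
  sSup {x : ℝ | ∃ F : Params p d s, (∀ i, (F i).Identified 1 ∧ ‖(F i).D‖ = 1) ∧
    x = frobInner (matGrad (lossKron Y) A) (kron F)}

end

end MARCF

/-! Put `h = φ ^ (1/3)`. At the truth `b` is comparable to `h`, `‖D‖ ≤ K² h`, the coefficient
matrices have norm `h³` and their Kronecker product `h⁶`. All estimates are homogeneous in `h`, with
constants in `K` and the angle gap only. Dimensions never enter because `[C R]` and `[C P]` are
measured by operator bounds (`OpBound`).

Rotations do not change the coefficient matrices, so the target is an orbit. Let `Θ'` be a point of
it with `‖Θ - Θ'‖² ≤ E²`, and let `W` be half the squared prediction error of `kron Θ - kron Θ'`,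
plus `λ₁/4` times the squared imbalance of norms, plus `λ₂/2` times the Gram defect `reg₂`.
Expanding the square of one gradient step leaves three facts to prove. (1) `⟨∇, Θ - Θ'⟩ ≥ W` up to
`O(β h⁸ E⁴)` and `O(h⁵ ξ E)` (`Regime.pairing_lower`). (2) `η ‖∇‖² ≤ W + κ² ξ² / α`
(`Regime.nsq_grad_le`). (3) `W` is at least a constant times `α h¹⁰ κ⁻² dist²`, up to `β h⁸ E⁴`
(`Regime.regularity_lower`). In the basin the quartic terms are absorbed and Young's inequality
handles the noise, so a step contracts (`Regime.nsq_step_le`).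

For (1) and (2), restricted smoothness and `ξ` speak only of Kronecker products of coefficient
matrices, whereas derivatives of `coef` are not of that form. But `coef` is an exact cubic along
lines, so a finite-difference stencil writes its derivatives as combinations of its values, with
controlled total norm (`Comp.ctrl_coefD`).

For (3), strong convexity and the balancing term control the errors of both factors
(`Truth.le_kron`). It remains to bound the distance by these errors and the Gram defect
(`Truth.distSq_le`). This is injectivity of the linearized parametrization modulo rotations
(`Comp.Base.linear_bound`). Projecting off `[C R]`, and by transposition off `[C P]`, shows that the
perturbation of `C` lies almost in the span of `R` and almost in that of `P`, and the angle gap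
makes it small. The skew parts invisible to Gram matrices are removed by a Cayley rotation, up to a
quadratic error (`exists_gauge`). No optimal alignment is needed: estimates hold for every orbit
point close enough, and the near-optimal value tends to the infimum (`le_of_forall_right_near`).
Iterating and comparing distance with coefficient error in both directions gives the three claims.
-/

namespace MARCF

/-! ### Frobenius inner product and operator bounds. -/

section Frobenius

variable {l m n o : Type*} [Fintype l] [Fintype m] [Fintype n] [Fintype o]

theorem frobInner_eq_sum (M N : Matrix m n ℝ) : frobInner M N = ∑ i, ∑ j, M i j * N i j := by
  simp only [frobInner, Matrix.trace, Matrix.diag, Matrix.mul_apply, Matrix.transpose_apply]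
  exact Finset.sum_comm

theorem norm_sq_eq_sum (M : Matrix m n ℝ) : ‖M‖ ^ 2 = ∑ i, ∑ j, M i j ^ 2 := by
  rw [Matrix.frobenius_norm_def, ← Real.sqrt_eq_rpow, Real.sq_sqrt (by positivity)]
  simp

theorem frobInner_self (M : Matrix m n ℝ) : frobInner M M = ‖M‖ ^ 2 := by
  rw [frobInner_eq_sum, norm_sq_eq_sum]; simp only [sq]

theorem frobInner_comm (M N : Matrix m n ℝ) : frobInner M N = frobInner N M := by
  simp only [frobInner_eq_sum, mul_comm]

theorem frobInner_add_right (M N N' : Matrix m n ℝ) :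
    frobInner M (N + N') = frobInner M N + frobInner M N' := by
  simp [frobInner, Matrix.mul_add]

theorem frobInner_sub_left (M M' N : Matrix m n ℝ) :
    frobInner (M - M') N = frobInner M N - frobInner M' N := by
  simp [frobInner, Matrix.sub_mul]

theorem frobInner_sub_right (M N N' : Matrix m n ℝ) :
    frobInner M (N - N') = frobInner M N - frobInner M N' := by
  simp [frobInner, Matrix.mul_sub]

theorem frobInner_smul_right (c : ℝ) (M N : Matrix m n ℝ) :
    frobInner M (c • N) = c * frobInner M N := by
  simp [frobInner]

theorem frobInner_neg_right (M N : Matrix m n ℝ) : frobInner M (-N) = -frobInner M N := by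
  simp [frobInner]

theorem frobInner_mul_left (A : Matrix l m ℝ) (M : Matrix m n ℝ) (N : Matrix l n ℝ) :
    frobInner (A * M) N = frobInner M (Aᵀ * N) := by
  simp [frobInner, Matrix.mul_assoc]

theorem abs_frobInner_le (M N : Matrix m n ℝ) : |frobInner M N| ≤ ‖M‖ * ‖N‖ := by
  have h : frobInner M N ^ 2 ≤ (‖M‖ * ‖N‖) ^ 2 := by
    rw [mul_pow, norm_sq_eq_sum, norm_sq_eq_sum, frobInner_eq_sum]
    simp only [← Finset.sum_product']
    exact Finset.sum_mul_sq_le_sq_mul_sq _ _ _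
  exact abs_le_of_sq_le_sq h (by positivity)

theorem frobInner_le (M N : Matrix m n ℝ) : frobInner M N ≤ ‖M‖ * ‖N‖ :=
  (le_abs_self _).trans (abs_frobInner_le M N)

theorem neg_le_frobInner (M N : Matrix m n ℝ) : -(‖M‖ * ‖N‖) ≤ frobInner M N :=
  (abs_le.mp (abs_frobInner_le M N)).1

theorem norm_sub_sq_frob (M N : Matrix m n ℝ) :
    ‖M - N‖ ^ 2 = ‖M‖ ^ 2 - 2 * frobInner M N + ‖N‖ ^ 2 := by
  rw [← frobInner_self, frobInner_sub_left, frobInner_sub_right, frobInner_sub_right,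
    frobInner_self, frobInner_self, frobInner_comm N M]; ring

theorem norm_transpose_frob (M : Matrix m n ℝ) : ‖Mᵀ‖ = ‖M‖ := Matrix.frobenius_norm_transpose M

theorem frobInner_kronecker (A C : Matrix l m ℝ) (B D : Matrix n o ℝ) :
    frobInner (A ⊗ₖ B) (C ⊗ₖ D) = frobInner A C * frobInner B D := by
  simp only [frobInner]
  rw [← Matrix.kroneckerMap_transpose, ← Matrix.mul_kronecker_mul, Matrix.trace_kronecker]

theorem norm_kronecker (A : Matrix l m ℝ) (B : Matrix n o ℝ) : ‖A ⊗ₖ B‖ = ‖A‖ * ‖B‖ := by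
  have h : ‖A ⊗ₖ B‖ ^ 2 = (‖A‖ * ‖B‖) ^ 2 := by
    rw [mul_pow, ← frobInner_self, ← frobInner_self, ← frobInner_self, frobInner_kronecker]
  exact (sq_eq_sq₀ (norm_nonneg _) (by positivity)).mp h

theorem norm_fromCols_sq (A : Matrix l m ℝ) (B : Matrix l n ℝ) :
    ‖Matrix.fromCols A B‖ ^ 2 = ‖A‖ ^ 2 + ‖B‖ ^ 2 := by
  simp [norm_sq_eq_sum, Finset.sum_add_distrib]

theorem norm_fromBlocks_sq (A : Matrix l m ℝ) (B : Matrix l n ℝ) (C : Matrix o m ℝ)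
    (D : Matrix o n ℝ) : ‖Matrix.fromBlocks A B C D‖ ^ 2 =
      ‖A‖ ^ 2 + ‖B‖ ^ 2 + ‖C‖ ^ 2 + ‖D‖ ^ 2 := by
  simp [norm_sq_eq_sum, Finset.sum_add_distrib]; ring

/-- `‖U‖ ≤ c` in operator norm, expressed through Frobenius norms of products. -/
def OpBound (U : Matrix m n ℝ) (c : ℝ) : Prop :=
  ∀ ⦃k : Type⦄ [Fintype k] (X : Matrix n k ℝ), ‖U * X‖ ≤ c * ‖X‖

theorem opBound_norm (U : Matrix m n ℝ) : OpBound U ‖U‖ := fun _ _ X =>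
  Matrix.frobenius_norm_mul U X

theorem OpBound.mono {U : Matrix m n ℝ} {c c' : ℝ} (h : OpBound U c) (hc : c ≤ c') :
    OpBound U c' := fun _ _ X => (h X).trans (by gcongr)

theorem OpBound.add {U V : Matrix m n ℝ} {c c' : ℝ} (h : OpBound U c) (h' : OpBound V c') :
    OpBound (U + V) (c + c') := fun _ _ X => by
  rw [Matrix.add_mul, add_mul]; exact (norm_add_le _ _).trans (add_le_add (h X) (h' X))

theorem OpBound.smul {U : Matrix m n ℝ} {c : ℝ} (h : OpBound U c) (t : ℝ) :
    OpBound (t • U) (|t| * c) := fun _ _ X => by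
  rw [Matrix.smul_mul, norm_smul, Real.norm_eq_abs, mul_assoc]; gcongr; exact h X

end Frobenius

section FrobeniusType

variable {m n : Type} {l k : Type*} [Fintype m] [Fintype n] [Fintype l] [Fintype k]

/-- The Frobenius norm of such a `U` is `b` times the square root of its number of columns; the
operator bound avoids that factor and keeps later constants free of dimensions. -/
theorem opBound_of_gram [DecidableEq n] {U : Matrix m n ℝ} {b : ℝ} (hb : 0 ≤ b)
    (h : Uᵀ * U = b ^ 2 • (1 : Matrix n n ℝ)) : OpBound U b := fun k _ X => by
  have : ‖U * X‖ ^ 2 = (b * ‖X‖) ^ 2 := by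
    rw [← frobInner_self, frobInner_mul_left, ← Matrix.mul_assoc, h, Matrix.smul_mul,
      Matrix.one_mul, frobInner_smul_right, frobInner_self]; ring
  exact ((sq_eq_sq₀ (norm_nonneg _) (by positivity)).mp this).le

theorem norm_mul_of_gram [DecidableEq n] {U : Matrix m n ℝ} {b : ℝ} (hb : 0 ≤ b)
    (h : Uᵀ * U = b ^ 2 • (1 : Matrix n n ℝ)) (X : Matrix n k ℝ) : ‖U * X‖ = b * ‖X‖ := by
  have : ‖U * X‖ ^ 2 = (b * ‖X‖) ^ 2 := by
    rw [← frobInner_self, frobInner_mul_left, ← Matrix.mul_assoc, h, Matrix.smul_mul,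
      Matrix.one_mul, frobInner_smul_right, frobInner_self]; ring
  exact (sq_eq_sq₀ (norm_nonneg _) (by positivity)).mp this

theorem norm_mul_transpose_of_gram [DecidableEq n] {U : Matrix m n ℝ} {b : ℝ} (hb : 0 ≤ b)
    (h : Uᵀ * U = b ^ 2 • (1 : Matrix n n ℝ)) (X : Matrix k n ℝ) : ‖X * Uᵀ‖ = b * ‖X‖ := by
  rw [← norm_transpose_frob, Matrix.transpose_mul, Matrix.transpose_transpose,
    norm_mul_of_gram hb h, norm_transpose_frob]

/-- By duality: `‖Uᵀ X‖²` is the inner product of `X` with `U Uᵀ X`, and one factor `‖Uᵀ X‖`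
cancels. -/
theorem OpBound.transpose {U : Matrix m n ℝ} {c : ℝ} (hc : 0 ≤ c) (h : OpBound U c) :
    OpBound Uᵀ c := fun k _ X => by
  have h1 : ‖Uᵀ * X‖ ^ 2 ≤ c * ‖Uᵀ * X‖ * ‖X‖ := by
    rw [← frobInner_self, frobInner_mul_left, Matrix.transpose_transpose, frobInner_comm]
    exact (frobInner_le _ _).trans (by gcongr; exact h _)
  by_cases h0 : ‖Uᵀ * X‖ = 0
  · rw [h0]; positivity
  · have : 0 < ‖Uᵀ * X‖ := lt_of_le_of_ne (norm_nonneg _) (Ne.symm h0)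
    nlinarith

theorem OpBound.mul_right {n k : Type} [Fintype n] [Fintype k] {V : Matrix m n ℝ} {c : ℝ}
    (h : OpBound V c) (X : Matrix k n ℝ) : ‖X * Vᵀ‖ ≤ c * ‖X‖ := by
  rw [← norm_transpose_frob, Matrix.transpose_mul, Matrix.transpose_transpose,
    ← norm_transpose_frob X]
  exact h _

theorem OpBound.mul_left {k : Type} [Fintype k] {V : Matrix m n ℝ} {c : ℝ} (hc : 0 ≤ c)
    (h : OpBound V c) (X : Matrix k m ℝ) : ‖X * V‖ ≤ c * ‖X‖ := by
  simpa using (h.transpose hc).mul_right X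

theorem norm_sandwich_le {m n k l : Type} [Fintype m] [Fintype n] [Fintype k] [Fintype l]
    {U : Matrix m n ℝ} {V : Matrix l k ℝ} {a c e : ℝ} (ha : 0 ≤ a) (hc : 0 ≤ c)
    (hU : OpBound U a) (hV : OpBound V c)
    {D : Matrix n k ℝ} (hD : ‖D‖ ≤ e) : ‖U * D * Vᵀ‖ ≤ a * e * c := by
  calc ‖U * D * Vᵀ‖ ≤ c * ‖U * D‖ := hV.mul_right _
    _ ≤ c * (a * e) := by gcongr; exact (hU D).trans (by gcongr)
    _ = _ := by ring

end FrobeniusType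

end MARCF

/-! ### The parameter as a vector space and the Taylor expansion of the coefficient matrix. -/

namespace MARCF

namespace Comp

variable {p d s : ℕ}

/-- A component as a tuple of matrices. -/
def equivProd (p d s : ℕ) : Comp p d s ≃ Matrix (Fin p) (Fin d) ℝ × Matrix (Fin p) (Fin s) ℝ ×
    Matrix (Fin p) (Fin s) ℝ × Matrix (Fin d ⊕ Fin s) (Fin d ⊕ Fin s) ℝ where
  toFun F := (F.C, F.R, F.P, F.D)
  invFun x := ⟨x.1, x.2.1, x.2.2.1, x.2.2.2⟩
  left_inv _ := rfl
  right_inv _ := rfl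

/-- The transported structure makes `Params` a real vector space in which a gradient step is
definitionally `Θ - η • grad`. -/
noncomputable instance : AddCommGroup (Comp p d s) := (equivProd p d s).addCommGroup

noncomputable instance : Module ℝ (Comp p d s) := (equivProd p d s).module ℝ

attribute [ext] Comp

@[simp] theorem add_C (F G : Comp p d s) : (F + G).C = F.C + G.C := rfl
@[simp] theorem add_R (F G : Comp p d s) : (F + G).R = F.R + G.R := rfl
@[simp] theorem add_P (F G : Comp p d s) : (F + G).P = F.P + G.P := rfl
@[simp] theorem add_D (F G : Comp p d s) : (F + G).D = F.D + G.D := rfl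
@[simp] theorem sub_C (F G : Comp p d s) : (F - G).C = F.C - G.C := rfl
@[simp] theorem sub_R (F G : Comp p d s) : (F - G).R = F.R - G.R := rfl
@[simp] theorem sub_P (F G : Comp p d s) : (F - G).P = F.P - G.P := rfl
@[simp] theorem sub_D (F G : Comp p d s) : (F - G).D = F.D - G.D := rfl
@[simp] theorem smul_C (t : ℝ) (F : Comp p d s) : (t • F).C = t • F.C := rfl
@[simp] theorem smul_R (t : ℝ) (F : Comp p d s) : (t • F).R = t • F.R := rfl
@[simp] theorem smul_P (t : ℝ) (F : Comp p d s) : (t • F).P = t • F.P := rfl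
@[simp] theorem smul_D (t : ℝ) (F : Comp p d s) : (t • F).D = t • F.D := rfl
@[simp] theorem zero_D : (0 : Comp p d s).D = 0 := rfl

@[simp] theorem add_U (F G : Comp p d s) : (F + G).U = F.U + G.U := by
  ext i (j | j) <;> simp [U]
@[simp] theorem add_V (F G : Comp p d s) : (F + G).V = F.V + G.V := by
  ext i (j | j) <;> simp [V]
@[simp] theorem sub_U (F G : Comp p d s) : (F - G).U = F.U - G.U := by
  ext i (j | j) <;> simp [U]
@[simp] theorem sub_V (F G : Comp p d s) : (F - G).V = F.V - G.V := by
  ext i (j | j) <;> simp [V]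
@[simp] theorem smul_U (t : ℝ) (F : Comp p d s) : (t • F).U = t • F.U := by
  ext i (j | j) <;> simp [U]
@[simp] theorem smul_V (t : ℝ) (F : Comp p d s) : (t • F).V = t • F.V := by
  ext i (j | j) <;> simp [V]

/-- First-order term of `coef` at `F` in the direction `X`. -/
noncomputable def coefD1 (F X : Comp p d s) : Matrix (Fin p) (Fin p) ℝ :=
  X.U * F.D * F.Vᵀ + F.U * X.D * F.Vᵀ + F.U * F.D * X.Vᵀ

/-- Second-order term of `coef` at `F` in the direction `X`. -/
noncomputable def coefD2 (F X : Comp p d s) : Matrix (Fin p) (Fin p) ℝ :=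
  X.U * X.D * F.Vᵀ + X.U * F.D * X.Vᵀ + F.U * X.D * X.Vᵀ

/-- `coef` is trilinear in `(U, D, V)`, so the expansion stops at degree three without remainder.
This exactness is what makes finite-difference formulas for `coefD1` and `coefD2` identities. -/
theorem coef_add_smul (F X : Comp p d s) (t : ℝ) :
    (F + t • X).coef = F.coef + t • F.coefD1 X + t ^ 2 • F.coefD2 X + t ^ 3 • X.coef := by
  simp only [coef, coefD1, coefD2, add_U, smul_U, add_V, smul_V, add_D, smul_D,
    Matrix.transpose_add, Matrix.transpose_smul, Matrix.add_mul, Matrix.mul_add, Matrix.smul_mul,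
    Matrix.mul_smul, smul_add, smul_smul]
  module

theorem coefD1_add (F X X' : Comp p d s) : F.coefD1 (X + X') = F.coefD1 X + F.coefD1 X' := by
  simp only [coefD1, add_U, add_V, add_D, Matrix.transpose_add, Matrix.add_mul, Matrix.mul_add]
  abel

theorem coefD1_smul (F X : Comp p d s) (t : ℝ) : F.coefD1 (t • X) = t • F.coefD1 X := by
  simp only [coefD1, smul_U, smul_V, smul_D, Matrix.transpose_smul, Matrix.smul_mul,
    Matrix.mul_smul, smul_add]

/-- Sum of the squared Frobenius norms of the components. -/
noncomputable def nsq (F : Comp p d s) : ℝ := ‖F.C‖ ^ 2 + ‖F.R‖ ^ 2 + ‖F.P‖ ^ 2 + ‖F.D‖ ^ 2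

/-- The inner product for which `nsq` is the squared norm. -/
noncomputable def pairing (F G : Comp p d s) : ℝ :=
  frobInner F.C G.C + frobInner F.R G.R + frobInner F.P G.P + frobInner F.D G.D

theorem nsq_nonneg (F : Comp p d s) : 0 ≤ F.nsq := by unfold nsq; positivity

theorem norm_U_sq_le (F : Comp p d s) : ‖F.U‖ ^ 2 ≤ F.nsq := by
  rw [U, norm_fromCols_sq, nsq]; nlinarith [sq_nonneg ‖F.P‖, sq_nonneg ‖F.D‖]

theorem norm_V_sq_le (F : Comp p d s) : ‖F.V‖ ^ 2 ≤ F.nsq := by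
  rw [V, norm_fromCols_sq, nsq]; nlinarith [sq_nonneg ‖F.R‖, sq_nonneg ‖F.D‖]

theorem norm_D_sq_le (F : Comp p d s) : ‖F.D‖ ^ 2 ≤ F.nsq := by
  rw [nsq]; nlinarith [sq_nonneg ‖F.R‖, sq_nonneg ‖F.C‖, sq_nonneg ‖F.P‖]

theorem nsq_sub_smul (F G : Comp p d s) (t : ℝ) :
    (F - t • G).nsq = F.nsq - 2 * t * G.pairing F + t ^ 2 * G.nsq := by
  simp only [nsq, pairing, sub_C, sub_R, sub_P, sub_D, smul_C, smul_R, smul_P, smul_D,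
    norm_sub_sq_frob, frobInner_smul_right, norm_smul, mul_pow, Real.norm_eq_abs, sq_abs,
    frobInner_comm G.C, frobInner_comm G.R, frobInner_comm G.P, frobInner_comm G.D]
  ring

theorem pairing_self (F : Comp p d s) : F.pairing F = F.nsq := by
  simp [pairing, nsq, frobInner_self]

end Comp

/-! ### Entrywise calculus for matrix functions. -/

section EntrywiseDerivative

variable {l m n o : Type*} [Fintype l] [Fintype m] [Fintype n] [Fintype o]

/-- The matrix-valued function `M` has the entrywise derivative `M'` at `0`. -/
def EDeriv (M : ℝ → Matrix m n ℝ) (M' : Matrix m n ℝ) : Prop :=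
  ∀ i j, HasDerivAt (fun t => M t i j) (M' i j) 0

omit [Fintype m] [Fintype n] in
theorem eDeriv_const (M : Matrix m n ℝ) : EDeriv (fun _ => M) 0 := fun _ _ => hasDerivAt_const _ _

omit [Fintype m] [Fintype n] in
theorem eDeriv_line (M X : Matrix m n ℝ) : EDeriv (fun t => M + t • X) X := fun i j => by
  simpa using ((hasDerivAt_id (0 : ℝ)).mul_const (X i j)).const_add (M i j)

omit [Fintype m] [Fintype n] in
theorem EDeriv.sub {M N : ℝ → Matrix m n ℝ} {M' N' : Matrix m n ℝ} (h : EDeriv M M')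
    (h' : EDeriv N N') : EDeriv (fun t => M t - N t) (M' - N') := fun i j => (h i j).sub (h' i j)

omit [Fintype m] [Fintype n] in
theorem EDeriv.transpose {M : ℝ → Matrix m n ℝ} {M' : Matrix m n ℝ} (h : EDeriv M M') :
    EDeriv (fun t => (M t)ᵀ) M'ᵀ := fun i j => h j i

omit [Fintype l] [Fintype n] in
theorem EDeriv.mul {M : ℝ → Matrix l m ℝ} {N : ℝ → Matrix m n ℝ} {M' : Matrix l m ℝ}
    {N' : Matrix m n ℝ} (h : EDeriv M M') (h' : EDeriv N N') :
    EDeriv (fun t => M t * N t) (M' * N 0 + M 0 * N') := fun i j => by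
  simp only [Matrix.mul_apply, Matrix.add_apply, ← Finset.sum_add_distrib]
  exact HasDerivAt.fun_sum fun k _ => (h i k).mul (h' k j)

omit [Fintype l] [Fintype m] [Fintype n] [Fintype o] in
theorem EDeriv.kronecker {M : ℝ → Matrix l m ℝ} {N : ℝ → Matrix n o ℝ} {M' : Matrix l m ℝ}
    {N' : Matrix n o ℝ} (h : EDeriv M M') (h' : EDeriv N N') :
    EDeriv (fun t => M t ⊗ₖ N t) (M' ⊗ₖ N 0 + M 0 ⊗ₖ N') := fun i j =>
  (h i.1 j.1).mul (h' i.2 j.2)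

theorem EDeriv.norm_sq {M : ℝ → Matrix m n ℝ} {M' : Matrix m n ℝ} (h : EDeriv M M') :
    HasDerivAt (fun t => ‖M t‖ ^ 2) (2 * frobInner (M 0) M') 0 := by
  simp only [norm_sq_eq_sum, frobInner_eq_sum, Finset.mul_sum]
  refine HasDerivAt.fun_sum fun i _ => HasDerivAt.fun_sum fun j _ => ?_
  have := (h i j).fun_pow 2
  simpa [mul_assoc] using this

/-- Partial derivatives alone do not determine directional ones. The linear form `L` supplies
linearity in the direction, so it suffices to compare both sides on the matrices with a single
nonzero entry. -/
theorem frobInner_matGrad [DecidableEq m] [DecidableEq n] {f : Matrix m n ℝ → ℝ}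
    {M : Matrix m n ℝ} (L : Matrix m n ℝ →ₗ[ℝ] ℝ)
    (h : ∀ N, HasDerivAt (fun t : ℝ => f (M + t • N)) (L N) 0) (N : Matrix m n ℝ) :
    frobInner (matGrad f M) N = L N := by
  have h1 : ∀ i j, matGrad f M i j = L (Matrix.single i j 1) := fun i j => by
    simp only [matGrad, Matrix.of_apply]
    rw [← (h (Matrix.single i j 1)).deriv]
    simp
  conv_rhs => rw [Matrix.matrix_eq_sum_single N]
  simp only [map_sum, frobInner_eq_sum, h1]
  refine Finset.sum_congr rfl fun i _ => Finset.sum_congr rfl fun j _ => ?_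
  rw [← mul_one (N i j), ← smul_eq_mul (N i j), ← Matrix.smul_single, map_smul, smul_eq_mul,
    smul_eq_mul]
  ring

end EntrywiseDerivative

end MARCF

/-! ### The gradient of the regularized objective. -/

namespace MARCF

noncomputable section

section Params

variable {p d s : Fin 2 → ℕ}

/-- Sum of the squared Frobenius norms of all components. -/
def nsq (Θ : Params p d s) : ℝ := ∑ i, (Θ i).nsq

/-- The inner product for which `nsq` is the squared norm. -/
def pairing (Θ Θ' : Params p d s) : ℝ := ∑ i, (Θ i).pairing (Θ' i)

theorem nsq_nonneg (Θ : Params p d s) : 0 ≤ nsq Θ := Finset.sum_nonneg fun i _ => (Θ i).nsq_nonneg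

theorem pairing_self (Θ : Params p d s) : pairing Θ Θ = nsq Θ := by
  simp [pairing, nsq, Comp.pairing_self]

theorem nsq_sub_smul (Θ G : Params p d s) (t : ℝ) :
    nsq (Θ - t • G) = nsq Θ - 2 * t * pairing G Θ + t ^ 2 * nsq G := by
  simp only [nsq, pairing, Pi.sub_apply, Pi.smul_apply, Comp.nsq_sub_smul, Fin.sum_univ_two]
  ring

theorem comp_nsq_le (Θ : Params p d s) (i : Fin 2) : (Θ i).nsq ≤ nsq Θ :=
  Finset.single_le_sum (f := fun i => (Θ i).nsq) (fun i _ => (Θ i).nsq_nonneg) (Finset.mem_univ i)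

/-- First-order term of `kron` at `Θ` in the direction `X`. -/
def kronD1 (Θ X : Params p d s) : Matrix (Fin (p 1) × Fin (p 0)) (Fin (p 1) × Fin (p 0)) ℝ :=
  (Θ 1).coefD1 (X 1) ⊗ₖ (Θ 0).coef + (Θ 1).coef ⊗ₖ (Θ 0).coefD1 (X 0)

variable {T : ℕ}

/-- The matrix whose columns are the scaled lagged observations. -/
def lagMat (Y : Fin (T + 1) → Matrix (Fin (p 0)) (Fin (p 1)) ℝ) :
    Matrix (Fin (p 1) × Fin (p 0)) (Fin T) ℝ :=
  Matrix.of fun i t => (√(T : ℝ))⁻¹ * (Y t.castSucc).vec i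

/-- The matrix whose columns are the scaled responses. -/
def respMat (Y : Fin (T + 1) → Matrix (Fin (p 0)) (Fin (p 1)) ℝ) :
    Matrix (Fin (p 1) × Fin (p 0)) (Fin T) ℝ :=
  Matrix.of fun i t => (√(T : ℝ))⁻¹ * (Y t.succ).vec i

/-- Collecting the vectorized observations as columns turns the sum over time into one Frobenius
norm, so the loss is visibly quadratic in `A`. -/
theorem lossKron_eq (Y : Fin (T + 1) → Matrix (Fin (p 0)) (Fin (p 1)) ℝ)
    (A : Matrix (Fin (p 1) × Fin (p 0)) (Fin (p 1) × Fin (p 0)) ℝ) :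
    lossKron Y A = 1 / 2 * ‖respMat Y - A * lagMat Y‖ ^ 2 := by
  have h : ∀ i t, (respMat Y - A * lagMat Y) i t =
      (√(T : ℝ))⁻¹ * ((Y t.succ).vec - A *ᵥ (Y t.castSucc).vec) i := by
    intro i t
    simp only [respMat, lagMat, Matrix.sub_apply, Matrix.of_apply, Matrix.mul_apply, Pi.sub_apply,
      Matrix.mulVec, dotProduct, mul_sub, Finset.mul_sum]
    congr 1
    exact Finset.sum_congr rfl fun k _ => by ring
  rw [norm_sq_eq_sum, Finset.sum_comm, lossKron, Finset.mul_sum, Finset.mul_sum]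
  refine Finset.sum_congr rfl fun t _ => ?_
  rw [EuclideanSpace.norm_sq_eq, Finset.mul_sum, Finset.mul_sum]
  refine Finset.sum_congr rfl fun i _ => ?_
  rw [h, mul_pow, inv_pow, Real.sq_sqrt (Nat.cast_nonneg T), Real.norm_eq_abs, sq_abs]
  rw [one_div, mul_inv]; ring

theorem loss_eq (Y : Fin (T + 1) → Matrix (Fin (p 0)) (Fin (p 1)) ℝ) (Θ : Params p d s) :
    loss Y Θ = lossKron Y (kron Θ) := by
  rw [loss, lossKron]
  congr 1
  refine Finset.sum_congr rfl fun t _ => ?_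
  rw [kron, Matrix.kronecker_mulVec_vec, ← Matrix.vec_sub, EuclideanSpace.norm_sq_eq,
    norm_sq_eq_sum, Fintype.sum_prod_type, Finset.sum_comm]
  simp [Matrix.vec]

theorem frobInner_matGrad_lossKron (Y : Fin (T + 1) → Matrix (Fin (p 0)) (Fin (p 1)) ℝ)
    (A N : Matrix (Fin (p 1) × Fin (p 0)) (Fin (p 1) × Fin (p 0)) ℝ) :
    frobInner (matGrad (lossKron Y) A) N
      = -frobInner (respMat Y - A * lagMat Y) (N * lagMat Y) := by
  let L : Matrix (Fin (p 1) × Fin (p 0)) (Fin (p 1) × Fin (p 0)) ℝ →ₗ[ℝ] ℝ :=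
    { toFun N := -frobInner (respMat Y - A * lagMat Y) (N * lagMat Y)
      map_add' N N' := by rw [Matrix.add_mul, frobInner_add_right]; ring
      map_smul' t N := by
        rw [Matrix.smul_mul, frobInner_smul_right, RingHom.id_apply, smul_eq_mul]; ring }
  refine frobInner_matGrad L (fun N => ?_) N
  simp only [lossKron_eq]
  have h := (((eDeriv_const (respMat Y)).sub
    ((eDeriv_line A N).mul (eDeriv_const (lagMat Y)))).norm_sq).const_mul (1 / 2)
  refine h.congr_deriv ?_
  change _ = -frobInner (respMat Y - A * lagMat Y) (N * lagMat Y)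
  simp only [zero_smul, add_zero, Matrix.mul_zero, zero_sub, frobInner_neg_right]
  ring

/-- The directional derivative of `‖Uᵀ U - b² I‖² / 2` for `U` varying in the direction `X`. -/
def gramDeriv {m n : Type*} [Fintype m] [Fintype n] [DecidableEq n] (b : ℝ) (U X : Matrix m n ℝ) :
    ℝ := frobInner (Uᵀ * U - b ^ 2 • 1) (Xᵀ * U + Uᵀ * X)

/-- The directional derivative of `objective` at `Θ` in the direction `X`. -/
def objDeriv (Y : Fin (T + 1) → Matrix (Fin (p 0)) (Fin (p 1)) ℝ) (lam₁ lam₂ b : ℝ)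
    (Θ X : Params p d s) : ℝ :=
  frobInner (matGrad (lossKron Y) (kron Θ)) (kronD1 Θ X)
    + lam₁ * (‖(Θ 0).coef‖ ^ 2 - ‖(Θ 1).coef‖ ^ 2)
      * (frobInner (Θ 0).coef ((Θ 0).coefD1 (X 0)) - frobInner (Θ 1).coef ((Θ 1).coefD1 (X 1)))
    + lam₂ * ∑ i, (gramDeriv b (Θ i).U (X i).U + gramDeriv b (Θ i).V (X i).V)

theorem eDeriv_gram {m n : Type*} [Fintype m] [Fintype n] [DecidableEq n] (b : ℝ)
    (U X : Matrix m n ℝ) :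
    HasDerivAt (fun t : ℝ => ‖(U + t • X)ᵀ * (U + t • X) - b ^ 2 • 1‖ ^ 2)
      (2 * gramDeriv b U X) 0 := by
  have h := (((eDeriv_line U X).transpose.mul (eDeriv_line U X)).sub
    (eDeriv_const (b ^ 2 • (1 : Matrix n n ℝ)))).norm_sq
  refine h.congr_deriv ?_
  simp [gramDeriv]

theorem eDeriv_coef {p d s : ℕ} (F X : Comp p d s) :
    EDeriv (fun t => (F + t • X).coef) (F.coefD1 X) := by
  simp only [Comp.coef, Comp.add_U, Comp.add_V, Comp.add_D, Comp.smul_U, Comp.smul_V, Comp.smul_D]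
  have h := (((eDeriv_line F.U X.U).mul (eDeriv_line F.D X.D)).mul
    (eDeriv_line F.V X.V).transpose)
  intro i j
  refine (h i j).congr_deriv ?_
  simp [Comp.coefD1, Matrix.add_mul]

theorem hasDerivAt_objective (Y : Fin (T + 1) → Matrix (Fin (p 0)) (Fin (p 1)) ℝ)
    (lam₁ lam₂ b : ℝ) (Θ X : Params p d s) :
    HasDerivAt (fun t : ℝ => objective Y lam₁ lam₂ b (Θ + t • X))
      (objDeriv Y lam₁ lam₂ b Θ X) 0 := by
  unfold objective objDeriv
  have hk : EDeriv (fun t : ℝ => kron (Θ + t • X)) (kronD1 Θ X) := by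
    intro i j
    refine (((eDeriv_coef (Θ 1) (X 1)).kronecker (eDeriv_coef (Θ 0) (X 0))) i j).congr_deriv ?_
    simp [kronD1]
  refine HasDerivAt.add (HasDerivAt.add ?_ ?_) ?_
  · simp only [loss_eq, lossKron_eq, frobInner_matGrad_lossKron]
    have h := (((eDeriv_const (respMat Y)).sub
      (hk.mul (eDeriv_const (lagMat Y)))).norm_sq).const_mul (1 / 2)
    refine h.congr_deriv ?_
    simp only [zero_smul, add_zero, Matrix.mul_zero, zero_sub, frobInner_neg_right]
    ring
  · have h := ((((eDeriv_coef (Θ 0) (X 0)).norm_sq).sub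
      ((eDeriv_coef (Θ 1) (X 1)).norm_sq)).fun_pow 2).const_mul (lam₁ / 4)
    refine h.congr_deriv ?_
    simp only [zero_smul, add_zero, Pi.sub_apply]
    push_cast
    ring
  · have h : ∀ i ∈ Finset.univ, HasDerivAt (fun t : ℝ =>
        ‖((Θ + t • X) i).Uᵀ * ((Θ + t • X) i).U - b ^ 2 • 1‖ ^ 2
        + ‖((Θ + t • X) i).Vᵀ * ((Θ + t • X) i).V - b ^ 2 • 1‖ ^ 2)
        (2 * gramDeriv b (Θ i).U (X i).U + 2 * gramDeriv b (Θ i).V (X i).V) 0 := fun i _ => by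
      simp only [Pi.add_apply, Pi.smul_apply, Comp.add_U, Comp.add_V, Comp.smul_U, Comp.smul_V]
      exact (eDeriv_gram b (Θ i).U (X i).U).add (eDeriv_gram b (Θ i).V (X i).V)
    refine ((HasDerivAt.fun_sum h).const_mul (lam₂ / 2)).congr_deriv ?_
    simp only [← mul_add, ← Finset.mul_sum]
    ring

theorem kronD1_add (Θ X X' : Params p d s) : kronD1 Θ (X + X') = kronD1 Θ X + kronD1 Θ X' := by
  simp only [kronD1, Pi.add_apply, Comp.coefD1_add, Matrix.add_kronecker, Matrix.kronecker_add]
  abel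

theorem kronD1_smul (Θ X : Params p d s) (t : ℝ) : kronD1 Θ (t • X) = t • kronD1 Θ X := by
  simp only [kronD1, Pi.smul_apply, Comp.coefD1_smul, Matrix.smul_kronecker, Matrix.kronecker_smul,
    smul_add]

theorem gramDeriv_add {m n : Type*} [Fintype m] [Fintype n] [DecidableEq n] (b : ℝ)
    (U X X' : Matrix m n ℝ) : gramDeriv b U (X + X') = gramDeriv b U X + gramDeriv b U X' := by
  simp only [gramDeriv, ← frobInner_add_right, Matrix.transpose_add, Matrix.add_mul, Matrix.mul_add]
  congr 1; abel

theorem gramDeriv_smul {m n : Type*} [Fintype m] [Fintype n] [DecidableEq n] (b t : ℝ)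
    (U X : Matrix m n ℝ) : gramDeriv b U (t • X) = t * gramDeriv b U X := by
  simp only [gramDeriv, ← frobInner_smul_right, Matrix.transpose_smul, Matrix.smul_mul,
    Matrix.mul_smul, smul_add]

/-- `objDeriv` as a linear form. -/
def objDerivLin (Y : Fin (T + 1) → Matrix (Fin (p 0)) (Fin (p 1)) ℝ) (lam₁ lam₂ b : ℝ)
    (Θ : Params p d s) : Params p d s →ₗ[ℝ] ℝ where
  toFun := objDeriv Y lam₁ lam₂ b Θ
  map_add' X X' := by
    simp only [objDeriv, kronD1_add, frobInner_add_right, Pi.add_apply, Comp.coefD1_add,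
      Comp.add_U, Comp.add_V, gramDeriv_add, Fin.sum_univ_two]
    ring
  map_smul' t X := by
    simp only [objDeriv, kronD1_smul, frobInner_smul_right, Pi.smul_apply, Comp.coefD1_smul,
      Comp.smul_U, Comp.smul_V, gramDeriv_smul, Fin.sum_univ_two, RingHom.id_apply, smul_eq_mul]
    ring

/-- The gradient of the objective. -/
def grad (Y : Fin (T + 1) → Matrix (Fin (p 0)) (Fin (p 1)) ℝ) (lam₁ lam₂ b : ℝ)
    (Θ : Params p d s) : Params p d s := fun i =>
  { C := matGrad (fun M =>
      objective Y lam₁ lam₂ b (Function.update Θ i { Θ i with C := M })) (Θ i).C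
    R := matGrad (fun M =>
      objective Y lam₁ lam₂ b (Function.update Θ i { Θ i with R := M })) (Θ i).R
    P := matGrad (fun M =>
      objective Y lam₁ lam₂ b (Function.update Θ i { Θ i with P := M })) (Θ i).P
    D := matGrad (fun M =>
      objective Y lam₁ lam₂ b (Function.update Θ i { Θ i with D := M })) (Θ i).D }

theorem gdStep_eq (Y : Fin (T + 1) → Matrix (Fin (p 0)) (Fin (p 1)) ℝ) (lam₁ lam₂ b η : ℝ)
    (Θ : Params p d s) :
    gdStep Y lam₁ lam₂ b η Θ = Θ - η • grad Y lam₁ lam₂ b Θ := rfl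

/-- Inclusion of the block `C`. -/
def inC (p d s : ℕ) : Matrix (Fin p) (Fin d) ℝ →ₗ[ℝ] Comp p d s where
  toFun N := ⟨N, 0, 0, 0⟩
  map_add' _ _ := by ext1 <;> simp
  map_smul' _ _ := by ext1 <;> simp

/-- Inclusion of the block `R`. -/
def inR (p d s : ℕ) : Matrix (Fin p) (Fin s) ℝ →ₗ[ℝ] Comp p d s where
  toFun N := ⟨0, N, 0, 0⟩
  map_add' _ _ := by ext1 <;> simp
  map_smul' _ _ := by ext1 <;> simp

/-- Inclusion of the block `P`. -/
def inP (p d s : ℕ) : Matrix (Fin p) (Fin s) ℝ →ₗ[ℝ] Comp p d s where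
  toFun N := ⟨0, 0, N, 0⟩
  map_add' _ _ := by ext1 <;> simp
  map_smul' _ _ := by ext1 <;> simp

/-- Inclusion of the block `D`. -/
def inD (p d s : ℕ) : Matrix (Fin d ⊕ Fin s) (Fin d ⊕ Fin s) ℝ →ₗ[ℝ] Comp p d s where
  toFun N := ⟨0, 0, 0, N⟩
  map_add' _ _ := by ext1 <;> simp
  map_smul' _ _ := by ext1 <;> simp

/-- Updating one block moves along a straight line in `Params`, so its partial gradient is the full
directional derivative restricted to that block. One statement serves `C`, `R`, `P` and `D`. -/
theorem frobInner_matGrad_block {m n : Type*} [Fintype m] [Fintype n] [DecidableEq m]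
    [DecidableEq n] (Y : Fin (T + 1) → Matrix (Fin (p 0)) (Fin (p 1)) ℝ) (lam₁ lam₂ b : ℝ)
    (Θ : Params p d s) (i : Fin 2) (M : Matrix m n ℝ)
    (rep : Matrix m n ℝ → Comp (p i) (d i) (s i))
    (inc : Matrix m n ℝ →ₗ[ℝ] Comp (p i) (d i) (s i))
    (h : ∀ (t : ℝ) N, rep (M + t • N) = Θ i + t • inc N) (N : Matrix m n ℝ) :
    frobInner (matGrad (fun M => objective Y lam₁ lam₂ b (Function.update Θ i (rep M))) M) N =
      objDerivLin Y lam₁ lam₂ b Θ (Pi.single i (inc N)) := by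
  refine frobInner_matGrad (objDerivLin Y lam₁ lam₂ b Θ ∘ₗ
    LinearMap.single ℝ (fun i => Comp (p i) (d i) (s i)) i ∘ₗ inc) (fun N => ?_) N
  have h1 : ∀ t : ℝ, Function.update Θ i (rep (M + t • N)) = Θ + t • (Pi.single i (inc N) : Params p d s) := by
    intro t
    funext j
    by_cases hj : j = i
    · subst hj; simp [h]
    · simp [hj]
  simp only [h1]
  exact hasDerivAt_objective Y lam₁ lam₂ b Θ (Pi.single i (inc N))

theorem pairing_grad (Y : Fin (T + 1) → Matrix (Fin (p 0)) (Fin (p 1)) ℝ) (lam₁ lam₂ b : ℝ)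
    (Θ X : Params p d s) :
    pairing (grad Y lam₁ lam₂ b Θ) X = objDeriv Y lam₁ lam₂ b Θ X := by
  have hX : X = ∑ i : Fin 2, ((Pi.single i (inC _ _ _ (X i).C) : Params p d s)
      + Pi.single i (inR _ _ _ (X i).R)
      + Pi.single i (inP _ _ _ (X i).P) + Pi.single i (inD _ _ _ (X i).D)) := by
    have h1 : ∀ i, X i = inC _ _ _ (X i).C + inR _ _ _ (X i).R + inP _ _ _ (X i).P
        + inD _ _ _ (X i).D := fun i => by
      ext1 <;> simp [inC, inR, inP, inD]
    conv_lhs => rw [← Finset.univ_sum_single X]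
    refine Finset.sum_congr rfl fun i _ => ?_
    conv_lhs => rw [h1 i]
    simp only [Pi.single_add]
  change _ = objDerivLin Y lam₁ lam₂ b Θ X
  conv_rhs => rw [hX]
  simp only [map_sum, map_add, pairing, Comp.pairing]
  refine Finset.sum_congr rfl fun i _ => ?_
  congr 1
  · congr 1
    · congr 1
      · exact frobInner_matGrad_block Y lam₁ lam₂ b Θ i _ (fun M => { Θ i with C := M })
          (inC _ _ _) (fun t N => by ext1 <;> simp [inC]) _
      · exact frobInner_matGrad_block Y lam₁ lam₂ b Θ i _ (fun M => { Θ i with R := M })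
          (inR _ _ _) (fun t N => by ext1 <;> simp [inR]) _
    · exact frobInner_matGrad_block Y lam₁ lam₂ b Θ i _ (fun M => { Θ i with P := M })
        (inP _ _ _) (fun t N => by ext1 <;> simp [inP]) _
  · exact frobInner_matGrad_block Y lam₁ lam₂ b Θ i _ (fun M => { Θ i with D := M })
      (inD _ _ _) (fun t N => by ext1 <;> simp [inD]) _

end Params

end

end MARCF

/-! ### Orthonormal representations, the deviation bound and controlled matrices. -/

namespace MARCF

noncomputable section

/-- Gram–Schmidt is completed to an orthonormal basis of the whole space, so the columns of `X` may
be dependent. -/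
theorem exists_qr {p n : ℕ} (hn : n ≤ p) (X : Matrix (Fin p) (Fin n) ℝ) :
    ∃ (Q : Matrix (Fin p) (Fin n) ℝ) (S : Matrix (Fin n) (Fin n) ℝ),
      Qᵀ * Q = 1 ∧ X = Q * S ∧ ∀ i j, j < i → S i j = 0 := by
  -- The columns are padded by zeros to `p` vectors, the number required for an orthonormal basis.
  let f : Fin p → EuclideanSpace ℝ (Fin p) := fun k =>
    if h : (k : ℕ) < n then WithLp.toLp 2 (fun i => X i ⟨k, h⟩) else 0
  let e := InnerProductSpace.gramSchmidtOrthonormalBasis (𝕜 := ℝ) (by simp) f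
  refine ⟨Matrix.of fun i k => e (Fin.castLE hn k) i,
    Matrix.of fun k j => inner ℝ (e (Fin.castLE hn k)) (f (Fin.castLE hn j)), ?_, ?_, ?_⟩
  · ext a c
    have h := orthonormal_iff_ite.mp e.orthonormal (Fin.castLE hn a) (Fin.castLE hn c)
    simp only [Matrix.mul_apply, Matrix.transpose_apply, Matrix.of_apply, Matrix.one_apply]
    rw [EuclideanSpace.inner_eq_star_dotProduct] at h
    simp only [dotProduct, star_trivial, Fin.castLE_inj] at h
    rw [← h]
    exact Finset.sum_congr rfl fun i _ => mul_comm _ _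
  · ext i j
    have h := congrArg (fun v : EuclideanSpace ℝ (Fin p) => v i) (e.sum_repr (f (Fin.castLE hn j)))
    simp only [WithLp.ofLp_sum, Finset.sum_apply, PiLp.smul_apply, smul_eq_mul,
      OrthonormalBasis.repr_apply_apply] at h
    have hf : (f (Fin.castLE hn j)) i = X i j := by simp [f]
    rw [hf] at h
    rw [← h, Matrix.mul_apply]
    symm
    -- Basis vectors of index at least `n` come after column `j`, so by triangularity they do not
    -- contribute.
    refine Fintype.sum_of_injective (Fin.castLE hn) (Fin.castLE_injective hn) _ _ ?_ ?_
    · intro k hk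
      have hjk : Fin.castLE hn j < k := by
        rw [Fin.lt_def, Fin.val_castLE]
        by_contra hlt
        exact hk ⟨⟨k, by omega⟩, by ext; simp⟩
      rw [InnerProductSpace.gramSchmidtOrthonormalBasis_inv_triangular _ f hjk, zero_mul]
    · intro k
      simp [mul_comm]
  · intro i j hij
    exact InnerProductSpace.gramSchmidtOrthonormalBasis_inv_triangular _ f
      (by rw [Fin.lt_def] at hij ⊢; exact hij)

/-- A triangular factorization of `[C R]` gives `C = E T`, where `T` is orthogonal because both `C`
and `E` have orthonormal columns. Hence `E` can be replaced by `C` itself, which lets `R` and `P` be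
extended from the same `C`. -/
theorem exists_orthonormal_extension {p d s : ℕ} (h : d + s ≤ p) (C : Matrix (Fin p) (Fin d) ℝ)
    (hC : Cᵀ * C = 1) (R : Matrix (Fin p) (Fin s) ℝ) :
    ∃ (Q : Matrix (Fin p) (Fin s) ℝ) (X : Matrix (Fin d) (Fin s) ℝ) (Y : Matrix (Fin s) (Fin s) ℝ),
      Qᵀ * Q = 1 ∧ Cᵀ * Q = 0 ∧ R = C * X + Q * Y := by
  obtain ⟨Q, S, hQ, hS, hT⟩ := exists_qr h ((Matrix.fromCols C R).submatrix id finSumFinEquiv.symm)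
  set Q' := Q.submatrix id (finSumFinEquiv (m := d) (n := s)) with hQ'
  set S' := S.submatrix (finSumFinEquiv (m := d) (n := s)) (finSumFinEquiv (m := d) (n := s))
    with hS'
  have hQ1 : Q'ᵀ * Q' = 1 := by
    rw [hQ', Matrix.transpose_submatrix, ← Matrix.submatrix_mul _ _ _ _ _ Function.bijective_id]
    rw [hQ, Matrix.submatrix_one_equiv]
  have hX : Matrix.fromCols C R = Q' * S' := by
    rw [hQ', hS', Matrix.submatrix_mul_equiv, ← hS]
    ext; simp
  have hS21 : S'.toBlocks₂₁ = 0 := by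
    ext i j
    simp only [hS', Matrix.toBlocks₂₁, Matrix.of_apply, Matrix.submatrix_apply, Matrix.zero_apply]
    apply hT
    simp only [finSumFinEquiv_apply_left, finSumFinEquiv_apply_right, Fin.lt_def, Fin.val_castAdd,
      Fin.val_natAdd]
    omega
  have hQc : Q' = Matrix.fromCols Q'.toCols₁ Q'.toCols₂ := (Matrix.fromCols_toCols Q').symm
  rw [← Matrix.fromBlocks_toBlocks S', hS21, hQc, Matrix.fromCols_mul_fromBlocks] at hX
  rw [hQc, Matrix.transpose_fromCols, Matrix.fromRows_mul_fromCols, ← Matrix.fromBlocks_one,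
    Matrix.fromBlocks_inj] at hQ1
  generalize Q'.toCols₁ = E at *
  generalize Q'.toCols₂ = G at *
  generalize S'.toBlocks₁₁ = T at *
  generalize S'.toBlocks₁₂ = X at *
  generalize S'.toBlocks₂₂ = Y at *
  obtain ⟨h1, h2⟩ := Matrix.fromCols_inj hX
  rw [Matrix.mul_zero, add_zero] at h1
  obtain ⟨e1, e2, e3, e4⟩ := hQ1
  have hT1 : Tᵀ * T = 1 := by
    rw [h1, Matrix.transpose_mul, Matrix.mul_assoc, ← Matrix.mul_assoc Eᵀ, e1, Matrix.one_mul] at hC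
    exact hC
  have hT2 : T * Tᵀ = 1 := mul_eq_one_comm.mp hT1
  refine ⟨G, Tᵀ * X, Y, e4, ?_, ?_⟩
  · rw [h1, Matrix.transpose_mul, Matrix.mul_assoc, e2, Matrix.mul_zero]
  · rw [h2, h1, ← Matrix.mul_assoc, Matrix.mul_assoc E, hT2, Matrix.mul_one]

/-- All triangular factors are absorbed into `D`. Thus the supremum defining `deviation`, taken over
orthonormal columns, controls every coefficient matrix of the model. -/
theorem Comp.exists_orthonormal {p d s : ℕ} (h : d + s ≤ p) (F : Comp p d s) :
    ∃ G : Comp p d s, G.Identified 1 ∧ G.coef = F.coef := by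
  obtain ⟨C, S, hC, hCS, -⟩ := exists_qr (le_of_add_le_left h) F.C
  obtain ⟨R, X, Y, hR, hCR, hRR⟩ := exists_orthonormal_extension h C hC F.R
  obtain ⟨P, Z, W, hP, hCP, hPP⟩ := exists_orthonormal_extension h C hC F.P
  have gram : ∀ Q : Matrix (Fin p) (Fin s) ℝ, Qᵀ * Q = 1 → Cᵀ * Q = 0 →
      (Matrix.fromCols C Q)ᵀ * Matrix.fromCols C Q =
        (1 : ℝ) ^ 2 • (1 : Matrix (Fin d ⊕ Fin s) (Fin d ⊕ Fin s) ℝ) := fun Q h1 h2 => by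
    have h3 : Qᵀ * C = 0 := by
      rw [← Matrix.transpose_transpose (Qᵀ * C), Matrix.transpose_mul, Matrix.transpose_transpose,
        h2, Matrix.transpose_zero]
    rw [Matrix.transpose_fromCols, Matrix.fromRows_mul_fromCols, hC, h1, h2, h3,
      Matrix.fromBlocks_one, one_pow, one_smul]
  refine ⟨⟨C, R, P, Matrix.fromBlocks S X 0 Y * F.D * (Matrix.fromBlocks S Z 0 W)ᵀ⟩,
    ⟨gram R hR hCR, gram P hP hCP⟩, ?_⟩
  have hU : F.U = Matrix.fromCols C R * Matrix.fromBlocks S X 0 Y := by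
    rw [Comp.U, Matrix.fromCols_mul_fromBlocks, Matrix.mul_zero, add_zero, ← hCS, ← hRR]
  have hV : F.V = Matrix.fromCols C P * Matrix.fromBlocks S Z 0 W := by
    rw [Comp.V, Matrix.fromCols_mul_fromBlocks, Matrix.mul_zero, add_zero, ← hCS, ← hPP]
  rw [Comp.coef, Comp.coef, hU, hV]
  simp only [Comp.U, Comp.V, Matrix.transpose_mul, Matrix.mul_assoc]

theorem Comp.norm_coef_of_identified {p d s : ℕ} {b : ℝ} (hb : 0 ≤ b) {F : Comp p d s}
    (h : F.Identified b) : ‖F.coef‖ = b ^ 2 * ‖F.D‖ := by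
  rw [Comp.coef, norm_mul_transpose_of_gram hb h.2, norm_mul_of_gram hb h.1]; ring

theorem Comp.coef_update_D {p d s : ℕ} (F : Comp p d s) (t : ℝ) :
    Comp.coef { F with D := t • F.D } = t • F.coef := by
  change F.U * (t • F.D) * F.Vᵀ = t • (F.U * F.D * F.Vᵀ)
  rw [Matrix.mul_smul, Matrix.smul_mul]

variable {p d s : Fin 2 → ℕ} {T : ℕ}

/-- The parameter with the given two components. -/
def mkParams (F : Comp (p 0) (d 0) (s 0)) (G : Comp (p 1) (d 1) (s 1)) : Params p d s
  | 0 => F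
  | 1 => G

@[simp] theorem mkParams_zero (F : Comp (p 0) (d 0) (s 0)) (G : Comp (p 1) (d 1) (s 1)) :
    mkParams F G 0 = F := rfl

@[simp] theorem mkParams_one (F : Comp (p 0) (d 0) (s 0)) (G : Comp (p 1) (d 1) (s 1)) :
    mkParams F G 1 = G := rfl

theorem kron_mkParams (F : Comp (p 0) (d 0) (s 0)) (G : Comp (p 1) (d 1) (s 1)) :
    kron (mkParams F G) = G.coef ⊗ₖ F.coef := rfl

theorem norm_kron (Θ : Params p d s) : ‖kron Θ‖ = ‖(Θ 1).coef‖ * ‖(Θ 0).coef‖ :=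
  norm_kronecker _ _

theorem bddAbove_deviation (Y : Fin (T + 1) → Matrix (Fin (p 0)) (Fin (p 1)) ℝ)
    (A : Matrix (Fin (p 1) × Fin (p 0)) (Fin (p 1) × Fin (p 0)) ℝ) :
    BddAbove {x : ℝ | ∃ F : Params p d s, (∀ i, (F i).Identified 1 ∧ ‖(F i).D‖ = 1) ∧
      x = frobInner (matGrad (lossKron Y) A) (kron F)} := by
  refine ⟨‖matGrad (lossKron Y) A‖, ?_⟩
  rintro x ⟨F, hF, rfl⟩
  refine (frobInner_le _ _).trans ?_
  rw [norm_kron, Comp.norm_coef_of_identified zero_le_one (hF 0).1,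
    Comp.norm_coef_of_identified zero_le_one (hF 1).1, (hF 0).2, (hF 1).2]
  simp

/-- By homogeneity: orthonormalize both factors, normalize their cores, and apply the definition of
the supremum. -/
theorem frobInner_kron_le_deviation (hp : ∀ i, d i + s i ≤ p i)
    (Y : Fin (T + 1) → Matrix (Fin (p 0)) (Fin (p 1)) ℝ)
    (A : Matrix (Fin (p 1) × Fin (p 0)) (Fin (p 1) × Fin (p 0)) ℝ) (F : Params p d s) :
    frobInner (matGrad (lossKron Y) A) (kron F) ≤
      deviation d s Y A * (‖(F 1).coef‖ * ‖(F 0).coef‖) := by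
  by_cases h0 : ‖(F 1).coef‖ * ‖(F 0).coef‖ = 0
  · rw [h0, mul_zero]
    rw [← norm_kron, norm_eq_zero] at h0
    simp [h0, frobInner]
  obtain ⟨h1, h2⟩ := mul_ne_zero_iff.mp h0
  choose G hG hGF using fun i => Comp.exists_orthonormal (hp i) (F i)
  have hD : ∀ i, ‖(G i).D‖ = ‖(F i).coef‖ := fun i => by
    rw [← hGF, Comp.norm_coef_of_identified zero_le_one (hG i)]; simp
  have hF0 : ∀ i, ‖(F i).coef‖ ≠ 0 := fun i => by fin_cases i <;> assumption
  let H : Params p d s := fun i => { G i with D := ‖(F i).coef‖⁻¹ • (G i).D }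
  have hc : ∀ i, (H i).coef = ‖(F i).coef‖⁻¹ • (F i).coef := fun i => by
    have h := (G i).coef_update_D (‖(F i).coef‖⁻¹)
    rwa [hGF] at h
  have hH : kron H = (‖(F 1).coef‖ * ‖(F 0).coef‖)⁻¹ • kron F := by
    rw [kron, kron, hc, hc, Matrix.smul_kronecker, Matrix.kronecker_smul, smul_smul, mul_inv]
  have hle : frobInner (matGrad (lossKron Y) A) (kron H) ≤ deviation d s Y A := by
    refine le_csSup (bddAbove_deviation Y A) ⟨H, fun i => ⟨hG i, ?_⟩, rfl⟩
    change ‖‖(F i).coef‖⁻¹ • (G i).D‖ = 1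
    rw [norm_smul, hD, norm_inv, norm_norm, inv_mul_cancel₀ (hF0 i)]
  rw [hH, frobInner_smul_right, inv_mul_eq_div, div_le_iff₀ (lt_of_le_of_ne (by positivity)
    (Ne.symm h0))] at hle
  exact hle

theorem abs_frobInner_kron_le_deviation (hp : ∀ i, d i + s i ≤ p i)
    (Y : Fin (T + 1) → Matrix (Fin (p 0)) (Fin (p 1)) ℝ)
    (A : Matrix (Fin (p 1) × Fin (p 0)) (Fin (p 1) × Fin (p 0)) ℝ) (F : Params p d s) :
    |frobInner (matGrad (lossKron Y) A) (kron F)| ≤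
      deviation d s Y A * (‖(F 1).coef‖ * ‖(F 0).coef‖) := by
  refine abs_le'.mpr ⟨frobInner_kron_le_deviation hp Y A F, ?_⟩
  have h := frobInner_kron_le_deviation hp Y A
    -- Reversing the sign of one core gives the bound from below.
    (mkParams { F 0 with D := (-1 : ℝ) • (F 0).D } (F 1))
  rw [kron_mkParams, mkParams_zero, mkParams_one, Comp.coef_update_D, Matrix.kronecker_smul,
    frobInner_smul_right, norm_smul] at h
  simpa [kron] using h

/-- The matrix is a finite sum of coefficient matrices whose norms sum to at most the bound. -/
inductive Ctrl (p d s : ℕ) : Matrix (Fin p) (Fin p) ℝ → ℝ → Prop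
  | coef (F : Comp p d s) (a : ℝ) (h : ‖F.coef‖ ≤ a) : Ctrl p d s F.coef a
  | add {M N : Matrix (Fin p) (Fin p) ℝ} {a c : ℝ} (hM : Ctrl p d s M a) (hN : Ctrl p d s N c) :
      Ctrl p d s (M + N) (a + c)

namespace Ctrl

variable {p d s : ℕ} {M N : Matrix (Fin p) (Fin p) ℝ} {a c : ℝ}

theorem norm_le (h : Ctrl p d s M a) : ‖M‖ ≤ a := by
  induction h with
  | coef F a h => exact h
  | add _ _ h h' => exact (norm_add_le _ _).trans (add_le_add h h')

theorem nonneg (h : Ctrl p d s M a) : 0 ≤ a := (norm_nonneg _).trans h.norm_le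

theorem mono (h : Ctrl p d s M a) (hc : a ≤ c) : Ctrl p d s M c := by
  induction h generalizing c with
  | coef F a h => exact .coef F _ (h.trans hc)
  | @add M N a a' _ _ h h' =>
    have := (h le_rfl).add (h' (c := c - a) (by linarith))
    rwa [add_sub_cancel] at this

theorem smul (h : Ctrl p d s M a) (t : ℝ) : Ctrl p d s (t • M) (|t| * a) := by
  induction h with
  | coef F a h =>
    rw [← Comp.coef_update_D]
    refine .coef _ _ ?_
    rw [Comp.coef_update_D, norm_smul, Real.norm_eq_abs]
    gcongr
  | add _ _ h h' => rw [smul_add, mul_add]; exact h.add h'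

theorem sub (h : Ctrl p d s M a) (h' : Ctrl p d s N c) : Ctrl p d s (M - N) (a + c) := by
  have := h.add (h'.smul (-1))
  simpa [sub_eq_add_neg] using this

end Ctrl

/-- Expanding bilinearly leaves only Kronecker products of coefficient matrices, where the
hypothesis applies. Only the total norm counts, not the number of summands. -/
theorem Ctrl.norm_kronecker_mul_lagMat_le {Y : Fin (T + 1) → Matrix (Fin (p 0)) (Fin (p 1)) ℝ}
    {β : ℝ} (hβ : ∀ Θ : Params p d s, ‖kron Θ * lagMat Y‖ ≤ √β * ‖kron Θ‖)
    {M : Matrix (Fin (p 1)) (Fin (p 1)) ℝ} {N : Matrix (Fin (p 0)) (Fin (p 0)) ℝ} {a c : ℝ}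
    (hM : Ctrl (p 1) (d 1) (s 1) M a) (hN : Ctrl (p 0) (d 0) (s 0) N c) :
    ‖(M ⊗ₖ N) * lagMat Y‖ ≤ √β * (a * c) := by
  induction hM with
  | add h1 h2 ih1 ih2 =>
    rw [Matrix.add_kronecker, Matrix.add_mul, add_mul, mul_add]
    exact (norm_add_le _ _).trans (add_le_add ih1 ih2)
  | coef F a hF =>
    have ha : 0 ≤ a := (norm_nonneg _).trans hF
    induction hN with
    | add h1 h2 ih1 ih2 =>
      rw [Matrix.kronecker_add, Matrix.add_mul, mul_add, mul_add]
      exact (norm_add_le _ _).trans (add_le_add ih1 ih2)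
    | coef G c hG =>
      refine (hβ (mkParams G F)).trans ?_
      rw [norm_kron]
      exact mul_le_mul_of_nonneg_left (mul_le_mul hF hG (norm_nonneg _) ha) (Real.sqrt_nonneg _)

theorem Ctrl.abs_frobInner_kronecker_le {ξ : ℝ} (hξ : 0 ≤ ξ)
    {G : Matrix (Fin (p 1) × Fin (p 0)) (Fin (p 1) × Fin (p 0)) ℝ}
    (hG : ∀ Θ : Params p d s, |frobInner G (kron Θ)| ≤ ξ * (‖(Θ 1).coef‖ * ‖(Θ 0).coef‖))
    {M : Matrix (Fin (p 1)) (Fin (p 1)) ℝ} {N : Matrix (Fin (p 0)) (Fin (p 0)) ℝ} {a c : ℝ}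
    (hM : Ctrl (p 1) (d 1) (s 1) M a) (hN : Ctrl (p 0) (d 0) (s 0) N c) :
    |frobInner G (M ⊗ₖ N)| ≤ ξ * (a * c) := by
  induction hM with
  | add h1 h2 ih1 ih2 =>
    rw [Matrix.add_kronecker, frobInner_add_right, add_mul, mul_add]
    exact (abs_add_le _ _).trans (add_le_add ih1 ih2)
  | coef F a hF =>
    have ha : 0 ≤ a := (norm_nonneg _).trans hF
    induction hN with
    | add h1 h2 ih1 ih2 =>
      rw [Matrix.kronecker_add, frobInner_add_right, mul_add, mul_add]
      exact (abs_add_le _ _).trans (add_le_add ih1 ih2)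
    | coef E c hE =>
      refine (hG (mkParams E F)).trans ?_
      exact mul_le_mul_of_nonneg_left (mul_le_mul hF hE (norm_nonneg _) ha) hξ

/-- The loss is quadratic, so its Bregman divergence is exactly half the squared prediction
difference. -/
theorem RSCRSS.norm_sq_eq {Y : Fin (T + 1) → Matrix (Fin (p 0)) (Fin (p 1)) ℝ}
    (A A' : Matrix (Fin (p 1) × Fin (p 0)) (Fin (p 1) × Fin (p 0)) ℝ) :
    lossKron Y A - lossKron Y A' - frobInner (matGrad (lossKron Y) A') (A - A') =
      1 / 2 * ‖(A - A') * lagMat Y‖ ^ 2 := by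
  have h : respMat Y - A * lagMat Y = (respMat Y - A' * lagMat Y) - (A - A') * lagMat Y := by
    rw [Matrix.sub_mul]; abel
  rw [lossKron_eq, lossKron_eq, frobInner_matGrad_lossKron, h, norm_sub_sq_frob]
  ring

theorem RSCRSS.lower {Y : Fin (T + 1) → Matrix (Fin (p 0)) (Fin (p 1)) ℝ} {α β : ℝ}
    (h : RSCRSS d s Y α β) (Θ Θ' : Params p d s) :
    α * ‖kron Θ - kron Θ'‖ ^ 2 ≤ ‖(kron Θ - kron Θ') * lagMat Y‖ ^ 2 := by
  have := (h.2.2 Θ Θ').1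
  rw [RSCRSS.norm_sq_eq] at this
  linarith

theorem RSCRSS.upper {Y : Fin (T + 1) → Matrix (Fin (p 0)) (Fin (p 1)) ℝ} {α β : ℝ}
    (h : RSCRSS d s Y α β) (Θ : Params p d s) : ‖kron Θ * lagMat Y‖ ≤ √β * ‖kron Θ‖ := by
  -- Smoothness is used only against the zero parameter, that is, for single Kronecker products;
  -- differences are handled through `Ctrl`.
  have := (h.2.2 Θ 0).2
  have h0 : kron (0 : Params p d s) = 0 := by
    simp [kron, Comp.coef]
  rw [RSCRSS.norm_sq_eq, h0, sub_zero] at this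
  refine Real.le_sqrt_of_sq_le ?_ |>.trans_eq (b := √(β * ‖kron Θ‖ ^ 2)) ?_
  · linarith
  · rw [Real.sqrt_mul (h.1.le.trans h.2.1), Real.sqrt_sq (norm_nonneg _)]

end

end MARCF

/-! ### Local derivative bounds and descent estimates. -/

namespace MARCF

noncomputable section

namespace Comp

variable {p d s : ℕ}

theorem coefD1_zero_of_norm_le {F X : Comp p d s} (hU : ‖X.U‖ ≤ 0) (hV : ‖X.V‖ ≤ 0)
    (hD : ‖X.D‖ ≤ 0) : F.coefD1 X = 0 ∧ F.coefD2 X = 0 := by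
  rw [norm_le_zero_iff] at hU hV hD
  simp [coefD1, coefD2, hU, hV, hD]

theorem ctrl_zero : Ctrl p d s 0 0 := by
  have h : (0 : Comp p d s).coef = 0 := by simp [coef]
  rw [← h]
  exact .coef _ _ (by rw [h, norm_zero])

theorem ctrl_line {F X : Comp p d s} {k h e t : ℝ} (hk : 0 ≤ k) (hh : 0 ≤ h)
    (hFU : OpBound F.U (k * h)) (hFV : OpBound F.V (k * h)) (hFD : ‖F.D‖ ≤ k * h)
    (hU : ‖X.U‖ ≤ e) (hV : ‖X.V‖ ≤ e) (hD : ‖X.D‖ ≤ e) (ht : |t| * e ≤ 2 * h) :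
    Ctrl p d s (F + t • X).coef ((k + 2) ^ 3 * h ^ 3) := by
  refine .coef _ _ ?_
  have hm : k * h + |t| * e ≤ (k + 2) * h := by linarith
  have key : ∀ {A : Matrix (Fin p) (Fin d ⊕ Fin s) ℝ} {B : Matrix (Fin p) (Fin d ⊕ Fin s) ℝ},
      OpBound A (k * h) → ‖B‖ ≤ e → OpBound (A + t • B) ((k + 2) * h) := fun hA hB =>
    (hA.add (((opBound_norm _).mono hB).smul t)).mono hm
  have h1 := key hFU hU
  have h2 := key hFV hV
  have h3 : ‖F.D + t • X.D‖ ≤ (k + 2) * h := by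
    refine (norm_add_le _ _).trans (le_trans (add_le_add hFD ?_) hm)
    rw [norm_smul, Real.norm_eq_abs]; gcongr
  rw [coef, add_U, add_V, add_D, smul_U, smul_V, smul_D]
  exact (norm_sandwich_le (by positivity) (by positivity) h1 h2 h3).trans_eq (by ring)

/-- Along `F + t • X` the coefficient matrix is a cubic in `t`, so exact difference formulas recover
its first two Taylor terms from values of `coef` itself. A bound on the norm alone would not
suffice, since restricted smoothness and `ξ` see only coefficient matrices. -/
theorem ctrl_coefD {F X : Comp p d s} {k h e : ℝ} (hk : 0 ≤ k) (hh : 0 < h)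
    (hFU : OpBound F.U (k * h)) (hFV : OpBound F.V (k * h)) (hFD : ‖F.D‖ ≤ k * h)
    (hU : ‖X.U‖ ≤ e) (hV : ‖X.V‖ ≤ e) (hD : ‖X.D‖ ≤ e) :
    Ctrl p d s (F.coefD1 X) (2 * (k + 2) ^ 3 * h ^ 2 * e) ∧
    Ctrl p d s (F.coefD2 X) (2 * (k + 2) ^ 3 * h * e ^ 2) := by
  have he : 0 ≤ e := (norm_nonneg _).trans hU
  rcases he.eq_or_lt with rfl | he
  · obtain ⟨h1, h2⟩ := coefD1_zero_of_norm_le (F := F) hU hV hD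
    rw [h1, h2]
    simpa using ctrl_zero
  have line : ∀ t : ℝ, |t| * e ≤ 2 * h → Ctrl p d s (F + t • X).coef ((k + 2) ^ 3 * h ^ 3) :=
    fun t ht => ctrl_line hk hh.le hFU hFV hFD hU hV hD ht
  -- The largest scale for which the sample points up to `2τ` still perturb each factor by at most
  -- `2h`.
  set τ := h / e with hτ
  have hτ0 : 0 < τ := by positivity
  have hτe : τ * e = h := by rw [hτ]; field_simp
  have l0 := line 0 (by simp; positivity)
  have l1 := line τ (by rw [abs_of_pos hτ0]; linarith)
  have l2 := line (-τ) (by rw [abs_neg, abs_of_pos hτ0]; linarith)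
  have l3 := line (2 * τ) (by rw [abs_of_pos (by positivity)]; linarith)
  have l4 := line (-(2 * τ)) (by rw [abs_neg, abs_of_pos (by positivity)]; linarith)
  constructor
  · have hc := (((l1.sub l2).smul 8).sub (l3.sub l4)).smul (1 / (12 * τ))
    have hE : (1 / (12 * τ)) • ((8 : ℝ) • ((F + τ • X).coef - (F + (-τ) • X).coef)
        - ((F + (2 * τ) • X).coef - (F + (-(2 * τ)) • X).coef)) = F.coefD1 X := by
      simp only [coef_add_smul]
      have : (12 * τ) ≠ 0 := by positivity
      match_scalars <;> field_simp <;> ring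
    rw [hE] at hc
    refine hc.mono ?_
    rw [abs_of_pos (by positivity), abs_of_pos (by norm_num)]
    have : 1 / (12 * τ) = e / (12 * h) := by rw [hτ]; field_simp
    rw [this]
    have : e / (12 * h) * (8 * ((k + 2) ^ 3 * h ^ 3 + (k + 2) ^ 3 * h ^ 3)
        + ((k + 2) ^ 3 * h ^ 3 + (k + 2) ^ 3 * h ^ 3)) = 3 / 2 * ((k + 2) ^ 3 * h ^ 2 * e) := by
      field_simp; ring
    rw [this]
    have : 0 ≤ (k + 2) ^ 3 * h ^ 2 * e := by positivity
    linarith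
  · have hc := ((l1.add l2).sub (l0.smul 2)).smul (1 / (2 * τ ^ 2))
    have hE : (1 / (2 * τ ^ 2)) • ((F + τ • X).coef + (F + (-τ) • X).coef
        - (2 : ℝ) • (F + (0 : ℝ) • X).coef) = F.coefD2 X := by
      simp only [coef_add_smul]
      have : τ ≠ 0 := by positivity
      match_scalars <;> field_simp <;> ring
    rw [hE] at hc
    refine hc.mono ?_
    rw [abs_of_pos (by positivity), abs_of_pos (by norm_num)]
    have : 1 / (2 * τ ^ 2) = e ^ 2 / (2 * h ^ 2) := by rw [hτ]; field_simp
    rw [this]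
    apply le_of_eq
    field_simp; ring

/-- Consequences of `F` being close to a well-scaled component `F'`. -/
structure Near (M h E : ℝ) (F F' : Comp p d s) : Prop where
  opU : OpBound F.U (M * h)
  opV : OpBound F.V (M * h)
  coef : Ctrl p d s F.coef (M * h ^ 3)
  deriv : ∀ (X : Comp p d s) (e : ℝ), ‖X.U‖ ≤ e → ‖X.V‖ ≤ e → ‖X.D‖ ≤ e →
    Ctrl p d s (F.coefD1 X) (M * h ^ 2 * e)
  diff : Ctrl p d s (F.coef - F'.coef) (3 * M * h ^ 2 * E)
  rem : Ctrl p d s (F.coefD1 (F - F') - (F.coef - F'.coef)) (2 * M * h * E ^ 2)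

/-- The expansion is based at `F`, where the gradient is evaluated, and run backwards to `F'`. -/
theorem coef_eq_sub (F F' : Comp p d s) :
    F'.coef = F.coef - F.coefD1 (F - F') + F.coefD2 (F - F') - (F - F').coef := by
  have h := coef_add_smul F (F - F') (-1)
  rw [neg_smul, one_smul, neg_sub, add_sub_cancel] at h
  rw [h]
  norm_num
  abel

theorem near_of_bounds {F F' : Comp p d s} {k h E : ℝ} (hk : 0 ≤ k) (hh : 0 < h) (hE : E ≤ h)
    (hFU : OpBound F'.U (k * h)) (hFV : OpBound F'.V (k * h)) (hFD : ‖F'.D‖ ≤ k * h)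
    (hU : ‖(F - F').U‖ ≤ E) (hV : ‖(F - F').V‖ ≤ E) (hD : ‖(F - F').D‖ ≤ E) :
    Near (2 * (k + 3) ^ 3) h E F F' := by
  have hE0 : 0 ≤ E := (norm_nonneg _).trans hU
  have eU : F.U = F'.U + (F - F').U := by simp
  have eV : F.V = F'.V + (F - F').V := by simp
  have eD : F.D = F'.D + (F - F').D := by simp
  have oU : OpBound F.U ((k + 1) * h) := by
    rw [eU]; exact (hFU.add (opBound_norm _)).mono (by linarith)
  have oV : OpBound F.V ((k + 1) * h) := by
    rw [eV]; exact (hFV.add (opBound_norm _)).mono (by linarith)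
  have oD : ‖F.D‖ ≤ (k + 1) * h := by
    rw [eD]; exact (norm_add_le _ _).trans (by linarith)
  have hk1 : (0 : ℝ) ≤ k + 1 := by linarith
  have hM1 : 1 ≤ (k + 3) ^ 3 := one_le_pow₀ (by linarith)
  have hM2 : k + 1 ≤ 2 * (k + 3) ^ 3 := by nlinarith [pow_nonneg hk 2, pow_nonneg hk 3]
  have e3 : k + 1 + 2 = k + 3 := by ring
  have hc1 : ∀ (X : Comp p d s) (e : ℝ), ‖X.U‖ ≤ e → ‖X.V‖ ≤ e → ‖X.D‖ ≤ e →
      Ctrl p d s (F.coefD1 X) (2 * (k + 3) ^ 3 * h ^ 2 * e) := fun X e h1 h2 h3 => by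
    have := (ctrl_coefD hk1 hh oU oV oD h1 h2 h3).1
    rwa [e3] at this
  have hc2 := (ctrl_coefD hk1 hh oU oV oD hU hV hD).2
  rw [e3] at hc2
  have hX : Ctrl p d s (F - F').coef (h * E ^ 2) := by
    refine .coef _ _ ?_
    rw [Comp.coef]
    refine (norm_sandwich_le hE0 hE0 ((opBound_norm _).mono hU) ((opBound_norm _).mono hV)
      hD).trans ?_
    nlinarith [mul_nonneg hE0 hE0]
  have hrem : Ctrl p d s (F.coefD1 (F - F') - (F.coef - F'.coef))
      (2 * (2 * (k + 3) ^ 3) * h * E ^ 2) := by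
    have e1 : F.coefD1 (F - F') - (F.coef - F'.coef) = F.coefD2 (F - F') - (F - F').coef := by
      rw [coef_eq_sub F F']; abel
    rw [e1]
    refine (hc2.sub hX).mono ?_
    have : 0 ≤ h * E ^ 2 := by positivity
    nlinarith
  refine ⟨oU.mono (by gcongr), oV.mono (by gcongr), ?_, hc1, ?_, hrem⟩
  · refine .coef _ _ ?_
    rw [Comp.coef]
    refine (norm_sandwich_le (by positivity) (by positivity) oU oV oD).trans ?_
    have : (k + 1) ^ 3 ≤ 2 * (k + 3) ^ 3 := by
      have : (k + 1) ^ 3 ≤ (k + 3) ^ 3 := by gcongr; linarith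
      linarith [pow_nonneg (by linarith : 0 ≤ k + 3) 3]
    calc (k + 1) * h * ((k + 1) * h) * ((k + 1) * h) = (k + 1) ^ 3 * h ^ 3 := by ring
      _ ≤ _ := by gcongr
  · have h1 := (hc1 _ E hU hV hD).sub hrem
    rw [sub_sub_cancel] at h1
    refine h1.mono ?_
    have : 0 ≤ 2 * (k + 3) ^ 3 * (h * E) := by positivity
    nlinarith

end Comp

section Descent

variable {p d s : Fin 2 → ℕ} {T : ℕ}

/-- The gradient is affine in `A`. With `A'` the truth, this separates the noise, controlled by `ξ`,
from the signal. -/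
theorem frobInner_matGrad_shift (Y : Fin (T + 1) → Matrix (Fin (p 0)) (Fin (p 1)) ℝ)
    (A A' N : Matrix (Fin (p 1) × Fin (p 0)) (Fin (p 1) × Fin (p 0)) ℝ) :
    frobInner (matGrad (lossKron Y) A) N = frobInner (matGrad (lossKron Y) A') N
      + frobInner ((A - A') * lagMat Y) (N * lagMat Y) := by
  rw [frobInner_matGrad_lossKron, frobInner_matGrad_lossKron]
  have h : respMat Y - A * lagMat Y = (respMat Y - A' * lagMat Y) - (A - A') * lagMat Y := by
    rw [Matrix.sub_mul]; abel
  rw [h, frobInner_sub_left]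
  ring

/-- The remainder is organized into Kronecker products of controlled factors, each of total order
two in the error. -/
theorem kronD1_sub_eq (Θ Θ' : Params p d s) :
    kronD1 Θ (Θ - Θ') = (kron Θ - kron Θ')
      + (((Θ 1).coef - (Θ' 1).coef) ⊗ₖ ((Θ 0).coef - (Θ' 0).coef)
        + (Θ 1).coef ⊗ₖ ((Θ 0).coefD1 (Θ 0 - Θ' 0) - ((Θ 0).coef - (Θ' 0).coef))
        + ((Θ 1).coefD1 (Θ 1 - Θ' 1) - ((Θ 1).coef - (Θ' 1).coef)) ⊗ₖ (Θ 0).coef) := by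
  simp only [kronD1, kron, Pi.sub_apply]
  ext ⟨i, j⟩ ⟨i', j'⟩
  simp only [Matrix.add_apply, Matrix.sub_apply, Matrix.kroneckerMap_apply]
  ring

variable {M h E : ℝ} {Θ Θ' : Params p d s}

theorem data_bound {Y : Fin (T + 1) → Matrix (Fin (p 0)) (Fin (p 1)) ℝ} {α β ξ : ℝ}
    (hR : RSCRSS d s Y α β) (hξ : 0 ≤ ξ)
    (hG : ∀ F : Params p d s, |frobInner (matGrad (lossKron Y) (kron Θ')) (kron F)| ≤
      ξ * (‖(F 1).coef‖ * ‖(F 0).coef‖))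
    (hN : ∀ i, Comp.Near M h E (Θ i) (Θ' i)) (X : Params p d s) {e : ℝ}
    (hU : ∀ i, ‖(X i).U‖ ≤ e) (hV : ∀ i, ‖(X i).V‖ ≤ e) (hD : ∀ i, ‖(X i).D‖ ≤ e) :
    ‖kronD1 Θ X * lagMat Y‖ ≤ √β * (2 * M ^ 2 * h ^ 5 * e) ∧
    |frobInner (matGrad (lossKron Y) (kron Θ')) (kronD1 Θ X)| ≤ ξ * (2 * M ^ 2 * h ^ 5 * e) := by
  have d0 := (hN 0).deriv (X 0) e (hU 0) (hV 0) (hD 0)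
  have d1 := (hN 1).deriv (X 1) e (hU 1) (hV 1) (hD 1)
  constructor
  · rw [kronD1, Matrix.add_mul]
    refine (norm_add_le _ _).trans ((add_le_add
      (Ctrl.norm_kronecker_mul_lagMat_le (fun Θ => hR.upper Θ) d1 (hN 0).coef)
      (Ctrl.norm_kronecker_mul_lagMat_le (fun Θ => hR.upper Θ) (hN 1).coef d0)).trans_eq ?_)
    ring
  · rw [kronD1, frobInner_add_right]
    refine (abs_add_le _ _).trans ((add_le_add
      (Ctrl.abs_frobInner_kronecker_le hξ hG d1 (hN 0).coef)
      (Ctrl.abs_frobInner_kronecker_le hξ hG (hN 1).coef d0)).trans_eq ?_)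
    ring

/-- The signal pairs with itself up to a quadratic remainder of size `13 M² h⁴ E²`, where `13 = 9 +
2 + 2`. Young's inequality spends half of the square, and `13² / 2 ≤ 85`. -/
theorem data_lower {Y : Fin (T + 1) → Matrix (Fin (p 0)) (Fin (p 1)) ℝ} {α β ξ : ℝ}
    (hR : RSCRSS d s Y α β) (hξ : 0 ≤ ξ)
    (hG : ∀ F : Params p d s, |frobInner (matGrad (lossKron Y) (kron Θ')) (kron F)| ≤
      ξ * (‖(F 1).coef‖ * ‖(F 0).coef‖))
    (hN : ∀ i, Comp.Near M h E (Θ i) (Θ' i))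
    (hU : ∀ i, ‖(Θ i - Θ' i).U‖ ≤ E) (hV : ∀ i, ‖(Θ i - Θ' i).V‖ ≤ E)
    (hD : ∀ i, ‖(Θ i - Θ' i).D‖ ≤ E) :
    1 / 2 * ‖(kron Θ - kron Θ') * lagMat Y‖ ^ 2 - 85 * M ^ 4 * β * h ^ 8 * E ^ 4
      - 2 * M ^ 2 * h ^ 5 * ξ * E ≤
    frobInner (matGrad (lossKron Y) (kron Θ)) (kronD1 Θ (Θ - Θ')) := by
  have hb := (data_bound hR hξ hG hN (Θ - Θ') hU hV hD).2
  have hβ : 0 ≤ β := hR.1.le.trans hR.2.1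
  rw [frobInner_matGrad_shift Y (kron Θ) (kron Θ')]
  have hb' := (abs_le.mp hb).1
  suffices h2 : 1 / 2 * ‖(kron Θ - kron Θ') * lagMat Y‖ ^ 2 - 85 * M ^ 4 * β * h ^ 8 * E ^ 4 ≤
      frobInner ((kron Θ - kron Θ') * lagMat Y) (kronD1 Θ (Θ - Θ') * lagMat Y) by
    nlinarith
  rw [kronD1_sub_eq, Matrix.add_mul _ _ (lagMat Y), frobInner_add_right, frobInner_self]
  set z := ‖(kron Θ - kron Θ') * lagMat Y‖
  have hz : ‖(((Θ 1).coef - (Θ' 1).coef) ⊗ₖ ((Θ 0).coef - (Θ' 0).coef)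
        + (Θ 1).coef ⊗ₖ ((Θ 0).coefD1 (Θ 0 - Θ' 0) - ((Θ 0).coef - (Θ' 0).coef))
        + ((Θ 1).coefD1 (Θ 1 - Θ' 1) - ((Θ 1).coef - (Θ' 1).coef)) ⊗ₖ (Θ 0).coef) * lagMat Y‖
      ≤ √β * (13 * M ^ 2 * h ^ 4 * E ^ 2) := by
    rw [Matrix.add_mul, Matrix.add_mul]
    refine (norm_add_le _ _).trans (le_trans (add_le_add ((norm_add_le _ _).trans (add_le_add
      (Ctrl.norm_kronecker_mul_lagMat_le (fun Θ => hR.upper Θ) (hN 1).diff (hN 0).diff)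
      (Ctrl.norm_kronecker_mul_lagMat_le (fun Θ => hR.upper Θ) (hN 1).coef (hN 0).rem)))
      (Ctrl.norm_kronecker_mul_lagMat_le (fun Θ => hR.upper Θ) (hN 1).rem (hN 0).coef))
      (le_of_eq ?_))
    ring
  have hi := neg_le_frobInner ((kron Θ - kron Θ') * lagMat Y)
    ((((Θ 1).coef - (Θ' 1).coef) ⊗ₖ ((Θ 0).coef - (Θ' 0).coef)
        + (Θ 1).coef ⊗ₖ ((Θ 0).coefD1 (Θ 0 - Θ' 0) - ((Θ 0).coef - (Θ' 0).coef))
        + ((Θ 1).coefD1 (Θ 1 - Θ' 1) - ((Θ 1).coef - (Θ' 1).coef)) ⊗ₖ (Θ 0).coef) * lagMat Y)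
  have hm := mul_le_mul_of_nonneg_left hz (norm_nonneg ((kron Θ - kron Θ') * lagMat Y))
  have hs : (√β * (13 * M ^ 2 * h ^ 4 * E ^ 2)) ^ 2 = 169 * M ^ 4 * β * h ^ 8 * E ^ 4 := by
    rw [mul_pow, Real.sq_sqrt hβ]; ring
  have hp : 0 ≤ M ^ 4 * β * h ^ 8 * E ^ 4 := by positivity
  nlinarith [sq_nonneg (z - √β * (13 * M ^ 2 * h ^ 4 * E ^ 2))]

/-- By polarization, `⟨A, A - A'⟩` is half of `‖A‖² - ‖A'‖² + ‖A - A'‖²`. Subtracting the two modes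
cancels the reference norms, which are equal, and leaves half the imbalance plus a quadratic error.
-/
theorem reg₁_lower (hN : ∀ i, Comp.Near M h E (Θ i) (Θ' i))
    (hφ : ‖(Θ' 0).coef‖ = ‖(Θ' 1).coef‖) :
    1 / 4 * (‖(Θ 0).coef‖ ^ 2 - ‖(Θ 1).coef‖ ^ 2) ^ 2 - 81 * M ^ 4 * h ^ 8 * E ^ 4 ≤
    (‖(Θ 0).coef‖ ^ 2 - ‖(Θ 1).coef‖ ^ 2)
      * (frobInner (Θ 0).coef ((Θ 0).coefD1 (Θ 0 - Θ' 0))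
        - frobInner (Θ 1).coef ((Θ 1).coefD1 (Θ 1 - Θ' 1))) := by
  have key : ∀ i, frobInner (Θ i).coef ((Θ i).coefD1 (Θ i - Θ' i)) =
      1 / 2 * (‖(Θ i).coef‖ ^ 2 - ‖(Θ' i).coef‖ ^ 2 + ‖(Θ i).coef - (Θ' i).coef‖ ^ 2)
      + frobInner (Θ i).coef ((Θ i).coefD1 (Θ i - Θ' i) - ((Θ i).coef - (Θ' i).coef)) := fun i => by
    rw [norm_sub_sq_frob, frobInner_sub_right, frobInner_sub_right, frobInner_self]; ring
  have hrem : ∀ i, |frobInner (Θ i).coef ((Θ i).coefD1 (Θ i - Θ' i)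
      - ((Θ i).coef - (Θ' i).coef))| ≤ 2 * M ^ 2 * h ^ 4 * E ^ 2 := fun i => by
    refine (abs_frobInner_le _ _).trans ((mul_le_mul (hN i).coef.norm_le (hN i).rem.norm_le
      (norm_nonneg _) (hN i).coef.nonneg).trans_eq (by ring))
  have hdiff : ∀ i, ‖(Θ i).coef - (Θ' i).coef‖ ^ 2 ≤ 9 * M ^ 2 * h ^ 4 * E ^ 2 := fun i =>
    (pow_le_pow_left₀ (norm_nonneg _) (hN i).diff.norm_le 2).trans_eq (by ring)
  rw [key 0, key 1, hφ]
  have r0 := abs_le.mp (hrem 0)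
  have r1 := abs_le.mp (hrem 1)
  have d0 := hdiff 0
  have d1 := hdiff 1
  have n0 := sq_nonneg ‖(Θ 0).coef - (Θ' 0).coef‖
  have n1 := sq_nonneg ‖(Θ 1).coef - (Θ' 1).coef‖
  generalize frobInner (Θ 0).coef ((Θ 0).coefD1 (Θ 0 - Θ' 0) - ((Θ 0).coef - (Θ' 0).coef)) = u0 at *
  generalize frobInner (Θ 1).coef ((Θ 1).coefD1 (Θ 1 - Θ' 1) - ((Θ 1).coef - (Θ' 1).coef)) = u1 at *
  generalize ‖(Θ 0).coef - (Θ' 0).coef‖ ^ 2 = v0 at *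
  generalize ‖(Θ 1).coef - (Θ' 1).coef‖ ^ 2 = v1 at *
  obtain ⟨δ, hδ⟩ : ∃ δ, δ = ‖(Θ 0).coef‖ ^ 2 - ‖(Θ 1).coef‖ ^ 2 := ⟨_, rfl⟩
  obtain ⟨q, hq⟩ : ∃ q, q = M ^ 2 * h ^ 4 * E ^ 2 := ⟨_, rfl⟩
  obtain ⟨w, hw⟩ : ∃ w, w = 1 / 2 * (v0 - v1) + u0 - u1 := ⟨_, rfl⟩
  have hwq : |w| ≤ 9 * q := abs_le.mpr ⟨by linarith, by linarith⟩
  have hw2 : w ^ 2 ≤ 81 * q ^ 2 := by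
    have := sq_le_sq' (abs_le.mp hwq).1 (abs_le.mp hwq).2
    linarith
  have e1 : (1 : ℝ) / 2 * (‖(Θ 0).coef‖ ^ 2 - ‖(Θ' 1).coef‖ ^ 2 + v0) + u0 -
      (1 / 2 * (‖(Θ 1).coef‖ ^ 2 - ‖(Θ' 1).coef‖ ^ 2 + v1) + u1) = 1 / 2 * δ + w := by
    rw [hδ, hw]; ring
  have e2 : 81 * M ^ 4 * h ^ 8 * E ^ 4 = 81 * q ^ 2 := by rw [hq]; ring
  rw [e1, ← hδ, e2]
  nlinarith [sq_nonneg (δ + 2 * w)]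

theorem reg₂_nonneg (b : ℝ) (Θ : Params p d s) : 0 ≤ reg₂ b Θ :=
  Finset.sum_nonneg fun _ _ => by positivity

/-- The first variation towards `U'` is the Gram defect plus `(U - U')ᵀ (U - U')`, because `U'` has
no defect; Young's inequality then applies. -/
theorem gramDeriv_lower {m n : Type} [Fintype m] [Fintype n] [DecidableEq n] {b E : ℝ}
    {U U' : Matrix m n ℝ} (hU' : U'ᵀ * U' = b ^ 2 • (1 : Matrix n n ℝ)) (hE : ‖U - U'‖ ^ 2 ≤ E) :
    1 / 2 * ‖Uᵀ * U - b ^ 2 • 1‖ ^ 2 - 1 / 2 * E ^ 2 ≤ gramDeriv b U (U - U') := by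
  have e : (U - U')ᵀ * U + Uᵀ * (U - U') = (Uᵀ * U - b ^ 2 • 1) + (U - U')ᵀ * (U - U') := by
    rw [← hU']
    simp only [Matrix.transpose_sub, Matrix.sub_mul, Matrix.mul_sub]
    abel
  rw [gramDeriv, e, frobInner_add_right, frobInner_self]
  have h1 : ‖(U - U')ᵀ * (U - U')‖ ≤ E := by
    refine (Matrix.frobenius_norm_mul _ _).trans ?_
    rw [norm_transpose_frob, ← sq]; exact hE
  have h2 := neg_le_frobInner (Uᵀ * U - b ^ 2 • 1) ((U - U')ᵀ * (U - U'))
  have h3 := mul_le_mul_of_nonneg_left h1 (norm_nonneg (Uᵀ * U - b ^ 2 • 1))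
  nlinarith [sq_nonneg (‖Uᵀ * U - b ^ 2 • 1‖ - E)]

theorem reg₂_lower {b : ℝ} (hI : ∀ i, (Θ' i).Identified b) :
    1 / 2 * reg₂ b Θ - nsq (Θ - Θ') ^ 2 ≤
    ∑ i, (gramDeriv b (Θ i).U ((Θ - Θ') i).U + gramDeriv b (Θ i).V ((Θ - Θ') i).V) := by
  have h : ∀ i, 1 / 2 * (‖(Θ i).Uᵀ * (Θ i).U - b ^ 2 • 1‖ ^ 2
      + ‖(Θ i).Vᵀ * (Θ i).V - b ^ 2 • 1‖ ^ 2) - ((Θ - Θ') i).nsq ^ 2 ≤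
      gramDeriv b (Θ i).U ((Θ - Θ') i).U + gramDeriv b (Θ i).V ((Θ - Θ') i).V := fun i => by
    have h1 := ((Θ - Θ') i).norm_U_sq_le
    have h2 := ((Θ - Θ') i).norm_V_sq_le
    rw [Pi.sub_apply, Comp.sub_U] at h1 ⊢
    rw [Pi.sub_apply, Comp.sub_V] at h2
    rw [Comp.sub_V]
    have h3 := gramDeriv_lower (hI i).1 h1
    have h4 := gramDeriv_lower (hI i).2 h2
    linarith
  have h0 := h 0
  have h1 := h 1
  have n0 := ((Θ - Θ') 0).nsq_nonneg
  have n1 := ((Θ - Θ') 1).nsq_nonneg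
  rw [reg₂, nsq, Fin.sum_univ_two, Fin.sum_univ_two, Fin.sum_univ_two]
  nlinarith [mul_nonneg n0 n1]

theorem gramDeriv_le {m n : Type} [Fintype m] [Fintype n] [DecidableEq n] {b c e : ℝ}
    {U X : Matrix m n ℝ} (hc : 0 ≤ c) (hU : OpBound U c) (hX : ‖X‖ ≤ e) :
    gramDeriv b U X ≤ 2 * c * e * ‖Uᵀ * U - b ^ 2 • 1‖ := by
  have h1 : ‖Xᵀ * U‖ ≤ c * e := by
    refine (hU.mul_left hc _).trans ?_
    rw [norm_transpose_frob]; gcongr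
  have h2 : ‖Uᵀ * X‖ ≤ c * e := ((hU.transpose hc) X).trans (by gcongr)
  have h3 : ‖Xᵀ * U + Uᵀ * X‖ ≤ 2 * c * e := (norm_add_le _ _).trans (by linarith)
  rw [gramDeriv]
  refine (frobInner_le _ _).trans ((mul_le_mul_of_nonneg_left h3 (norm_nonneg _)).trans_eq ?_)
  ring

theorem objDeriv_le {Y : Fin (T + 1) → Matrix (Fin (p 0)) (Fin (p 1)) ℝ} {α β ξ lam₁ lam₂ b : ℝ}
    (hR : RSCRSS d s Y α β) (hξ : 0 ≤ ξ) (hl₁ : 0 ≤ lam₁) (hl₂ : 0 ≤ lam₂) (hM : 0 ≤ M)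
    (hh : 0 ≤ h)
    (hG : ∀ F : Params p d s, |frobInner (matGrad (lossKron Y) (kron Θ')) (kron F)| ≤
      ξ * (‖(F 1).coef‖ * ‖(F 0).coef‖))
    (hN : ∀ i, Comp.Near M h E (Θ i) (Θ' i)) (X : Params p d s) :
    objDeriv Y lam₁ lam₂ b Θ X ≤
      (2 * M ^ 2 * h ^ 5 * (√β * ‖(kron Θ - kron Θ') * lagMat Y‖ + ξ
        + lam₁ * |‖(Θ 0).coef‖ ^ 2 - ‖(Θ 1).coef‖ ^ 2|)
        + 4 * M * h * lam₂ * √(reg₂ b Θ)) * √(nsq X) := by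
  set e := √(nsq X) with he
  have he0 : 0 ≤ e := Real.sqrt_nonneg _
  have hU : ∀ i, ‖(X i).U‖ ≤ e := fun i =>
    Real.le_sqrt_of_sq_le ((X i).norm_U_sq_le.trans (comp_nsq_le X i))
  have hV : ∀ i, ‖(X i).V‖ ≤ e := fun i =>
    Real.le_sqrt_of_sq_le ((X i).norm_V_sq_le.trans (comp_nsq_le X i))
  have hD : ∀ i, ‖(X i).D‖ ≤ e := fun i =>
    Real.le_sqrt_of_sq_le ((X i).norm_D_sq_le.trans (comp_nsq_le X i))
  obtain ⟨b1, b2⟩ := data_bound hR hξ hG hN X hU hV hD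
  rw [objDeriv, frobInner_matGrad_shift Y (kron Θ) (kron Θ')]
  have p1 : frobInner (matGrad (lossKron Y) (kron Θ')) (kronD1 Θ X) ≤
    ξ * (2 * M ^ 2 * h ^ 5 * e) := (le_abs_self _).trans b2
  have p2 : frobInner ((kron Θ - kron Θ') * lagMat Y) (kronD1 Θ X * lagMat Y) ≤
      ‖(kron Θ - kron Θ') * lagMat Y‖ * (√β * (2 * M ^ 2 * h ^ 5 * e)) :=
    (frobInner_le _ _).trans (by gcongr)
  have p3 : lam₁ * (‖(Θ 0).coef‖ ^ 2 - ‖(Θ 1).coef‖ ^ 2)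
      * (frobInner (Θ 0).coef ((Θ 0).coefD1 (X 0)) - frobInner (Θ 1).coef ((Θ 1).coefD1 (X 1))) ≤
      lam₁ * |‖(Θ 0).coef‖ ^ 2 - ‖(Θ 1).coef‖ ^ 2| * (2 * M ^ 2 * h ^ 5 * e) := by
    have q : ∀ i, |frobInner (Θ i).coef ((Θ i).coefD1 (X i))| ≤ M ^ 2 * h ^ 5 * e := fun i =>
      (abs_frobInner_le _ _).trans ((mul_le_mul (hN i).coef.norm_le
        ((hN i).deriv _ e (hU i) (hV i) (hD i)).norm_le (norm_nonneg _)
        (hN i).coef.nonneg).trans_eq (by ring))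
    have q' : |frobInner (Θ 0).coef ((Θ 0).coefD1 (X 0))
        - frobInner (Θ 1).coef ((Θ 1).coefD1 (X 1))| ≤ 2 * M ^ 2 * h ^ 5 * e :=
      (abs_sub _ _).trans (by linarith [q 0, q 1])
    rw [mul_assoc, mul_assoc]
    refine mul_le_mul_of_nonneg_left ((le_abs_self _).trans ?_) hl₁
    rw [abs_mul]
    gcongr
  have p4 : ∑ i, (gramDeriv b (Θ i).U (X i).U + gramDeriv b (Θ i).V (X i).V) ≤
      4 * M * h * e * √(reg₂ b Θ) := by
    have q : ∀ i, gramDeriv b (Θ i).U (X i).U + gramDeriv b (Θ i).V (X i).V ≤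
        2 * (M * h) * e * (‖(Θ i).Uᵀ * (Θ i).U - b ^ 2 • 1‖
          + ‖(Θ i).Vᵀ * (Θ i).V - b ^ 2 • 1‖) := fun i => by
      have h1 := gramDeriv_le (b := b) (by positivity) (hN i).opU (hU i)
      have h2 := gramDeriv_le (b := b) (by positivity) (hN i).opV (hV i)
      linarith
    have hs : ‖(Θ 0).Uᵀ * (Θ 0).U - b ^ 2 • 1‖ + ‖(Θ 0).Vᵀ * (Θ 0).V - b ^ 2 • 1‖
        + (‖(Θ 1).Uᵀ * (Θ 1).U - b ^ 2 • 1‖ + ‖(Θ 1).Vᵀ * (Θ 1).V - b ^ 2 • 1‖) ≤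
        2 * √(reg₂ b Θ) := by
      refine abs_le_of_sq_le_sq' ?_ (by positivity) |>.2
      rw [mul_pow, Real.sq_sqrt (reg₂_nonneg b Θ), reg₂,
        Fin.sum_univ_two]
      generalize ‖(Θ 0).Uᵀ * (Θ 0).U - b ^ 2 • 1‖ = x
      generalize ‖(Θ 0).Vᵀ * (Θ 0).V - b ^ 2 • 1‖ = y
      generalize ‖(Θ 1).Uᵀ * (Θ 1).U - b ^ 2 • 1‖ = x'
      generalize ‖(Θ 1).Vᵀ * (Θ 1).V - b ^ 2 • 1‖ = y'
      nlinarith [sq_nonneg (x - y), sq_nonneg (x - x'), sq_nonneg (x - y'), sq_nonneg (y - x'),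
        sq_nonneg (y - y'), sq_nonneg (x' - y')]
    rw [Fin.sum_univ_two]
    have hm := mul_le_mul_of_nonneg_left hs (by positivity : 0 ≤ 2 * (M * h) * e)
    have := q 0
    have := q 1
    linarith
  have p5 := mul_le_mul_of_nonneg_left p4 hl₂
  linarith

theorem nsq_grad_le {Y : Fin (T + 1) → Matrix (Fin (p 0)) (Fin (p 1)) ℝ} {α β ξ lam₁ lam₂ b : ℝ}
    (hR : RSCRSS d s Y α β) (hξ : 0 ≤ ξ) (hl₁ : 0 ≤ lam₁) (hl₂ : 0 ≤ lam₂) (hM : 0 ≤ M)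
    (hh : 0 ≤ h)
    (hG : ∀ F : Params p d s, |frobInner (matGrad (lossKron Y) (kron Θ')) (kron F)| ≤
      ξ * (‖(F 1).coef‖ * ‖(F 0).coef‖))
    (hN : ∀ i, Comp.Near M h E (Θ i) (Θ' i)) :
    nsq (grad Y lam₁ lam₂ b Θ) ≤
      16 * M ^ 4 * h ^ 10 * (β * ‖(kron Θ - kron Θ') * lagMat Y‖ ^ 2 + ξ ^ 2
        + lam₁ ^ 2 * (‖(Θ 0).coef‖ ^ 2 - ‖(Θ 1).coef‖ ^ 2) ^ 2)
        + 64 * M ^ 2 * h ^ 2 * lam₂ ^ 2 * reg₂ b Θ := by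
  -- Testing the bound on directional derivatives against the gradient itself yields its norm.
  have h1 := objDeriv_le (b := b) hR hξ hl₁ hl₂ hM hh hG hN (grad Y lam₁ lam₂ b Θ)
  rw [← pairing_grad, pairing_self] at h1
  have hβ : 0 ≤ β := hR.1.le.trans hR.2.1
  have hr : 0 ≤ reg₂ b Θ := reg₂_nonneg b Θ
  set n := nsq (grad Y lam₁ lam₂ b Θ)
  have hn : 0 ≤ n := nsq_nonneg _
  set z := ‖(kron Θ - kron Θ') * lagMat Y‖
  set δ := ‖(Θ 0).coef‖ ^ 2 - ‖(Θ 1).coef‖ ^ 2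
  set B := 2 * M ^ 2 * h ^ 5 * (√β * z + ξ + lam₁ * |δ|) + 4 * M * h * lam₂ * √(reg₂ b Θ) with hB
  have hB0 : 0 ≤ B := by positivity
  have h2 : √n ≤ B := by
    by_cases h0 : √n = 0
    · rw [h0]; exact hB0
    · have : 0 < √n := lt_of_le_of_ne (Real.sqrt_nonneg _) (Ne.symm h0)
      nlinarith [Real.sq_sqrt hn]
  have h3 : n ≤ B ^ 2 := by
    rw [← Real.sq_sqrt hn]; gcongr
  refine h3.trans ?_
  have e : 16 * M ^ 4 * h ^ 10 * (β * z ^ 2 + ξ ^ 2 + lam₁ ^ 2 * δ ^ 2)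
      + 64 * M ^ 2 * h ^ 2 * lam₂ ^ 2 * reg₂ b Θ =
      4 * ((2 * M ^ 2 * h ^ 5 * (√β * z)) ^ 2 + (2 * M ^ 2 * h ^ 5 * ξ) ^ 2
        + (2 * M ^ 2 * h ^ 5 * (lam₁ * |δ|)) ^ 2 + (4 * M * h * lam₂ * √(reg₂ b Θ)) ^ 2) := by
    simp only [mul_pow, sq_abs, Real.sq_sqrt hβ, Real.sq_sqrt hr]; ring
  rw [e]
  have e2 : B = 2 * M ^ 2 * h ^ 5 * (√β * z) + 2 * M ^ 2 * h ^ 5 * ξ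
      + 2 * M ^ 2 * h ^ 5 * (lam₁ * |δ|) + 4 * M * h * lam₂ * √(reg₂ b Θ) := by rw [hB]; ring
  rw [e2]
  generalize 2 * M ^ 2 * h ^ 5 * (√β * z) = x
  generalize 2 * M ^ 2 * h ^ 5 * ξ = y
  generalize 2 * M ^ 2 * h ^ 5 * (lam₁ * |δ|) = x'
  generalize 4 * M * h * lam₂ * √(reg₂ b Θ) = y'
  nlinarith [sq_nonneg (x - y), sq_nonneg (x - x'), sq_nonneg (x - y'), sq_nonneg (y - x'),
    sq_nonneg (y - y'), sq_nonneg (x' - y')]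

end Descent

end

end MARCF

/-! ### Injectivity of the linearized parametrization modulo rotations. -/

namespace MARCF

noncomputable section

section Blocks

variable {l m n o : Type*} [Fintype l] [Fintype m] [Fintype n] [Fintype o]

theorem norm_le_fromCols_left (A : Matrix l m ℝ) (B : Matrix l n ℝ) :
    ‖A‖ ≤ ‖Matrix.fromCols A B‖ :=
  abs_le_of_sq_le_sq' (by rw [norm_fromCols_sq]; nlinarith [sq_nonneg ‖B‖]) (norm_nonneg _) |>.2

theorem norm_le_fromCols_right (A : Matrix l m ℝ) (B : Matrix l n ℝ) :
    ‖B‖ ≤ ‖Matrix.fromCols A B‖ :=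
  abs_le_of_sq_le_sq' (by rw [norm_fromCols_sq]; nlinarith [sq_nonneg ‖A‖]) (norm_nonneg _) |>.2

theorem norm_fromCols_le (A : Matrix l m ℝ) (B : Matrix l n ℝ) :
    ‖Matrix.fromCols A B‖ ≤ ‖A‖ + ‖B‖ :=
  abs_le_of_sq_le_sq' (by rw [norm_fromCols_sq]; nlinarith [norm_nonneg A, norm_nonneg B])
    (by positivity) |>.2

theorem norm_le_fromBlocks₁₁ (A : Matrix l m ℝ) (B : Matrix l n ℝ) (C : Matrix o m ℝ)
    (D : Matrix o n ℝ) : ‖A‖ ≤ ‖Matrix.fromBlocks A B C D‖ :=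
  abs_le_of_sq_le_sq' (by
    rw [norm_fromBlocks_sq]; nlinarith [sq_nonneg ‖B‖, sq_nonneg ‖C‖, sq_nonneg ‖D‖])
    (norm_nonneg _) |>.2

theorem norm_le_fromBlocks₁₂ (A : Matrix l m ℝ) (B : Matrix l n ℝ) (C : Matrix o m ℝ)
    (D : Matrix o n ℝ) : ‖B‖ ≤ ‖Matrix.fromBlocks A B C D‖ :=
  abs_le_of_sq_le_sq' (by
    rw [norm_fromBlocks_sq]; nlinarith [sq_nonneg ‖A‖, sq_nonneg ‖C‖, sq_nonneg ‖D‖])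
    (norm_nonneg _) |>.2

theorem norm_le_fromBlocks₂₂ (A : Matrix l m ℝ) (B : Matrix l n ℝ) (C : Matrix o m ℝ)
    (D : Matrix o n ℝ) : ‖D‖ ≤ ‖Matrix.fromBlocks A B C D‖ :=
  abs_le_of_sq_le_sq' (by
    rw [norm_fromBlocks_sq]; nlinarith [sq_nonneg ‖A‖, sq_nonneg ‖C‖, sq_nonneg ‖B‖])
    (norm_nonneg _) |>.2

theorem norm_fromBlocks_diag_le (A : Matrix l m ℝ) (D : Matrix o n ℝ) :
    ‖Matrix.fromBlocks A 0 0 D‖ ≤ ‖A‖ + ‖D‖ :=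
  abs_le_of_sq_le_sq' (by
    rw [norm_fromBlocks_sq]; simp; nlinarith [norm_nonneg A, norm_nonneg D])
    (by positivity) |>.2

end Blocks

section Projection

variable {m n : Type} {k : Type*} [Fintype m] [Fintype n] [Fintype k] [DecidableEq n]
  {U : Matrix m n ℝ} {b : ℝ}

theorem norm_sub_proj_le (hb : 0 < b) (h : Uᵀ * U = b ^ 2 • (1 : Matrix n n ℝ))
    (X : Matrix m k ℝ) : ‖X - (b ^ 2)⁻¹ • (U * (Uᵀ * X))‖ ≤ ‖X‖ := by
  refine abs_le_of_sq_le_sq' ?_ (norm_nonneg _) |>.2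
  rw [norm_sub_sq_frob, frobInner_smul_right, norm_smul, norm_mul_of_gram hb.le h,
    frobInner_comm, frobInner_mul_left, frobInner_self, Real.norm_eq_abs, abs_of_pos (by positivity)]
  have : ((b ^ 2)⁻¹ * (b * ‖Uᵀ * X‖)) ^ 2 = (b ^ 2)⁻¹ * ‖Uᵀ * X‖ ^ 2 := by field_simp
  rw [this]
  have : 0 ≤ (b ^ 2)⁻¹ * ‖Uᵀ * X‖ ^ 2 := by positivity
  linarith

omit [Fintype k] in
theorem sub_proj_mul (hb : 0 < b) (h : Uᵀ * U = b ^ 2 • (1 : Matrix n n ℝ)) (S : Matrix n k ℝ) :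
    U * S - (b ^ 2)⁻¹ • (U * (Uᵀ * (U * S))) = 0 := by
  rw [← Matrix.mul_assoc Uᵀ, h, Matrix.smul_mul, Matrix.one_mul, Matrix.mul_smul, smul_smul,
    inv_mul_cancel₀ (by positivity), one_smul, sub_self]

theorem norm_inv_smul_mul (hb : 0 < b) (h : Uᵀ * U = b ^ 2 • (1 : Matrix n n ℝ))
    (S : Matrix n k ℝ) : ‖(b ^ 2)⁻¹ • (U * S)‖ = b⁻¹ * ‖S‖ := by
  rw [norm_smul, norm_mul_of_gram hb.le h, Real.norm_eq_abs, abs_of_pos (by positivity)]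
  field_simp

end Projection

namespace Comp

variable {p d s : ℕ}

/-- An identified component whose core matrix has smallest singular value at least `m` and whose
specific subspaces have largest canonical cosine at most `σ`. -/
structure Base (b m σ : ℝ) (F : Comp p d s) : Prop where
  ident : F.Identified b
  left : ∀ {k : Type} [Fintype k] (X : Matrix k (Fin d ⊕ Fin s) ℝ), m * ‖X‖ ≤ ‖X * F.D‖
  right : ∀ {k : Type} [Fintype k] (X : Matrix (Fin d ⊕ Fin s) k ℝ), m * ‖X‖ ≤ ‖F.D * X‖
  angle : 0 < d → OpBound (F.Rᵀ * F.P) (b ^ 2 * σ)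

/-- The component of the transposed coefficient matrix. -/
def flip (F : Comp p d s) : Comp p d s := ⟨F.C, F.P, F.R, F.Dᵀ⟩

theorem flip_U (F : Comp p d s) : F.flip.U = F.V := rfl
theorem flip_V (F : Comp p d s) : F.flip.V = F.U := rfl

theorem coefD1_flip (F X : Comp p d s) : F.flip.coefD1 X.flip = (F.coefD1 X)ᵀ := by
  simp only [coefD1, flip_U, flip_V, Matrix.transpose_add, Matrix.transpose_mul,
    Matrix.transpose_transpose, Matrix.mul_assoc]
  simp only [flip]
  abel

theorem Base.flip {b m σ : ℝ} {F : Comp p d s} (hσ : 0 ≤ σ) (h : Base b m σ F) :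
    Base b m σ F.flip where
  ident := ⟨h.ident.2, h.ident.1⟩
  left X := by
    have := h.right Xᵀ
    rw [← norm_transpose_frob X, ← norm_transpose_frob (X * _)]
    simpa [Comp.flip] using this
  right X := by
    have := h.left Xᵀ
    rw [← norm_transpose_frob X, ← norm_transpose_frob (_ * X)]
    simpa [Comp.flip] using this
  angle hd := by
    have := (h.angle hd).transpose (by positivity)
    simpa [Comp.flip] using this

theorem gram_C {b : ℝ} {F : Comp p d s} (h : F.Identified b) :
    F.Cᵀ * F.C = b ^ 2 • (1 : Matrix (Fin d) (Fin d) ℝ) := by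
  have := h.1
  rw [U, Matrix.transpose_fromCols, Matrix.fromRows_mul_fromCols, ← Matrix.fromBlocks_one,
    Matrix.fromBlocks_smul, Matrix.fromBlocks_inj] at this
  exact this.1

theorem gram_R {b : ℝ} {F : Comp p d s} (h : F.Identified b) :
    F.Rᵀ * F.R = b ^ 2 • (1 : Matrix (Fin s) (Fin s) ℝ) := by
  have := h.1
  rw [U, Matrix.transpose_fromCols, Matrix.fromRows_mul_fromCols, ← Matrix.fromBlocks_one,
    Matrix.fromBlocks_smul, Matrix.fromBlocks_inj] at this
  exact this.2.2.2

theorem gram_P {b : ℝ} {F : Comp p d s} (h : F.Identified b) :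
    F.Pᵀ * F.P = b ^ 2 • (1 : Matrix (Fin s) (Fin s) ℝ) :=
  gram_R (F := F.flip) ⟨h.2, h.1⟩

theorem norm_le_of_sym_of_skew {n : Type*} [Fintype n] {M : Matrix n n ℝ} {ω : ℝ}
    (h1 : ‖Mᵀ + M‖ ≤ ω) (h2 : ‖M - Mᵀ‖ ≤ ω) : ‖M‖ ≤ ω := by
  have h : (2 : ℝ) • M = (Mᵀ + M) + (M - Mᵀ) := by rw [two_smul]; abel
  have h3 : ‖(2 : ℝ) • M‖ ≤ ω + ω := by rw [h]; exact (norm_add_le _ _).trans (add_le_add h1 h2)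
  rw [norm_smul, Real.norm_two] at h3
  linarith

/-- Control of the column spaces of a perturbation by its first-order effect on the coefficient
matrix and on the Gram matrix. -/
theorem Base.half {b m σ ω : ℝ} {F : Comp p d s} (hb : 0 < b) (hm : 0 < m) (h : Base b m σ F)
    (X : Comp p d s) (hω : ‖X.Uᵀ * F.U + F.Uᵀ * X.U‖ ≤ ω)
    (hC : ‖F.Cᵀ * X.C - (F.Cᵀ * X.C)ᵀ‖ ≤ ω) (hR : ‖F.Rᵀ * X.R - (F.Rᵀ * X.R)ᵀ‖ ≤ ω) :
    ‖X.C - (b ^ 2)⁻¹ • (F.R * (F.Rᵀ * X.C))‖ ≤ ‖F.coefD1 X‖ / (b * m) + ω / b ∧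
    ‖X.R‖ ≤ 2 * (‖F.coefD1 X‖ / (b * m) + ω / b) + ‖X.C‖ := by
  have hU := h.ident.1
  have gC := gram_C h.ident
  have gR := gram_R h.ident
  set e := ‖F.coefD1 X‖ with he
  have hZ : ‖X.U - (b ^ 2)⁻¹ • (F.U * (F.Uᵀ * X.U))‖ ≤ e / (b * m) := by
    -- Projecting away from the columns of `F.U` kills the variations of `D` and `V`; only that of
    -- `U` survives, and `D` can then be divided out at cost `m`.
    have h1 : (X.U - (b ^ 2)⁻¹ • (F.U * (F.Uᵀ * X.U))) * F.D * F.Vᵀ =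
        F.coefD1 X - (b ^ 2)⁻¹ • (F.U * (F.Uᵀ * F.coefD1 X)) := by
      have h2 := sub_proj_mul hb hU (X.D * F.Vᵀ)
      have h3 := sub_proj_mul hb hU (F.D * X.Vᵀ)
      rw [coefD1]
      simp only [Matrix.sub_mul, Matrix.mul_add, Matrix.smul_mul, smul_add, Matrix.mul_assoc]
        at h2 h3 ⊢
      rw [sub_eq_zero] at h2 h3
      rw [← h2, ← h3]
      abel
    have h4 := norm_sub_proj_le hb hU (F.coefD1 X)
    rw [← h1, norm_mul_transpose_of_gram hb.le h.ident.2] at h4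
    have h5 := h.left (X.U - (b ^ 2)⁻¹ • (F.U * (F.Uᵀ * X.U)))
    rw [le_div_iff₀ (by positivity)]
    nlinarith
  have hsplit : X.U - (b ^ 2)⁻¹ • (F.U * (F.Uᵀ * X.U)) = Matrix.fromCols
      (X.C - (b ^ 2)⁻¹ • (F.C * (F.Cᵀ * X.C)) - (b ^ 2)⁻¹ • (F.R * (F.Rᵀ * X.C)))
      (X.R - (b ^ 2)⁻¹ • (F.C * (F.Cᵀ * X.R)) - (b ^ 2)⁻¹ • (F.R * (F.Rᵀ * X.R))) := by
    rw [U, U, Matrix.transpose_fromCols, Matrix.fromRows_mul_fromCols,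
      Matrix.fromCols_mul_fromBlocks]
    ext i (j | j) <;> simp <;> ring
  rw [hsplit] at hZ
  have hZ1 := (norm_le_fromCols_left _ _).trans hZ
  have hZ2 := (norm_le_fromCols_right _ _).trans hZ
  have hblk : X.Uᵀ * F.U + F.Uᵀ * X.U = Matrix.fromBlocks (X.Cᵀ * F.C + F.Cᵀ * X.C)
      (X.Cᵀ * F.R + F.Cᵀ * X.R) (X.Rᵀ * F.C + F.Rᵀ * X.C) (X.Rᵀ * F.R + F.Rᵀ * X.R) := by
    rw [U, U, Matrix.transpose_fromCols, Matrix.transpose_fromCols, Matrix.fromRows_mul_fromCols,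
      Matrix.fromRows_mul_fromCols, Matrix.fromBlocks_add]
  rw [hblk] at hω
  have w11 := (norm_le_fromBlocks₁₁ _ _ _ _).trans hω
  have w12 := (norm_le_fromBlocks₁₂ _ _ _ _).trans hω
  have w22 := (norm_le_fromBlocks₂₂ _ _ _ _).trans hω
  -- The Gram matrix controls the symmetric part of a diagonal block; the gauge hypothesis supplies
  -- the skew part.
  have cC : ‖F.Cᵀ * X.C‖ ≤ ω := norm_le_of_sym_of_skew (by simpa using w11) hC
  have cR : ‖F.Rᵀ * X.R‖ ≤ ω := norm_le_of_sym_of_skew (by simpa using w22) hR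
  have hbi : 0 < b⁻¹ := inv_pos.mpr hb
  have q1 : ‖(b ^ 2)⁻¹ • (F.C * (F.Cᵀ * X.C))‖ ≤ ω / b := by
    rw [norm_inv_smul_mul hb gC, div_eq_inv_mul]; gcongr
  have q2 : ‖(b ^ 2)⁻¹ • (F.R * (F.Rᵀ * X.R))‖ ≤ ω / b := by
    rw [norm_inv_smul_mul hb gR, div_eq_inv_mul]; gcongr
  -- The off-diagonal block cannot be rotated away. The Gram matrix only relates `Cᵀ X.R` to `X.Cᵀ
  -- R`, so `X.R` is bounded in terms of `X.C`.
  have q3 : ‖(b ^ 2)⁻¹ • (F.C * (F.Cᵀ * X.R))‖ ≤ ω / b + ‖X.C‖ := by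
    have h1 : ‖X.Cᵀ * F.R‖ ≤ b * ‖X.C‖ := by
      have := (opBound_of_gram hb.le gR).mul_left hb.le X.Cᵀ
      rwa [norm_transpose_frob] at this
    have h2 : ‖F.Cᵀ * X.R‖ ≤ ω + b * ‖X.C‖ := by
      have e1 : F.Cᵀ * X.R = (X.Cᵀ * F.R + F.Cᵀ * X.R) - X.Cᵀ * F.R := by abel
      rw [e1]; exact (norm_sub_le _ _).trans (add_le_add w12 h1)
    rw [norm_inv_smul_mul hb gC]
    calc b⁻¹ * ‖F.Cᵀ * X.R‖ ≤ b⁻¹ * (ω + b * ‖X.C‖) := by gcongr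
      _ = _ := by field_simp
  constructor
  · have e1 : X.C - (b ^ 2)⁻¹ • (F.R * (F.Rᵀ * X.C)) =
        (X.C - (b ^ 2)⁻¹ • (F.C * (F.Cᵀ * X.C)) - (b ^ 2)⁻¹ • (F.R * (F.Rᵀ * X.C)))
        + (b ^ 2)⁻¹ • (F.C * (F.Cᵀ * X.C)) := by abel
    rw [e1]
    exact (norm_add_le _ _).trans (add_le_add hZ1 q1)
  · have e1 : X.R = (X.R - (b ^ 2)⁻¹ • (F.C * (F.Cᵀ * X.R)) - (b ^ 2)⁻¹ • (F.R * (F.Rᵀ * X.R)))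
        + (b ^ 2)⁻¹ • (F.C * (F.Cᵀ * X.R)) + (b ^ 2)⁻¹ • (F.R * (F.Rᵀ * X.R)) := by abel
    have h1 : ‖X.R‖ ≤ e / (b * m) + (ω / b + ‖X.C‖) + ω / b := by
      conv_lhs => rw [e1]
      exact (norm_add_le _ _).trans (add_le_add ((norm_add_le _ _).trans (add_le_add hZ2 q3)) q2)
    have : 0 ≤ e / (b * m) := by positivity
    linarith

/-- A matrix whose columns lie almost in two subspaces separated by an angle must be small. The
norms of `Rᵀ X` and `Pᵀ X` each bound the other up to the factor `σ < 1`, which closes the loop. -/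
theorem norm_C_le_of_angle {b σ g τ : ℝ} (hb : 0 < b) (hσ : 0 ≤ σ) (hg : 0 < g)
    (hσg : σ ^ 2 ≤ 1 - g ^ 2) (hτ : 0 ≤ τ) {F : Comp p d s} (h : F.Identified b)
    (ha : 0 < d → OpBound (F.Rᵀ * F.P) (b ^ 2 * σ)) (X : Matrix (Fin p) (Fin d) ℝ)
    (h1 : ‖X - (b ^ 2)⁻¹ • (F.R * (F.Rᵀ * X))‖ ≤ τ)
    (h2 : ‖X - (b ^ 2)⁻¹ • (F.P * (F.Pᵀ * X))‖ ≤ τ) : ‖X‖ ≤ (1 + 2 / g ^ 2) * τ := by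
  rcases Nat.eq_zero_or_pos d with rfl | hd
  · have : X = 0 := by ext i j; exact j.elim0
    rw [this, norm_zero]; positivity
  have gR := gram_R h
  have gP := gram_P h
  have hb2 : 0 < b ^ 2 := by positivity
  have aux : ∀ (A B : Matrix (Fin p) (Fin s) ℝ), OpBound A b → OpBound (Aᵀ * B) (b ^ 2 * σ) →
      ‖X - (b ^ 2)⁻¹ • (B * (Bᵀ * X))‖ ≤ τ → ‖Aᵀ * X‖ ≤ σ * ‖Bᵀ * X‖ + b * τ := by
    intro A B hA hAB hX
    have e1 : Aᵀ * X = (b ^ 2)⁻¹ • (Aᵀ * B * (Bᵀ * X))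
        + Aᵀ * (X - (b ^ 2)⁻¹ • (B * (Bᵀ * X))) := by
      rw [Matrix.mul_sub, Matrix.mul_smul, Matrix.mul_assoc]; abel
    rw [e1]
    refine (norm_add_le _ _).trans (add_le_add ?_ ?_)
    · rw [norm_smul, Real.norm_eq_abs, abs_of_pos (by positivity)]
      calc (b ^ 2)⁻¹ * ‖Aᵀ * B * (Bᵀ * X)‖ ≤ (b ^ 2)⁻¹ * (b ^ 2 * σ * ‖Bᵀ * X‖) := by
            gcongr; exact hAB _
        _ = _ := by field_simp
    · exact ((hA.transpose hb.le) _).trans (by gcongr)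
  have y1 := aux F.R F.P (opBound_of_gram hb.le gR) (ha hd) h2
  have y2 := aux F.P F.R (opBound_of_gram hb.le gP)
    (by simpa using (ha hd).transpose (by positivity)) h1
  have hσ1 : σ ≤ 1 := by nlinarith
  have y3 : g ^ 2 * ‖F.Rᵀ * X‖ ≤ 2 * (b * τ) := by
    have hbt : 0 ≤ b * τ := by positivity
    have := mul_le_mul_of_nonneg_left y2 hσ
    nlinarith [norm_nonneg (F.Rᵀ * X)]
  have y4 : ‖(b ^ 2)⁻¹ • (F.R * (F.Rᵀ * X))‖ ≤ 2 / g ^ 2 * τ := by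
    rw [norm_inv_smul_mul hb gR]
    calc b⁻¹ * ‖F.Rᵀ * X‖ = (g ^ 2 * ‖F.Rᵀ * X‖) / (b * g ^ 2) := by field_simp
      _ ≤ 2 * (b * τ) / (b * g ^ 2) := by gcongr
      _ = _ := by field_simp
  have e1 : X = (X - (b ^ 2)⁻¹ • (F.R * (F.Rᵀ * X))) + (b ^ 2)⁻¹ • (F.R * (F.Rᵀ * X)) := by abel
  calc ‖X‖ = ‖(X - (b ^ 2)⁻¹ • (F.R * (F.Rᵀ * X))) + (b ^ 2)⁻¹ • (F.R * (F.Rᵀ * X))‖ := by rw [← e1]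
    _ ≤ τ + 2 / g ^ 2 * τ := (norm_add_le _ _).trans (add_le_add h1 y4)
    _ = _ := by ring

/-- Injectivity of the first-order map modulo rotations, with explicit bounds. -/
theorem Base.linear_bound {b m σ g ω L : ℝ} {F : Comp p d s} (hb : 0 < b) (hm : 0 < m)
    (hσ : 0 ≤ σ) (hg : 0 < g) (hσg : σ ^ 2 ≤ 1 - g ^ 2) (h : Base b m σ F) (hL : ‖F.D‖ ≤ L)
    (X : Comp p d s) (hωU : ‖X.Uᵀ * F.U + F.Uᵀ * X.U‖ ≤ ω)
    (hωV : ‖X.Vᵀ * F.V + F.Vᵀ * X.V‖ ≤ ω)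
    (hC : ‖F.Cᵀ * X.C - (F.Cᵀ * X.C)ᵀ‖ ≤ ω) (hR : ‖F.Rᵀ * X.R - (F.Rᵀ * X.R)ᵀ‖ ≤ ω)
    (hP : ‖F.Pᵀ * X.P - (F.Pᵀ * X.P)ᵀ‖ ≤ ω) {τ : ℝ}
    (hτ : ‖F.coefD1 X‖ / (b * m) + ω / b ≤ τ) :
    ‖X.C‖ ≤ (3 + 2 / g ^ 2) * τ ∧ ‖X.R‖ ≤ (3 + 2 / g ^ 2) * τ ∧ ‖X.P‖ ≤ (3 + 2 / g ^ 2) * τ ∧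
    ‖X.D‖ ≤ ‖F.coefD1 X‖ / b ^ 2 + L / b * (4 * (3 + 2 / g ^ 2) * τ) := by
  have hω : 0 ≤ ω := (norm_nonneg _).trans hC
  have hτ0 : 0 ≤ τ := le_trans (by positivity) hτ
  obtain ⟨c1, r1⟩ := h.half hb hm X hωU hC hR
  -- Transposition exchanges `[C R]` and `[C P]`, so the second projection estimate is the first one
  -- for the flipped component.
  obtain ⟨c2, r2⟩ := (h.flip hσ).half hb hm X.flip hωV hC hP
  rw [coefD1_flip, norm_transpose_frob] at c2 r2
  have hXC : ‖X.C‖ ≤ (1 + 2 / g ^ 2) * τ :=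
    norm_C_le_of_angle hb hσ hg hσg hτ0 h.ident h.angle X.C (c1.trans hτ) (c2.trans hτ)
  change ‖X.P‖ ≤ _ + ‖X.C‖ at r2
  have hXR : ‖X.R‖ ≤ (3 + 2 / g ^ 2) * τ := by linarith
  have hXP : ‖X.P‖ ≤ (3 + 2 / g ^ 2) * τ := by linarith
  have hXC' : ‖X.C‖ ≤ (3 + 2 / g ^ 2) * τ := by linarith
  refine ⟨hXC', hXR, hXP, ?_⟩
  have hU : ‖X.U‖ ≤ 2 * (3 + 2 / g ^ 2) * τ := (norm_fromCols_le _ _).trans (by linarith)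
  have hV : ‖X.V‖ ≤ 2 * (3 + 2 / g ^ 2) * τ := (norm_fromCols_le _ _).trans (by linarith)
  have hL0 : 0 ≤ L := (norm_nonneg _).trans hL
  -- Once the column spaces are controlled, the variation of `D` is what remains of the first-order
  -- term.
  have e1 : F.U * X.D * F.Vᵀ = F.coefD1 X - X.U * F.D * F.Vᵀ - F.U * F.D * X.Vᵀ := by
    rw [coefD1]; abel
  have n1 : ‖X.U * F.D * F.Vᵀ‖ ≤ 2 * (3 + 2 / g ^ 2) * τ * L * b :=
    norm_sandwich_le (by positivity) hb.le ((opBound_norm _).mono hU)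
      (opBound_of_gram hb.le h.ident.2) hL
  have n2 : ‖F.U * F.D * X.Vᵀ‖ ≤ b * L * (2 * (3 + 2 / g ^ 2) * τ) :=
    norm_sandwich_le hb.le (by positivity) (opBound_of_gram hb.le h.ident.1)
      ((opBound_norm _).mono hV) hL
  have n3 : b ^ 2 * ‖X.D‖ ≤ ‖F.coefD1 X‖ + b * L * (4 * (3 + 2 / g ^ 2) * τ) := by
    have : ‖F.U * X.D * F.Vᵀ‖ = b ^ 2 * ‖X.D‖ := by
      rw [norm_mul_transpose_of_gram hb.le h.ident.2, norm_mul_of_gram hb.le h.ident.1]; ring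
    rw [← this, e1]
    refine (norm_sub_le _ _).trans ((add_le_add (norm_sub_le _ _) le_rfl).trans ?_)
    linarith
  have : ‖F.coefD1 X‖ / b ^ 2 + L / b * (4 * (3 + 2 / g ^ 2) * τ) =
      (‖F.coefD1 X‖ + b * L * (4 * (3 + 2 / g ^ 2) * τ)) / b ^ 2 := by
    field_simp
  rw [this, le_div_iff₀ (by positivity)]
  linarith

end Comp

/-! ### Near-alignment by Cayley rotations. -/

section Cayley

variable {n : Type} [Fintype n] [DecidableEq n]

/-- Skewness makes `X` and `A X` orthogonal, so `1 - A` cannot shrink norms. This gives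
invertibility and all estimates for the Cayley transform. -/
theorem norm_le_one_sub_skew_mul {k : Type*} [Fintype k] {A : Matrix n n ℝ} (hA : Aᵀ = -A)
    (X : Matrix n k ℝ) : ‖X‖ ≤ ‖(1 - A) * X‖ := by
  refine abs_le_of_sq_le_sq' ?_ (norm_nonneg _) |>.2
  have h0 : frobInner X (A * X) = 0 := by
    have h1 : frobInner (A * X) X = -frobInner X (A * X) := by
      rw [frobInner_mul_left, hA, Matrix.neg_mul, frobInner_neg_right]
    rw [frobInner_comm] at h1
    linarith
  rw [Matrix.sub_mul, Matrix.one_mul, norm_sub_sq_frob, h0]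
  nlinarith [sq_nonneg ‖A * X‖]

/-- Take `Q = (1 - A)⁻¹ (1 + A)` with `A = Ω / 2`. Multiplied by `1 - A`, the errors `Q - 1` and `Q
- 1 - Ω` become exactly `Ω` and `Ω² / 2`. -/
theorem exists_cayley {Ω : Matrix n n ℝ} (hΩ : Ωᵀ = -Ω) :
    ∃ Q : Matrix n n ℝ, Q ∈ Matrix.orthogonalGroup n ℝ ∧ ‖Q - 1‖ ≤ ‖Ω‖ ∧
      ‖Q - 1 - Ω‖ ≤ 1 / 2 * ‖Ω‖ ^ 2 := by
  set A : Matrix n n ℝ := (1 / 2 : ℝ) • Ω with hA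
  have hAs : Aᵀ = -A := by rw [hA, Matrix.transpose_smul, hΩ, smul_neg]
  have hAΩ : A + A = Ω := by rw [hA, ← add_smul]; norm_num
  have hu : IsUnit (1 - A) := by
    rw [← Matrix.mulVec_injective_iff_isUnit]
    intro x y hxy
    have h1 : (1 - A) * Matrix.replicateCol Unit (x - y) = 0 := by
      rw [← Matrix.replicateCol_mulVec, Matrix.mulVec_sub, sub_eq_zero.mpr hxy]
      ext; simp
    have h2 := norm_le_one_sub_skew_mul hAs (Matrix.replicateCol Unit (x - y))
    rw [h1, norm_zero, norm_le_zero_iff] at h2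
    rw [← sub_eq_zero]
    ext i
    exact congrFun (congrFun h2 i) ()
  obtain ⟨B, hB1, hB2⟩ := isUnit_iff_exists.mp hu
  have q1 : (1 - A) * (B * (1 + A)) = 1 + A := by rw [← Matrix.mul_assoc, hB1, Matrix.one_mul]
  have q2 : B * (1 + A) * (1 - A) = 1 + A := by
    rw [Matrix.mul_assoc, show (1 + A) * (1 - A) = (1 - A) * (1 + A) by noncomm_ring,
      ← Matrix.mul_assoc, hB2, Matrix.one_mul]
  set Q := B * (1 + A) with hQ
  have q3 : Qᵀ * (1 + A) = 1 - A := by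
    have := congrArg Matrix.transpose q1
    simpa [Matrix.transpose_mul, hAs, sub_eq_add_neg] using this
  have q4 : Qᵀ * Q = 1 := by
    calc Qᵀ * Q = Qᵀ * Q * ((1 - A) * B) := by rw [hB1, Matrix.mul_one]
      _ = Qᵀ * (Q * (1 - A)) * B := by simp only [Matrix.mul_assoc]
      _ = 1 := by rw [q2, q3, hB1]
  refine ⟨Q, ?_, ?_, ?_⟩
  · rw [Matrix.mem_orthogonalGroup_iff']
    exact q4
  · have := norm_le_one_sub_skew_mul hAs (Q - 1)
    rwa [Matrix.mul_sub, q1, Matrix.mul_one, show (1 + A) - (1 - A) = A + A by abel, hAΩ] at this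
  · have h1 := norm_le_one_sub_skew_mul hAs (Q - 1 - Ω)
    have h2 : (1 - A) * (Q - 1 - Ω) = (1 / 2 : ℝ) • (Ω * Ω) := by
      rw [Matrix.mul_sub, Matrix.mul_sub, q1, Matrix.mul_one, Matrix.sub_mul, Matrix.one_mul, hA,
        Matrix.smul_mul]
      module
    rw [h2, norm_smul] at h1
    refine h1.trans ?_
    rw [sq, Real.norm_of_nonneg (by norm_num)]
    gcongr
    exact Matrix.frobenius_norm_mul _ _

/-- An explicit rotation replaces Procrustes alignment. Rotating by the Cayley transform of the skew
part of `b⁻² Cᵀ (C' - C)` cancels that part to first order, and a skew residue of order `E²` is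
harmless. -/
theorem exists_gauge {m : Type} [Fintype m] {b E : ℝ} (hb : 0 < b) (hE : E ≤ b)
    {C C' : Matrix m n ℝ} (hC : Cᵀ * C = b ^ 2 • (1 : Matrix n n ℝ)) (h : ‖C' - C‖ ≤ E) :
    ∃ Q ∈ Matrix.orthogonalGroup n ℝ, ‖Q - 1‖ ≤ E / b ∧
      ‖(C * Q)ᵀ * (C' - C * Q) - ((C * Q)ᵀ * (C' - C * Q))ᵀ‖ ≤ 4 * E ^ 2 := by
  have hE0 : 0 ≤ E := (norm_nonneg _).trans h
  set N : Matrix n n ℝ := (b ^ 2)⁻¹ • (Cᵀ * (C' - C)) with hN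
  have hNb : ‖N‖ ≤ E / b := by
    rw [hN, norm_smul, Real.norm_eq_abs, abs_of_pos (by positivity)]
    have := (opBound_of_gram hb.le hC).transpose hb.le (k := n) (C' - C)
    calc (b ^ 2)⁻¹ * ‖Cᵀ * (C' - C)‖ ≤ (b ^ 2)⁻¹ * (b * E) := by
          gcongr; exact this.trans (by gcongr)
      _ = _ := by field_simp
  have hCC : Cᵀ * C' = b ^ 2 • (1 + N) := by
    rw [smul_add, hN, smul_smul, mul_inv_cancel₀ (by positivity), one_smul, Matrix.mul_sub, hC]
    abel
  set S : Matrix n n ℝ := (1 / 2 : ℝ) • (N + Nᵀ) with hS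
  set Ω : Matrix n n ℝ := (1 / 2 : ℝ) • (N - Nᵀ) with hΩ
  have hNt : ‖Nᵀ‖ ≤ E / b := by rwa [norm_transpose_frob]
  have hSb : ‖S‖ ≤ E / b := by
    rw [hS, norm_smul, Real.norm_of_nonneg (by norm_num)]
    linarith [norm_add_le N Nᵀ]
  have hΩb : ‖Ω‖ ≤ E / b := by
    rw [hΩ, norm_smul, Real.norm_of_nonneg (by norm_num)]
    linarith [norm_sub_le N Nᵀ]
  have hSt : Sᵀ = S := by
    rw [hS, Matrix.transpose_smul, Matrix.transpose_add, Matrix.transpose_transpose, add_comm]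
  have hΩt : Ωᵀ = -Ω := by
    rw [hΩ, Matrix.transpose_smul, Matrix.transpose_sub, Matrix.transpose_transpose, ← smul_neg,
      neg_sub]
  have hNS : N = S + Ω := by rw [hS, hΩ]; module
  obtain ⟨Q, hQ, hQ1, hQ2⟩ := exists_cayley hΩt
  refine ⟨Q, hQ, hQ1.trans hΩb, ?_⟩
  have hQQ : Qᵀ * Q = 1 := (Matrix.mem_orthogonalGroup_iff' n ℝ).mp hQ
  set r := Q - 1 - Ω with hr
  have hQr : Q = 1 + Ω + r := by rw [hr]; abel
  have e1 : (C * Q)ᵀ * (C' - C * Q) = b ^ 2 • (Qᵀ * (1 + N) - 1) := by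
    rw [Matrix.mul_sub, Matrix.transpose_mul, Matrix.mul_assoc, hCC, Matrix.mul_assoc,
      ← Matrix.mul_assoc Cᵀ, hC, Matrix.smul_mul, Matrix.mul_smul, Matrix.mul_smul, Matrix.one_mul,
      hQQ, smul_sub]
  -- All first-order terms have cancelled. The four remaining terms are quadratic, whence the
  -- constant `4`.
  have e2 : Qᵀ * (1 + N) - 1 - (Qᵀ * (1 + N) - 1)ᵀ =
      rᵀ * (1 + N) - (rᵀ * (1 + N))ᵀ - Ω * S - S * Ω := by
    rw [hQr, hNS]
    simp only [Matrix.transpose_add, Matrix.transpose_sub, Matrix.transpose_mul,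
      Matrix.transpose_neg, Matrix.transpose_one, Matrix.transpose_transpose, hSt, hΩt]
    noncomm_ring
  rw [e1, Matrix.transpose_smul, ← smul_sub, e2, norm_smul, Real.norm_eq_abs,
    abs_of_pos (by positivity)]
  have hEb : E / b ≤ 1 := (div_le_one hb).mpr hE
  have hEb0 : 0 ≤ E / b := by positivity
  have n1 : ‖r‖ ≤ 1 / 2 * (E / b) ^ 2 := hQ2.trans (by gcongr)
  have n2 : ‖rᵀ * (1 + N)‖ ≤ (E / b) ^ 2 := by
    rw [Matrix.mul_add, Matrix.mul_one]
    have h1 : ‖rᵀ * N‖ ≤ 1 / 2 * (E / b) ^ 2 * 1 := by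
      refine (Matrix.frobenius_norm_mul _ _).trans ?_
      rw [norm_transpose_frob]
      gcongr
      exact hNb.trans hEb
    refine (norm_add_le _ _).trans ?_
    rw [norm_transpose_frob]
    linarith
  have n3 : ‖Ω * S‖ ≤ (E / b) ^ 2 := by
    rw [sq]; exact (Matrix.frobenius_norm_mul _ _).trans (by gcongr)
  have n4 : ‖S * Ω‖ ≤ (E / b) ^ 2 := by
    rw [sq]; exact (Matrix.frobenius_norm_mul _ _).trans (by gcongr)
  have n5 : ‖rᵀ * (1 + N) - (rᵀ * (1 + N))ᵀ - Ω * S - S * Ω‖ ≤ 4 * (E / b) ^ 2 := by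
    refine (norm_sub_le _ _).trans ((add_le_add ((norm_sub_le _ _).trans
      (add_le_add (norm_sub_le _ _) le_rfl)) le_rfl).trans ?_)
    rw [norm_transpose_frob]
    linarith
  calc b ^ 2 * _ ≤ b ^ 2 * (4 * (E / b) ^ 2) := by gcongr
    _ = 4 * E ^ 2 := by field_simp

end Cayley

end

end MARCF

/-! ### The rotation action and quantitative injectivity. -/

namespace MARCF

noncomputable section

namespace Comp

variable {p d s : ℕ}

/-- The action of orthogonal rotations on a component. -/
def rot (Q₁ : Matrix (Fin d) (Fin d) ℝ) (Q₂ Q₃ : Matrix (Fin s) (Fin s) ℝ) (F : Comp p d s) :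
    Comp p d s where
  C := F.C * Q₁
  R := F.R * Q₂
  P := F.P * Q₃
  D := (Matrix.fromBlocks Q₁ 0 0 Q₂)ᵀ * F.D * Matrix.fromBlocks Q₁ 0 0 Q₃

theorem rot_U (Q₁ : Matrix (Fin d) (Fin d) ℝ) (Q₂ Q₃ : Matrix (Fin s) (Fin s) ℝ)
    (F : Comp p d s) : (F.rot Q₁ Q₂ Q₃).U = F.U * Matrix.fromBlocks Q₁ 0 0 Q₂ := by
  simp [U, rot, Matrix.fromCols_mul_fromBlocks]

theorem rot_V (Q₁ : Matrix (Fin d) (Fin d) ℝ) (Q₂ Q₃ : Matrix (Fin s) (Fin s) ℝ)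
    (F : Comp p d s) : (F.rot Q₁ Q₂ Q₃).V = F.V * Matrix.fromBlocks Q₁ 0 0 Q₃ := by
  simp [V, rot, Matrix.fromCols_mul_fromBlocks]

theorem rot_rot (Q₁ Q₁' : Matrix (Fin d) (Fin d) ℝ) (Q₂ Q₃ Q₂' Q₃' : Matrix (Fin s) (Fin s) ℝ)
    (F : Comp p d s) :
    (F.rot Q₁ Q₂ Q₃).rot Q₁' Q₂' Q₃' = F.rot (Q₁ * Q₁') (Q₂ * Q₂') (Q₃ * Q₃') := by
  have h : ∀ (A A' : Matrix (Fin d) (Fin d) ℝ) (B B' : Matrix (Fin s) (Fin s) ℝ),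
      Matrix.fromBlocks (A * A') 0 0 (B * B') =
        Matrix.fromBlocks A 0 0 B * Matrix.fromBlocks A' 0 0 B' := fun A A' B B' => by
    simp [Matrix.fromBlocks_multiply]
  ext1 <;> simp only [rot, h, Matrix.transpose_mul, Matrix.mul_assoc]

theorem transpose_mul_self_of_mem {n : Type} [Fintype n] [DecidableEq n] {Q : Matrix n n ℝ}
    (h : Q ∈ Matrix.orthogonalGroup n ℝ) : Qᵀ * Q = 1 :=
  (Matrix.mem_orthogonalGroup_iff' n ℝ).mp h

theorem mul_transpose_self_of_mem {n : Type} [Fintype n] [DecidableEq n] {Q : Matrix n n ℝ}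
    (h : Q ∈ Matrix.orthogonalGroup n ℝ) : Q * Qᵀ = 1 :=
  (Matrix.mem_orthogonalGroup_iff n ℝ).mp h

theorem blockDiag_mem_orthogonalGroup {Q₁ : Matrix (Fin d) (Fin d) ℝ}
    {Q₂ : Matrix (Fin s) (Fin s) ℝ} (h₁ : Q₁ ∈ Matrix.orthogonalGroup (Fin d) ℝ)
    (h₂ : Q₂ ∈ Matrix.orthogonalGroup (Fin s) ℝ) :
    Matrix.fromBlocks Q₁ 0 0 Q₂ ∈ Matrix.orthogonalGroup (Fin d ⊕ Fin s) ℝ := by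
  rw [Matrix.mem_orthogonalGroup_iff']
  change (Matrix.fromBlocks Q₁ 0 0 Q₂)ᵀ * Matrix.fromBlocks Q₁ 0 0 Q₂ = 1
  simp [Matrix.fromBlocks_transpose, Matrix.fromBlocks_multiply, transpose_mul_self_of_mem h₁,
    transpose_mul_self_of_mem h₂]

theorem norm_orthogonal_mul {n : Type} {k : Type*} [Fintype n] [Fintype k] [DecidableEq n]
    {Q : Matrix n n ℝ} (h : Q ∈ Matrix.orthogonalGroup n ℝ) (X : Matrix n k ℝ) :
    ‖Q * X‖ = ‖X‖ ∧ ‖Qᵀ * X‖ = ‖X‖ := by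
  constructor
  · simpa using norm_mul_of_gram (U := Q) zero_le_one
      (by simpa using transpose_mul_self_of_mem h) X
  · simpa using norm_mul_of_gram (U := Qᵀ) zero_le_one
      (by simpa using mul_transpose_self_of_mem h) X

theorem norm_mul_orthogonal {n : Type} {k : Type*} [Fintype n] [Fintype k] [DecidableEq n]
    {Q : Matrix n n ℝ} (h : Q ∈ Matrix.orthogonalGroup n ℝ) (X : Matrix k n ℝ) :
    ‖X * Q‖ = ‖X‖ ∧ ‖X * Qᵀ‖ = ‖X‖ := by
  constructor
  · rw [← norm_transpose_frob, Matrix.transpose_mul, (norm_orthogonal_mul h _).2,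
      norm_transpose_frob]
  · rw [← norm_transpose_frob, Matrix.transpose_mul, Matrix.transpose_transpose,
      (norm_orthogonal_mul h _).1, norm_transpose_frob]

section Orthogonal

variable {Q₁ : Matrix (Fin d) (Fin d) ℝ} {Q₂ Q₃ : Matrix (Fin s) (Fin s) ℝ}
  (h₁ : Q₁ ∈ Matrix.orthogonalGroup (Fin d) ℝ) (h₂ : Q₂ ∈ Matrix.orthogonalGroup (Fin s) ℝ)
  (h₃ : Q₃ ∈ Matrix.orthogonalGroup (Fin s) ℝ) {F : Comp p d s} {b m σ : ℝ}
include h₁ h₂ h₃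

theorem rot_coef : (F.rot Q₁ Q₂ Q₃).coef = F.coef := by
  have hA := mul_transpose_self_of_mem (blockDiag_mem_orthogonalGroup h₁ h₂)
  have hB := mul_transpose_self_of_mem (blockDiag_mem_orthogonalGroup h₁ h₃)
  rw [coef, rot_U, rot_V, Matrix.transpose_mul]
  change F.U * Matrix.fromBlocks Q₁ 0 0 Q₂ * ((Matrix.fromBlocks Q₁ 0 0 Q₂)ᵀ * F.D
    * Matrix.fromBlocks Q₁ 0 0 Q₃) * ((Matrix.fromBlocks Q₁ 0 0 Q₃)ᵀ * F.Vᵀ) = F.U * F.D * F.Vᵀ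
  generalize Matrix.fromBlocks Q₁ 0 0 Q₂ = A at *
  generalize Matrix.fromBlocks Q₁ 0 0 Q₃ = B at *
  calc F.U * A * (Aᵀ * F.D * B) * (Bᵀ * F.Vᵀ) = F.U * (A * Aᵀ) * F.D * (B * Bᵀ) * F.Vᵀ := by
        simp only [Matrix.mul_assoc]
    _ = _ := by rw [hA, hB, Matrix.mul_one, Matrix.mul_one]

theorem rot_norm_D : ‖(F.rot Q₁ Q₂ Q₃).D‖ = ‖F.D‖ := by
  rw [rot, (norm_mul_orthogonal (blockDiag_mem_orthogonalGroup h₁ h₃) _).1,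
    (norm_orthogonal_mul (blockDiag_mem_orthogonalGroup h₁ h₂) _).2]

theorem rot_identified (h : F.Identified b) : (F.rot Q₁ Q₂ Q₃).Identified b := by
  have key : ∀ {U : Matrix (Fin p) (Fin d ⊕ Fin s) ℝ} {Q : Matrix (Fin d ⊕ Fin s) (Fin d ⊕ Fin s) ℝ},
      Uᵀ * U = b ^ 2 • (1 : Matrix (Fin d ⊕ Fin s) (Fin d ⊕ Fin s) ℝ) →
      Q ∈ Matrix.orthogonalGroup (Fin d ⊕ Fin s) ℝ →
      (U * Q)ᵀ * (U * Q) = b ^ 2 • (1 : Matrix (Fin d ⊕ Fin s) (Fin d ⊕ Fin s) ℝ) := by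
    intro U Q hU hQ
    rw [Matrix.transpose_mul, Matrix.mul_assoc, ← Matrix.mul_assoc Uᵀ, hU, Matrix.smul_mul,
      Matrix.one_mul, Matrix.mul_smul, transpose_mul_self_of_mem hQ]
  exact ⟨by rw [rot_U]; exact key h.1 (blockDiag_mem_orthogonalGroup h₁ h₂),
    by rw [rot_V]; exact key h.2 (blockDiag_mem_orthogonalGroup h₁ h₃)⟩

theorem Base.rot (h : Base b m σ F) : Base b m σ (F.rot Q₁ Q₂ Q₃) where
  ident := rot_identified h₁ h₂ h₃ h.ident
  left X := by
    have := h.left (X * (Matrix.fromBlocks Q₁ 0 0 Q₂)ᵀ)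
    rw [(norm_mul_orthogonal (blockDiag_mem_orthogonalGroup h₁ h₂) _).2] at this
    rw [Comp.rot, ← Matrix.mul_assoc, ← Matrix.mul_assoc,
      (norm_mul_orthogonal (blockDiag_mem_orthogonalGroup h₁ h₃) _).1]
    exact this
  right X := by
    have := h.right (Matrix.fromBlocks Q₁ 0 0 Q₃ * X)
    rw [(norm_orthogonal_mul (blockDiag_mem_orthogonalGroup h₁ h₃) _).1] at this
    rw [Comp.rot, Matrix.mul_assoc, Matrix.mul_assoc,
      (norm_orthogonal_mul (blockDiag_mem_orthogonalGroup h₁ h₂) _).2]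
    exact this
  angle hd := fun k _ X => by
    have := h.angle hd (Q₃ * X)
    rw [(norm_orthogonal_mul h₃ _).1] at this
    rw [Comp.rot, Matrix.transpose_mul]
    simp only [Matrix.mul_assoc] at this ⊢
    rw [(norm_orthogonal_mul h₂ _).2]
    exact this

end Orthogonal

theorem norm_gram_le {m n : Type} [Fintype m] [Fintype n] [DecidableEq n] {b E : ℝ}
    {U U' : Matrix m n ℝ} (hU' : U'ᵀ * U' = b ^ 2 • (1 : Matrix n n ℝ)) (hE : ‖U - U'‖ ≤ E) :
    ‖(U - U')ᵀ * U' + U'ᵀ * (U - U')‖ ≤ ‖Uᵀ * U - b ^ 2 • 1‖ + E ^ 2 := by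
  have e : (U - U')ᵀ * U' + U'ᵀ * (U - U') =
      (Uᵀ * U - b ^ 2 • 1) - (U - U')ᵀ * (U - U') := by
    rw [← hU']
    simp only [Matrix.transpose_sub, Matrix.sub_mul, Matrix.mul_sub]
    abel
  rw [e]
  have hE0 : 0 ≤ E := (norm_nonneg _).trans hE
  refine (norm_sub_le _ _).trans (add_le_add le_rfl ((Matrix.frobenius_norm_mul _ _).trans ?_))
  rw [norm_transpose_frob, sq]
  gcongr

theorem norm_sub_rot_block_le {n : Type} [Fintype n] [DecidableEq n]
    {m : Type} [Fintype m]
    {C C' : Matrix m n ℝ} {Q : Matrix n n ℝ} {b E : ℝ} (hb : 0 < b)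
    (hC : Cᵀ * C = b ^ 2 • (1 : Matrix n n ℝ)) (h : ‖C' - C‖ ≤ E) (hQ : ‖Q - 1‖ ≤ E / b) :
    ‖C' - C * Q‖ ≤ 2 * E := by
  have e : C' - C * Q = (C' - C) - C * (Q - 1) := by
    rw [Matrix.mul_sub, Matrix.mul_one]; abel
  rw [e]
  refine (norm_sub_le _ _).trans ?_
  rw [norm_mul_of_gram hb.le hC]
  have : b * ‖Q - 1‖ ≤ E := by
    calc b * ‖Q - 1‖ ≤ b * (E / b) := by gcongr
      _ = E := by field_simp
  linarith

theorem norm_sub_rot_D_le {D D' A B : Matrix (Fin d ⊕ Fin s) (Fin d ⊕ Fin s) ℝ} {E L ε : ℝ}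
    (hA : A ∈ Matrix.orthogonalGroup (Fin d ⊕ Fin s) ℝ) (hD : ‖D' - D‖ ≤ E) (hL : ‖D‖ ≤ L)
    (hA1 : ‖A - 1‖ ≤ ε) (hB1 : ‖B - 1‖ ≤ ε) : ‖D' - Aᵀ * D * B‖ ≤ E + 2 * (L * ε) := by
  have e : D' - Aᵀ * D * B = (D' - D) - Aᵀ * (D * (B - 1)) - (A - 1)ᵀ * D := by
    simp only [Matrix.mul_sub, Matrix.transpose_sub, Matrix.sub_mul, Matrix.transpose_one,
      Matrix.one_mul, Matrix.mul_one, Matrix.mul_assoc]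
    abel
  have hL0 : 0 ≤ L := (norm_nonneg _).trans hL
  have n1 : ‖Aᵀ * (D * (B - 1))‖ ≤ L * ε := by
    rw [(norm_orthogonal_mul hA _).2]
    exact (Matrix.frobenius_norm_mul _ _).trans (by gcongr)
  have n2 : ‖(A - 1)ᵀ * D‖ ≤ L * ε := by
    refine (Matrix.frobenius_norm_mul _ _).trans ?_
    rw [norm_transpose_frob, mul_comm L]
    have : 0 ≤ ε := (norm_nonneg _).trans hA1
    gcongr
  rw [e]
  refine (norm_sub_le _ _).trans ((add_le_add (norm_sub_le _ _) le_rfl).trans ?_)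
  linarith

/-- Here the Taylor expansion is based at the reference `F'`, since injectivity of the linearization
is known only there. -/
theorem norm_coefD1_le {F F' : Comp p d s} {b L E E' : ℝ} (hb : 0 ≤ b)
    (hI : F'.Identified b) (hL : ‖F'.D‖ ≤ L) (hU : ‖(F - F').U‖ ≤ E) (hV : ‖(F - F').V‖ ≤ E)
    (hD : ‖(F - F').D‖ ≤ E') :
    ‖F'.coefD1 (F - F')‖ ≤ ‖F.coef - F'.coef‖ + (2 * b * E * E' + L * E ^ 2 + E ^ 2 * E') := by
  have hE : 0 ≤ E := (norm_nonneg _).trans hU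
  have h := coef_add_smul F' (F - F') 1
  simp only [one_smul, one_pow, add_sub_cancel] at h
  have e : F'.coefD1 (F - F') =
      (F.coef - F'.coef) - F'.coefD2 (F - F') - (F - F').coef := by rw [h]; abel
  have oU := (opBound_norm (F - F').U).mono hU
  have oV := (opBound_norm (F - F').V).mono hV
  have n1 : ‖F'.coefD2 (F - F')‖ ≤ 2 * b * E * E' + L * E ^ 2 := by
    rw [coefD2]
    refine (norm_add_le _ _).trans ((add_le_add ((norm_add_le _ _).trans (add_le_add
      (norm_sandwich_le hE hb oU (opBound_of_gram hb hI.2) hD)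
      (norm_sandwich_le hE hE oU oV hL)))
      (norm_sandwich_le hb hE (opBound_of_gram hb hI.1) oV hD)).trans_eq ?_)
    ring
  have n2 : ‖(F - F').coef‖ ≤ E ^ 2 * E' :=
    (norm_sandwich_le hE hE oU oV hD).trans_eq (by ring)
  rw [e]
  refine (norm_sub_le _ _).trans ((add_le_add (norm_sub_le _ _) le_rfl).trans ?_)
  linarith

/-- The constant in the upper bound of the aligned distance. -/
def geomConst (K g : ℝ) : ℝ := 9241600 * K ^ 20 * (3 + 2 / g ^ 2) ^ 2

theorem sq_scale_bound {K h κ G x wU wV E n τ : ℝ} (hK : 1 ≤ K) (hh : 0 < h) (hκ : 1 ≤ κ)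
    (hx : 0 ≤ x) (hwU : 0 ≤ wU) (hwV : 0 ≤ wV)
    (hτ : τ = K ^ 3 * (κ * (x + 136 * K ^ 4 * h * E ^ 2) / h ^ 2 + (wU + wV + 16 * E ^ 2) / h))
    (hn : n ≤ 4 * (5 * K ^ 3 * G * τ) ^ 2) :
    n ≤ 9241600 * K ^ 20 * G ^ 2 *
      (κ ^ 2 / h ^ 4 * x ^ 2 + (wU ^ 2 + wV ^ 2) / h ^ 2 + κ ^ 2 / h ^ 2 * E ^ 4) := by
  have hK4 : 1 ≤ K ^ 4 := one_le_pow₀ hK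
  have hKκ : 1 ≤ K ^ 4 * κ := one_le_mul_of_one_le_of_one_le hK4 hκ
  have hX : 0 ≤ κ * x / h ^ 2 := by positivity
  have hY : 0 ≤ wU / h := by positivity
  have hZ : 0 ≤ wV / h := by positivity
  have hW : 0 ≤ κ * E ^ 2 / h := by positivity
  have hW' : 0 ≤ E ^ 2 / h := by positivity
  have hτ' : τ ≤ 152 * K ^ 7 * (κ * x / h ^ 2 + wU / h + wV / h + κ * E ^ 2 / h) := by
    have e1 : τ = K ^ 3 * (κ * x / h ^ 2 + wU / h + wV / h
        + (136 * (K ^ 4 * κ) + 16) * (E ^ 2 / h)) := by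
      rw [hτ]; field_simp; ring
    have e2 : 152 * K ^ 7 * (κ * x / h ^ 2 + wU / h + wV / h + κ * E ^ 2 / h) =
        K ^ 3 * (152 * (K ^ 4 * (κ * x / h ^ 2)) + 152 * (K ^ 4 * (wU / h))
          + 152 * (K ^ 4 * (wV / h)) + 152 * (K ^ 4 * κ) * (E ^ 2 / h)) := by ring
    rw [e1, e2]
    have i1 := mul_le_mul_of_nonneg_right hK4 hX
    have i2 := mul_le_mul_of_nonneg_right hK4 hY
    have i3 := mul_le_mul_of_nonneg_right hK4 hZ
    have i4 := mul_le_mul_of_nonneg_right hKκ hW'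
    have : 0 ≤ K ^ 3 := by positivity
    gcongr ?_ * ?_
    linarith
  have hτ0 : 0 ≤ τ := by rw [hτ]; positivity
  have hsq : (κ * x / h ^ 2 + wU / h + wV / h + κ * E ^ 2 / h) ^ 2 ≤
      4 * (κ ^ 2 / h ^ 4 * x ^ 2 + (wU ^ 2 + wV ^ 2) / h ^ 2 + κ ^ 2 / h ^ 2 * E ^ 4) := by
    have e : κ ^ 2 / h ^ 4 * x ^ 2 + (wU ^ 2 + wV ^ 2) / h ^ 2 + κ ^ 2 / h ^ 2 * E ^ 4 =
        (κ * x / h ^ 2) ^ 2 + (wU / h) ^ 2 + (wV / h) ^ 2 + (κ * E ^ 2 / h) ^ 2 := by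
      field_simp; ring
    rw [e]
    generalize κ * x / h ^ 2 = a
    generalize wU / h = a1
    generalize wV / h = a2
    generalize κ * E ^ 2 / h = a3
    nlinarith [sq_nonneg (a - a1), sq_nonneg (a - a2), sq_nonneg (a - a3), sq_nonneg (a1 - a2),
      sq_nonneg (a1 - a3), sq_nonneg (a2 - a3)]
  have hτ2 : τ ^ 2 ≤ (152 * K ^ 7) ^ 2 * (4 * (κ ^ 2 / h ^ 4 * x ^ 2 + (wU ^ 2 + wV ^ 2) / h ^ 2
      + κ ^ 2 / h ^ 2 * E ^ 4)) := by
    calc τ ^ 2 ≤ (152 * K ^ 7 * (κ * x / h ^ 2 + wU / h + wV / h + κ * E ^ 2 / h)) ^ 2 := by gcongr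
      _ = (152 * K ^ 7) ^ 2 * (κ * x / h ^ 2 + wU / h + wV / h + κ * E ^ 2 / h) ^ 2 := by ring
      _ ≤ _ := by gcongr
  calc n ≤ 4 * (5 * K ^ 3 * G * τ) ^ 2 := hn
    _ = 100 * K ^ 6 * G ^ 2 * τ ^ 2 := by ring
    _ ≤ 100 * K ^ 6 * G ^ 2 * ((152 * K ^ 7) ^ 2 * (4 * (κ ^ 2 / h ^ 4 * x ^ 2
        + (wU ^ 2 + wV ^ 2) / h ^ 2 + κ ^ 2 / h ^ 2 * E ^ 4))) := by gcongr
    _ = _ := by ring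

/-- Quantitative injectivity of `coef` at an aligned pair of components. -/
theorem Base.nsq_le_of_aligned {K h κ g b m σ E : ℝ} {F F' : Comp p d s} (hK : 1 ≤ K)
    (hh : 0 < h) (hκ : 1 ≤ κ) (hg : 0 < g) (hbl : h / K ≤ b) (hbu : b ≤ K * h) (hσ : 0 ≤ σ)
    (hσg : σ ^ 2 ≤ 1 - g ^ 2) (hm : h / (κ * K ^ 2) ≤ m) (hB : Base b m σ F')
    (hL : ‖F'.D‖ ≤ K ^ 2 * h) (hEb : E ≤ b)
    (u2 : ‖(F - F').U‖ ≤ 4 * E) (v2 : ‖(F - F').V‖ ≤ 4 * E) (d2 : ‖(F - F').D‖ ≤ 5 * K ^ 3 * E)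
    (hC : ‖F'.Cᵀ * (F - F').C - (F'.Cᵀ * (F - F').C)ᵀ‖ ≤ 4 * E ^ 2)
    (hR : ‖F'.Rᵀ * (F - F').R - (F'.Rᵀ * (F - F').R)ᵀ‖ ≤ 4 * E ^ 2)
    (hP : ‖F'.Pᵀ * (F - F').P - (F'.Pᵀ * (F - F').P)ᵀ‖ ≤ 4 * E ^ 2) :
    (F - F').nsq ≤ geomConst K g * (κ ^ 2 / h ^ 4 * ‖F.coef - F'.coef‖ ^ 2
          + (‖F.Uᵀ * F.U - b ^ 2 • 1‖ ^ 2 + ‖F.Vᵀ * F.V - b ^ 2 • 1‖ ^ 2) / h ^ 2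
          + κ ^ 2 / h ^ 2 * E ^ 4) := by
  have hK0 : 0 < K := by linarith
  have hκ0 : 0 < κ := by linarith
  have hb : 0 < b := lt_of_lt_of_le (by positivity) hbl
  have hm0 : 0 < m := lt_of_lt_of_le (by positivity) hm
  have gu : ‖(F - F').Uᵀ * F'.U + F'.Uᵀ * (F - F').U‖ ≤
      ‖F.Uᵀ * F.U - b ^ 2 • 1‖ + (4 * E) ^ 2 := by
    rw [sub_U] at u2 ⊢
    exact norm_gram_le hB.ident.1 u2
  have gv : ‖(F - F').Vᵀ * F'.V + F'.Vᵀ * (F - F').V‖ ≤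
      ‖F.Vᵀ * F.V - b ^ 2 • 1‖ + (4 * E) ^ 2 := by
    rw [sub_V] at v2 ⊢
    exact norm_gram_le hB.ident.2 v2
  have he0 := norm_coefD1_le hb.le hB.ident hL u2 v2 d2
  have hwU : 0 ≤ ‖F.Uᵀ * F.U - b ^ 2 • 1‖ := norm_nonneg _
  have hwV : 0 ≤ ‖F.Vᵀ * F.V - b ^ 2 • 1‖ := norm_nonneg _
  have hx0 : 0 ≤ ‖F.coef - F'.coef‖ := norm_nonneg _
  generalize ‖F.coef - F'.coef‖ = x at *
  generalize ‖F.Uᵀ * F.U - b ^ 2 • 1‖ = wU at *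
  generalize ‖F.Vᵀ * F.V - b ^ 2 • 1‖ = wV at *
  have hE2 : 0 ≤ E ^ 2 := sq_nonneg E
  have hEE : 4 * E ^ 2 ≤ wU + wV + 16 * E ^ 2 := by linarith
  -- Here `136 = 40 + 16 + 80`, one summand for each Taylor remainder.
  have he : ‖F'.coefD1 (F - F')‖ ≤ x + 136 * K ^ 4 * h * E ^ 2 := by
    refine he0.trans ?_
    have h1 : 2 * b * (4 * E) * (5 * K ^ 3 * E) ≤ 40 * K ^ 4 * h * E ^ 2 := by
      calc 2 * b * (4 * E) * (5 * K ^ 3 * E) = 40 * K ^ 3 * b * E ^ 2 := by ring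
        _ ≤ 40 * K ^ 3 * (K * h) * E ^ 2 := by gcongr
        _ = _ := by ring
    have h2 : K ^ 2 * h * (4 * E) ^ 2 ≤ 16 * K ^ 4 * h * E ^ 2 := by
      have : K ^ 2 ≤ K ^ 4 := pow_le_pow_right₀ hK (by norm_num)
      calc K ^ 2 * h * (4 * E) ^ 2 = 16 * K ^ 2 * h * E ^ 2 := by ring
        _ ≤ 16 * K ^ 4 * h * E ^ 2 := by gcongr
    have h3 : (4 * E) ^ 2 * (5 * K ^ 3 * E) ≤ 80 * K ^ 4 * h * E ^ 2 := by
      calc (4 * E) ^ 2 * (5 * K ^ 3 * E) = 80 * K ^ 3 * E ^ 2 * E := by ring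
        _ ≤ 80 * K ^ 3 * E ^ 2 * (K * h) := by gcongr; exact hEb.trans hbu
        _ = _ := by ring
    linarith
  obtain ⟨τ, hτ⟩ : ∃ τ, τ = K ^ 3 * (κ * (x + 136 * K ^ 4 * h * E ^ 2) / h ^ 2
    + (wU + wV + 16 * E ^ 2) / h) := ⟨_, rfl⟩
  have hK3 : (1 : ℝ) ≤ K ^ 3 := one_le_pow₀ hK
  have hK23 : K ^ 2 ≤ K ^ 3 := pow_le_pow_right₀ hK (by norm_num)
  have hK13 : K ≤ K ^ 3 := le_self_pow₀ hK (by norm_num)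
  have hτle : ‖F'.coefD1 (F - F')‖ / (b * m) + (wU + wV + 16 * E ^ 2) / b ≤ τ := by
    have h1 : ‖F'.coefD1 (F - F')‖ / (b * m) ≤
        K ^ 3 * (κ * (x + 136 * K ^ 4 * h * E ^ 2) / h ^ 2) := by
      calc _ ≤ (x + 136 * K ^ 4 * h * E ^ 2) / (h / K * (h / (κ * K ^ 2))) := by gcongr
        _ = _ := by field_simp
    have h2 : (wU + wV + 16 * E ^ 2) / b ≤ K ^ 3 * ((wU + wV + 16 * E ^ 2) / h) := by
      calc _ ≤ (wU + wV + 16 * E ^ 2) / (h / K) := by gcongr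
        _ = K * ((wU + wV + 16 * E ^ 2) / h) := by field_simp
        _ ≤ _ := by gcongr
    rw [hτ, mul_add]
    exact add_le_add h1 h2
  obtain ⟨fC, fR, fP, fD⟩ := hB.linear_bound (ω := wU + wV + 16 * E ^ 2) hb hm0 hσ hg hσg hL
    (F - F') (gu.trans (by linarith)) (gv.trans (by linarith))
    (hC.trans hEE) (hR.trans hEE) (hP.trans hEE) hτle
  have hG1 : 1 ≤ 3 + 2 / g ^ 2 := by
    have : 0 ≤ 2 / g ^ 2 := by positivity
    linarith
  rw [geomConst]
  generalize 3 + 2 / g ^ 2 = G at *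
  have hτ0 : 0 ≤ τ := by rw [hτ]; positivity
  have hGτ : G * τ ≤ 5 * K ^ 3 * G * τ := by
    have : 0 ≤ G * τ := by positivity
    nlinarith
  have hDb : ‖(F - F').D‖ ≤ 5 * K ^ 3 * G * τ := by
    refine fD.trans ?_
    have h1 : ‖F'.coefD1 (F - F')‖ / b ^ 2 ≤ τ := by
      calc _ ≤ (x + 136 * K ^ 4 * h * E ^ 2) / (h / K) ^ 2 := by gcongr
        _ = K ^ 2 * (1 * (x + 136 * K ^ 4 * h * E ^ 2) / h ^ 2) := by field_simp
        _ ≤ K ^ 3 * (κ * (x + 136 * K ^ 4 * h * E ^ 2) / h ^ 2) := by gcongr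
        _ ≤ τ := by
            rw [hτ]
            exact mul_le_mul_of_nonneg_left (le_add_of_nonneg_right (by positivity)) (by positivity)
    have h2 : K ^ 2 * h / b ≤ K ^ 3 := by
      calc K ^ 2 * h / b ≤ K ^ 2 * h / (h / K) := by gcongr
        _ = _ := by field_simp
    have h3 : K ^ 2 * h / b * (4 * G * τ) ≤ K ^ 3 * (4 * G * τ) := by gcongr
    have h4 : τ ≤ K ^ 3 * G * τ := le_mul_of_one_le_left hτ0
      (one_le_mul_of_one_le_of_one_le hK3 hG1)
    linarith
  refine sq_scale_bound hK hh hκ hx0 hwU hwV hτ ?_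
  rw [nsq]
  have s1 := pow_le_pow_left₀ (norm_nonneg _) (fC.trans hGτ) 2
  have s2 := pow_le_pow_left₀ (norm_nonneg _) (fR.trans hGτ) 2
  have s3 := pow_le_pow_left₀ (norm_nonneg _) (fP.trans hGτ) 2
  have s4 := pow_le_pow_left₀ (norm_nonneg _) hDb 2
  linarith

/-- Each of `C`, `R`, `P` gets its own Cayley rotation, and `D` follows. Since the rotations are
`O(E / b)` from the identity, aligned differences remain of order `E`, so linearization errors stay
quadratic. -/
theorem Base.exists_rot_nsq_le {K h κ g b m σ E : ℝ} {F F' : Comp p d s} (hK : 1 ≤ K)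
    (hh : 0 < h) (hκ : 1 ≤ κ) (hg : 0 < g) (hbl : h / K ≤ b) (hbu : b ≤ K * h) (hσ : 0 ≤ σ)
    (hσg : σ ^ 2 ≤ 1 - g ^ 2) (hm : h / (κ * K ^ 2) ≤ m) (hB : Base b m σ F')
    (hL : ‖F'.D‖ ≤ K ^ 2 * h) (hE0 : 0 ≤ E) (hE : (F - F').nsq ≤ E ^ 2) (hEb : E ≤ h / K) :
    ∃ Q₁ ∈ Matrix.orthogonalGroup (Fin d) ℝ, ∃ Q₂ ∈ Matrix.orthogonalGroup (Fin s) ℝ,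
      ∃ Q₃ ∈ Matrix.orthogonalGroup (Fin s) ℝ, (F - F'.rot Q₁ Q₂ Q₃).nsq ≤ geomConst K g *
        (κ ^ 2 / h ^ 4 * ‖F.coef - F'.coef‖ ^ 2
          + (‖F.Uᵀ * F.U - b ^ 2 • 1‖ ^ 2 + ‖F.Vᵀ * F.V - b ^ 2 • 1‖ ^ 2) / h ^ 2
          + κ ^ 2 / h ^ 2 * E ^ 4) := by
  have hK0 : 0 < K := by linarith
  have hb : 0 < b := lt_of_lt_of_le (by positivity) hbl
  have hEb' : E ≤ b := hEb.trans hbl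
  have le_of : ∀ x : ℝ, x ^ 2 ≤ (F - F').nsq → x ≤ E := fun x hx =>
    (abs_le_of_sq_le_sq' (hx.trans hE) hE0).2
  have hC : ‖F.C - F'.C‖ ≤ E := le_of _ (by
    rw [nsq, sub_C]
    nlinarith [sq_nonneg ‖(F - F').R‖, sq_nonneg ‖(F - F').P‖, sq_nonneg ‖(F - F').D‖])
  have hR : ‖F.R - F'.R‖ ≤ E := le_of _ (by
    rw [nsq, sub_R]
    nlinarith [sq_nonneg ‖(F - F').C‖, sq_nonneg ‖(F - F').P‖, sq_nonneg ‖(F - F').D‖])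
  have hP : ‖F.P - F'.P‖ ≤ E := le_of _ (by
    rw [nsq, sub_P]
    nlinarith [sq_nonneg ‖(F - F').C‖, sq_nonneg ‖(F - F').R‖, sq_nonneg ‖(F - F').D‖])
  have hD : ‖F.D - F'.D‖ ≤ E := le_of _ (F - F').norm_D_sq_le
  have gC := gram_C hB.ident
  have gR := gram_R hB.ident
  have gP := gram_P hB.ident
  obtain ⟨Q₁, o₁, i₁, sk₁⟩ := exists_gauge hb hEb' gC hC
  obtain ⟨Q₂, o₂, i₂, sk₂⟩ := exists_gauge hb hEb' gR hR
  obtain ⟨Q₃, o₃, i₃, sk₃⟩ := exists_gauge hb hEb' gP hP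
  refine ⟨Q₁, o₁, Q₂, o₂, Q₃, o₃, ?_⟩
  have c2 : ‖(F - F'.rot Q₁ Q₂ Q₃).C‖ ≤ 2 * E := norm_sub_rot_block_le hb gC hC i₁
  have r2 : ‖(F - F'.rot Q₁ Q₂ Q₃).R‖ ≤ 2 * E := norm_sub_rot_block_le hb gR hR i₂
  have p2 : ‖(F - F'.rot Q₁ Q₂ Q₃).P‖ ≤ 2 * E := norm_sub_rot_block_le hb gP hP i₃
  have blk : ∀ {Q : Matrix (Fin s) (Fin s) ℝ}, ‖Q - 1‖ ≤ E / b →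
      ‖Matrix.fromBlocks Q₁ 0 0 Q - 1‖ ≤ 2 * (E / b) := fun {Q} hQ => by
    have e : Matrix.fromBlocks Q₁ 0 0 Q - 1 = Matrix.fromBlocks (Q₁ - 1) 0 0 (Q - 1) := by
      rw [← Matrix.fromBlocks_one, sub_eq_add_neg, Matrix.fromBlocks_neg, Matrix.fromBlocks_add]
      simp only [neg_zero, add_zero, ← sub_eq_add_neg]
    rw [e]
    exact (norm_fromBlocks_diag_le _ _).trans (by linarith)
  have d2 : ‖(F - F'.rot Q₁ Q₂ Q₃).D‖ ≤ 5 * K ^ 3 * E := by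
    have := norm_sub_rot_D_le (blockDiag_mem_orthogonalGroup o₁ o₂) hD hL (blk i₂) (blk i₃)
    refine this.trans ?_
    have h1 : K ^ 2 * h * (2 * (E / b)) ≤ 2 * (K ^ 3 * E) := by
      have : E / b ≤ E / (h / K) := by gcongr
      calc K ^ 2 * h * (2 * (E / b)) ≤ K ^ 2 * h * (2 * (E / (h / K))) := by gcongr
        _ = _ := by field_simp
    have h2 : E ≤ K ^ 3 * E := le_mul_of_one_le_left hE0 (one_le_pow₀ hK)
    linarith
  have u2 : ‖(F - F'.rot Q₁ Q₂ Q₃).U‖ ≤ 4 * E := (norm_fromCols_le _ _).trans (by linarith)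
  have v2 : ‖(F - F'.rot Q₁ Q₂ Q₃).V‖ ≤ 4 * E := (norm_fromCols_le _ _).trans (by linarith)
  have key := (hB.rot o₁ o₂ o₃).nsq_le_of_aligned (F := F) hK hh hκ hg hbl hbu hσ hσg hm
    ((rot_norm_D o₁ o₂ o₃).trans_le hL) hEb' u2 v2 d2 sk₁ sk₂ sk₃
  rwa [rot_coef o₁ o₂ o₃] at key

end Comp

section Orbit

variable {p d s : Fin 2 → ℕ}

/-- `Θ''` is obtained from `Θ'` by orthogonal rotations. -/
def Orbit (Θ' Θ'' : Params p d s) : Prop :=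
  ∃ Q : ∀ i : Fin 2, Matrix.orthogonalGroup (Fin (d i)) ℝ ×
      Matrix.orthogonalGroup (Fin (s i)) ℝ × Matrix.orthogonalGroup (Fin (s i)) ℝ,
    Θ'' = fun i => (Θ' i).rot ((Q i).1 : Matrix (Fin (d i)) (Fin (d i)) ℝ)
      ((Q i).2.1 : Matrix (Fin (s i)) (Fin (s i)) ℝ) ((Q i).2.2 : Matrix (Fin (s i)) (Fin (s i)) ℝ)

theorem Orbit.trans {Θ Θ' Θ'' : Params p d s} (h : Orbit Θ Θ') (h' : Orbit Θ' Θ'') :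
    Orbit Θ Θ'' := by
  obtain ⟨Q, rfl⟩ := h
  obtain ⟨Q', rfl⟩ := h'
  refine ⟨fun i => ((Q i).1 * (Q' i).1, (Q i).2.1 * (Q' i).2.1, (Q i).2.2 * (Q' i).2.2), ?_⟩
  funext i
  rw [Comp.rot_rot]
  rfl

theorem distSq_le_of_orbit {Θ Θ' Θ'' : Params p d s} (h : Orbit Θ' Θ'') :
    distSq Θ Θ' ≤ nsq (Θ - Θ'') := by
  obtain ⟨Q, rfl⟩ := h
  refine ciInf_le ⟨0, ?_⟩ Q
  rintro _ ⟨Q, rfl⟩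
  positivity

theorem exists_orbit_of_distSq_lt {Θ Θ' : Params p d s} {c : ℝ} (h : distSq Θ Θ' < c) :
    ∃ Θ'', Orbit Θ' Θ'' ∧ nsq (Θ - Θ'') < c := by
  obtain ⟨Q, hQ⟩ := exists_lt_of_ciInf_lt h
  exact ⟨_, ⟨Q, rfl⟩, hQ⟩

theorem distSq_nonneg (Θ Θ' : Params p d s) : 0 ≤ distSq Θ Θ' :=
  Real.iInf_nonneg fun _ => by positivity

end Orbit

end

end MARCF

/-! ### Singular values and conditioning of the core matrix. -/

namespace MARCF

noncomputable section

section SingularValues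

variable {E F : Type*} [NormedAddCommGroup E] [InnerProductSpace ℝ E] [FiniteDimensional ℝ E]
  [NormedAddCommGroup F] [InnerProductSpace ℝ F] [FiniteDimensional ℝ F] (T : E →ₗ[ℝ] F)

theorem norm_sq_apply_eq_sum (x : E) : ‖T x‖ ^ 2 = ∑ i : Fin (Module.finrank ℝ E),
    T.singularValues i ^ 2 * (T.isSymmetric_adjoint_comp_self.eigenvectorBasis rfl).repr x i ^ 2 := by
  set e := T.isSymmetric_adjoint_comp_self.eigenvectorBasis rfl
  rw [← real_inner_self_eq_norm_sq, ← LinearMap.adjoint_inner_right, ← LinearMap.comp_apply,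
    ← e.repr.inner_map_map, PiLp.inner_apply]
  refine Finset.sum_congr rfl fun i _ => ?_
  rw [T.isSymmetric_adjoint_comp_self.eigenvectorBasis_apply_self_apply rfl,
    T.sq_singularValues_fin rfl i]
  simp only [RCLike.inner_apply, conj_trivial, RCLike.ofReal_real_eq_id, id]
  ring

theorem norm_sq_eq_sum_repr (x : E) : ‖x‖ ^ 2 = ∑ i : Fin (Module.finrank ℝ E),
    (T.isSymmetric_adjoint_comp_self.eigenvectorBasis rfl).repr x i ^ 2 := by
  rw [← (T.isSymmetric_adjoint_comp_self.eigenvectorBasis rfl).repr.norm_map,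
    EuclideanSpace.norm_sq_eq]
  simp

theorem norm_apply_le_singularValues_zero (x : E) : ‖T x‖ ≤ T.singularValues 0 * ‖x‖ := by
  refine abs_le_of_sq_le_sq' ?_ (mul_nonneg (T.singularValues_nonneg 0) (norm_nonneg _)) |>.2
  rw [mul_pow, norm_sq_apply_eq_sum, norm_sq_eq_sum_repr T, Finset.mul_sum]
  refine Finset.sum_le_sum fun i _ => ?_
  gcongr
  · exact T.singularValues_nonneg _
  · exact T.singularValues_antitone (Nat.zero_le _)

/-- In the eigenbasis of `T* T`, basis vectors of index at least `r` lie in the kernel, so `x` has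
no component along them; the other singular values are at least the last nonzero one. -/
theorem singularValues_mul_norm_le {x : E} (hx : ∀ v, T v = 0 → inner ℝ v x = 0) {r : ℕ}
    (hr : Module.finrank ℝ T.range = r) :
    T.singularValues (r - 1) * ‖x‖ ≤ ‖T x‖ := by
  refine abs_le_of_sq_le_sq' ?_ (norm_nonneg _) |>.2
  rw [mul_pow, norm_sq_apply_eq_sum, norm_sq_eq_sum_repr T, Finset.mul_sum]
  refine Finset.sum_le_sum fun i _ => ?_
  by_cases hi : (i : ℕ) < r
  · gcongr
    · exact T.singularValues_nonneg _
    · exact T.singularValues_antitone (by omega)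
  · have h0 : T.singularValues i = 0 :=
      T.singularValues_eq_zero_iff_le_finrank_range.mpr (by omega)
    have h1 : T (T.isSymmetric_adjoint_comp_self.eigenvectorBasis rfl i) = 0 := by
      rw [← norm_eq_zero, ← sq_eq_zero_iff, norm_sq_apply_eq_sum]
      refine Finset.sum_eq_zero fun j _ => ?_
      rw [OrthonormalBasis.repr_self]
      by_cases hj : j = i
      · rw [hj, h0]; simp
      · simp [hj]
    have h2 : (T.isSymmetric_adjoint_comp_self.eigenvectorBasis rfl).repr x i = 0 := by
      rw [OrthonormalBasis.repr_apply_apply]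
      exact hx _ h1
    rw [h2]; simp

end SingularValues

section MatrixSingularValues

variable {m n k : Type} [Fintype m] [Fintype n] [Fintype k] [DecidableEq n]

omit [DecidableEq n] in
theorem norm_sq_eq_sum_col (M : Matrix n k ℝ) : ‖M‖ ^ 2 = ∑ j, ‖WithLp.toLp 2 (M.col j)‖ ^ 2 := by
  rw [norm_sq_eq_sum, Finset.sum_comm]
  refine Finset.sum_congr rfl fun j _ => ?_
  rw [EuclideanSpace.norm_sq_eq]
  simp [Matrix.col]

omit [Fintype m] [Fintype k] in
theorem toEuclideanLin_col (A : Matrix m n ℝ) (X : Matrix n k ℝ) (j : k) :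
    WithLp.toLp 2 ((A * X).col j) = Matrix.toEuclideanLin A (WithLp.toLp 2 (X.col j)) := by
  ext i
  simp [Matrix.col, Matrix.mul_apply, Matrix.mulVec, dotProduct, Matrix.toLpLin_apply]

theorem opBound_singularValues_zero (A : Matrix m n ℝ) :
    OpBound A ((Matrix.toEuclideanLin A).singularValues 0) := fun k _ X => by
  have h0 := (Matrix.toEuclideanLin A).singularValues_nonneg 0
  refine abs_le_of_sq_le_sq' ?_ (by positivity) |>.2
  rw [mul_pow, norm_sq_eq_sum_col X, norm_sq_eq_sum_col (A * X), Finset.mul_sum]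
  refine Finset.sum_le_sum fun j _ => ?_
  rw [toEuclideanLin_col, ← mul_pow]
  gcongr
  exact norm_apply_le_singularValues_zero _ _

theorem finrank_range_toEuclideanLin [DecidableEq m] (A : Matrix m n ℝ) :
    Module.finrank ℝ (Matrix.toEuclideanLin A).range = A.rank := by
  exact (Matrix.rank_eq_finrank_range_toLin A (PiLp.basisFun 2 ℝ m) (PiLp.basisFun 2 ℝ n)).symm

theorem singularValues_mul_norm_le_mul [DecidableEq m] {A : Matrix m n ℝ} {X : Matrix n k ℝ}
    (hX : ∀ v : n → ℝ, A *ᵥ v = 0 → v ᵥ* X = 0) :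
    (Matrix.toEuclideanLin A).singularValues (A.rank - 1) * ‖X‖ ≤ ‖A * X‖ := by
  refine abs_le_of_sq_le_sq' ?_ (norm_nonneg _) |>.2
  rw [mul_pow, norm_sq_eq_sum_col X, norm_sq_eq_sum_col (A * X), Finset.mul_sum]
  refine Finset.sum_le_sum fun j _ => ?_
  rw [toEuclideanLin_col, ← mul_pow]
  have h0 := (Matrix.toEuclideanLin A).singularValues_nonneg (A.rank - 1)
  gcongr
  refine singularValues_mul_norm_le _ (fun v hv => ?_) (finrank_range_toEuclideanLin A)
  have h1 : A *ᵥ (WithLp.ofLp v) = 0 := by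
    have := congrArg WithLp.ofLp hv
    simpa [Matrix.toLpLin_apply] using this
  have h2 := congrFun (hX _ h1) j
  rw [EuclideanSpace.inner_eq_star_dotProduct]
  simpa [Matrix.vecMul, dotProduct, Matrix.col, mul_comm] using h2

end MatrixSingularValues

namespace Comp

variable {p d s : ℕ} {F : Comp p d s} {b : ℝ}

theorem isUnit_D (hr : F.coef.rank = d + s) : IsUnit F.D := by
  have h1 : d + s ≤ F.D.rank := by
    rw [← hr, coef]
    exact (Matrix.rank_mul_le_left _ _).trans (Matrix.rank_mul_le_right _ _)
  rw [← Matrix.mulVec_surjective_iff_isUnit]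
  have h2 : F.D.mulVecLin.range = ⊤ := by
    apply Submodule.eq_top_of_finrank_eq
    refine le_antisymm (Submodule.finrank_le _) ?_
    simpa [Matrix.rank] using h1
  exact LinearMap.range_eq_top.mp h2

/-- The columns of `V X` are orthogonal to the kernel of the coefficient matrix, and the two nearly
orthonormal factors scale norms exactly by `b`. So the singular value bound passes to `D` with a
loss of `b²`. -/
theorem sigmaR_mul_le (hb : 0 < b) (hI : F.Identified b) (hr : F.coef.rank = d + s) :
    (∀ {k : Type} [Fintype k] (X : Matrix (Fin d ⊕ Fin s) k ℝ),
      F.sigmaR / b ^ 2 * ‖X‖ ≤ ‖F.D * X‖) ∧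
    (∀ {k : Type} [Fintype k] (X : Matrix k (Fin d ⊕ Fin s) ℝ),
      F.sigmaR / b ^ 2 * ‖X‖ ≤ ‖X * F.D‖) := by
  obtain ⟨B, hB1, hB2⟩ := isUnit_iff_exists.mp (isUnit_D hr)
  have hinj : ∀ v : Fin p → ℝ, F.coef *ᵥ v = 0 → v ᵥ* F.V = 0 := by
    intro v hv
    have h1 : (B * F.Uᵀ) *ᵥ (F.coef *ᵥ v) = b ^ 2 • (F.Vᵀ *ᵥ v) := by
      rw [Matrix.mulVec_mulVec, coef]
      have : B * F.Uᵀ * (F.U * F.D * F.Vᵀ) = b ^ 2 • F.Vᵀ := by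
        calc _ = B * (F.Uᵀ * F.U) * F.D * F.Vᵀ := by simp only [Matrix.mul_assoc]
          _ = b ^ 2 • (B * F.D * F.Vᵀ) := by
            rw [hI.1, Matrix.mul_smul, Matrix.mul_one, Matrix.smul_mul, Matrix.smul_mul]
          _ = _ := by rw [hB2, Matrix.one_mul]
      rw [this, Matrix.smul_mulVec]
    rw [hv, Matrix.mulVec_zero, eq_comm, smul_eq_zero] at h1
    rw [← Matrix.mulVec_transpose]
    exact h1.resolve_left (by positivity)
  have hleft : ∀ {k : Type} [Fintype k] (X : Matrix (Fin d ⊕ Fin s) k ℝ),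
      F.sigmaR / b ^ 2 * ‖X‖ ≤ ‖F.D * X‖ := by
    intro k _ X
    have h1 := singularValues_mul_norm_le_mul (A := F.coef) (X := F.V * X) (fun v hv => by
      rw [← Matrix.vecMul_vecMul, hinj v hv, Matrix.zero_vecMul])
    have h2 : F.coef * (F.V * X) = b ^ 2 • (F.U * (F.D * X)) := by
      calc _ = F.U * F.D * (F.Vᵀ * F.V) * X := by simp only [coef, Matrix.mul_assoc]
        _ = _ := by
          rw [hI.2, Matrix.mul_smul, Matrix.mul_one, Matrix.smul_mul, Matrix.mul_assoc]
    rw [h2, norm_smul, norm_mul_of_gram hb.le hI.1, norm_mul_of_gram hb.le hI.2,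
      Real.norm_of_nonneg (by positivity), hr] at h1
    rw [div_mul_eq_mul_div, div_le_iff₀ (by positivity)]
    have h3 : b * (F.sigmaR * ‖X‖) ≤ b * (‖F.D * X‖ * b ^ 2) := by
      rw [sigmaR]; linarith
    exact le_of_mul_le_mul_left h3 hb
  refine ⟨hleft, fun {k} _ X => ?_⟩
  have hs : 0 ≤ F.sigmaR := LinearMap.singularValues_nonneg _ _
  rcases hs.eq_or_lt with h0 | h0
  · rw [← h0]; simp
  have hm : 0 < F.sigmaR / b ^ 2 := by positivity
  -- The bound for multiplication on the other side comes from the inverse, whose operator bound is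
  -- the same for its transpose.
  have hop : OpBound B (F.sigmaR / b ^ 2)⁻¹ := fun k _ Z => by
    have := hleft (B * Z)
    rw [← Matrix.mul_assoc, hB1, Matrix.one_mul] at this
    rwa [inv_mul_eq_div, le_div_iff₀ hm, mul_comm]
  have h1 := hop.mul_left (by positivity) (X * F.D)
  rwa [Matrix.mul_assoc, hB1, Matrix.mul_one, inv_mul_eq_div, le_div_iff₀ hm, mul_comm] at h1

theorem sigmaR_pos (hr : F.coef.rank = d + s) (hpos : 0 < d + s) : 0 < F.sigmaR := by
  rw [sigmaR, LinearMap.singularValues_pos_iff_lt_finrank_range, finrank_range_toEuclideanLin, hr]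
  omega

theorem sigmaR_le_norm (hb : 0 < b) (hI : F.Identified b) (hr : F.coef.rank = d + s)
    (hpos : 0 < d + s) : F.sigmaR ≤ ‖F.coef‖ := by
  have : Nonempty (Fin d ⊕ Fin s) := by
    rw [← Fintype.card_pos_iff]; simpa using hpos
  obtain ⟨i⟩ := this
  have h1 := (sigmaR_mul_le hb hI hr).1 (Matrix.replicateCol Unit (Pi.single i (1 : ℝ)))
  have h2 : ‖Matrix.replicateCol Unit (Pi.single i (1 : ℝ) : Fin d ⊕ Fin s → ℝ)‖ = 1 := by
    rw [Matrix.frobenius_norm_replicateCol]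
    simp
  have h3 := Matrix.frobenius_norm_mul F.D (Matrix.replicateCol Unit (Pi.single i (1 : ℝ)))
  rw [h2] at h1 h3
  rw [norm_coef_of_identified hb.le hI]
  have h4 : F.sigmaR / b ^ 2 ≤ ‖F.D‖ := by linarith
  rwa [div_le_iff₀ (by positivity), mul_comm] at h4

theorem exists_base {g : ℝ} (hg : 0 < g) (hg1 : g ≤ 1) (hb : 0 < b) (hI : F.Identified b)
    (hr : F.coef.rank = d + s) (hs : 0 < d → g ≤ F.sinTheta b) :
    ∃ σ : ℝ, 0 ≤ σ ∧ σ ^ 2 ≤ 1 - g ^ 2 ∧ Base b (F.sigmaR / b ^ 2) σ F := by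
  obtain ⟨h1, h2⟩ := sigmaR_mul_le hb hI hr
  rcases Nat.eq_zero_or_pos d with hd | hd
  · exact ⟨0, le_rfl, by nlinarith, hI, h2, h1, fun h => absurd h (by omega)⟩
  refine ⟨(Matrix.toEuclideanLin ((b⁻¹ • F.R)ᵀ * (b⁻¹ • F.P))).singularValues 0,
    LinearMap.singularValues_nonneg _ _, ?_, hI, h2, h1, fun _ => ?_⟩
  · have h3 := hs hd
    rw [sinTheta, Real.sin_arccos] at h3
    have := (Real.le_sqrt' hg).mp h3
    linarith
  · have h3 := (opBound_singularValues_zero ((b⁻¹ • F.R)ᵀ * (b⁻¹ • F.P))).smul (b ^ 2)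
    have e : b ^ 2 • ((b⁻¹ • F.R)ᵀ * (b⁻¹ • F.P)) = F.Rᵀ * F.P := by
      rw [Matrix.transpose_smul, Matrix.smul_mul, Matrix.mul_smul, smul_smul, smul_smul]
      have : b ^ 2 * b⁻¹ * b⁻¹ = 1 := by field_simp
      rw [this, one_smul]
    rwa [e, abs_of_pos (by positivity)] at h3

end Comp

end

end MARCF

/-! ### Geometry in a neighbourhood of the truth. -/

namespace MARCF

noncomputable section

open Filter Topology

/-- Used with `x` a squared distance: each larger `u` is beaten by some rotation, and letting `u`
decrease to `x` replaces attainment of the minimum. -/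
theorem le_of_forall_right_near {f : ℝ → ℝ} {x y B : ℝ} (hB : 0 < B) (hf : ContinuousAt f x)
    (h : ∀ u, x < u → u ≤ x + B → y ≤ f u) : y ≤ f x := by
  refine ge_of_tendsto (hf.tendsto.mono_left (nhdsWithin_le_nhds (s := Set.Ioi x))) ?_
  filter_upwards [Ioc_mem_nhdsGT (show x < x + B by linarith)] with u hu
  exact h u hu.1 hu.2

variable {p d s : Fin 2 → ℕ} {T : ℕ} {K G h κ b E : ℝ} {Θ Θ' Θ'' Θs : Params p d s}

/-- The growth constant of the components in a neighbourhood of the true parameter. -/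
def nearConst (K : ℝ) : ℝ := 2 * ((K ^ 2 + 1) + 3) ^ 3

theorem two_le_nearConst (K : ℝ) : 2 ≤ nearConst K := by
  have : 1 ≤ ((K ^ 2 + 1) + 3) ^ 3 := one_le_pow₀ (by nlinarith [sq_nonneg K])
  rw [nearConst]; linarith

theorem le_nearConst (hK : 1 ≤ K) : K ≤ nearConst K := by
  have h1 : K ^ 2 + 1 + 3 ≤ ((K ^ 2 + 1) + 3) ^ 3 :=
    le_self_pow₀ (by nlinarith [sq_nonneg K]) (by norm_num)
  rw [nearConst]; nlinarith

theorem geomConst_ge_one (hK : 1 ≤ K) (G : ℝ) : 1 ≤ Comp.geomConst K G := by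
  have h1 : 1 ≤ K ^ 20 := one_le_pow₀ hK
  have h2 : 1 ≤ (3 + 2 / G ^ 2) ^ 2 := one_le_pow₀ (by
    have : 0 ≤ 2 / G ^ 2 := by positivity
    linarith)
  have := one_le_mul_of_one_le_of_one_le h1 h2
  rw [Comp.geomConst]; nlinarith

/-- A parameter that is identified, balanced with norm `h ^ 3`, and well-conditioned. -/
structure Truth (K G h κ b : ℝ) (Θ' : Params p d s) : Prop where
  one_le_K : 1 ≤ K
  G_pos : 0 < G
  h_pos : 0 < h
  one_le_κ : 1 ≤ κ
  le_b : h / K ≤ b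
  b_le : b ≤ K * h
  norm_coef : ∀ i, ‖(Θ' i).coef‖ = h ^ 3
  base : ∀ i, ∃ m σ, 0 ≤ σ ∧ σ ^ 2 ≤ 1 - G ^ 2 ∧ h / (κ * K ^ 2) ≤ m ∧ Comp.Base b m σ (Θ' i)

theorem Orbit.coef_eq (ho : Orbit Θ' Θ'') (i : Fin 2) : (Θ'' i).coef = (Θ' i).coef := by
  obtain ⟨Q, rfl⟩ := ho
  exact Comp.rot_coef (Q i).1.2 (Q i).2.1.2 (Q i).2.2.2

theorem Orbit.kron_eq (ho : Orbit Θ' Θ'') : kron Θ'' = kron Θ' := by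
  rw [kron, kron, ho.coef_eq, ho.coef_eq]

namespace Truth

theorem orbit (hT : Truth K G h κ b Θ') (ho : Orbit Θ' Θ'') : Truth K G h κ b Θ'' where
  one_le_K := hT.one_le_K
  G_pos := hT.G_pos
  h_pos := hT.h_pos
  one_le_κ := hT.one_le_κ
  le_b := hT.le_b
  b_le := hT.b_le
  norm_coef i := by rw [ho.coef_eq, hT.norm_coef]
  base i := by
    obtain ⟨m, σ, h1, h2, h3, h4⟩ := hT.base i
    obtain ⟨Q, rfl⟩ := ho
    exact ⟨m, σ, h1, h2, h3, h4.rot (Q i).1.2 (Q i).2.1.2 (Q i).2.2.2⟩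

theorem b_pos (hT : Truth K G h κ b Θ') : 0 < b :=
  lt_of_lt_of_le (div_pos hT.h_pos (by linarith [hT.one_le_K])) hT.le_b

theorem ident (hT : Truth K G h κ b Θ') (i : Fin 2) : (Θ' i).Identified b := by
  obtain ⟨m, σ, -, -, -, h4⟩ := hT.base i
  exact h4.ident

theorem norm_D_le (hT : Truth K G h κ b Θ') (i : Fin 2) : ‖(Θ' i).D‖ ≤ K ^ 2 * h := by
  have h1 := Comp.norm_coef_of_identified hT.b_pos.le (hT.ident i)
  rw [hT.norm_coef] at h1
  have hK : 0 < K := by linarith [hT.one_le_K]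
  have h2 : (h / K) ^ 2 * ‖(Θ' i).D‖ ≤ h ^ 3 := by
    rw [h1]
    have := hT.le_b
    have := hT.h_pos
    gcongr
  have e : (h / K) ^ 2 * ‖(Θ' i).D‖ = h ^ 2 / K ^ 2 * ‖(Θ' i).D‖ := by rw [div_pow]
  rw [e, div_mul_eq_mul_div, div_le_iff₀ (by positivity)] at h2
  have : h ^ 2 * ‖(Θ' i).D‖ ≤ h ^ 2 * (K ^ 2 * h) := by linarith
  exact le_of_mul_le_mul_left this (by have := hT.h_pos; positivity)

end Truth

theorem norm_U_sub_le (hE0 : 0 ≤ E) (hE : nsq (Θ - Θ') ≤ E ^ 2) (i : Fin 2) :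
    ‖(Θ i - Θ' i).U‖ ≤ E :=
  (abs_le_of_sq_le_sq' ((Comp.norm_U_sq_le _).trans ((comp_nsq_le (Θ - Θ') i).trans hE)) hE0).2

theorem norm_V_sub_le (hE0 : 0 ≤ E) (hE : nsq (Θ - Θ') ≤ E ^ 2) (i : Fin 2) :
    ‖(Θ i - Θ' i).V‖ ≤ E :=
  (abs_le_of_sq_le_sq' ((Comp.norm_V_sq_le _).trans ((comp_nsq_le (Θ - Θ') i).trans hE)) hE0).2

theorem norm_D_sub_le (hE0 : 0 ≤ E) (hE : nsq (Θ - Θ') ≤ E ^ 2) (i : Fin 2) :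
    ‖(Θ i - Θ' i).D‖ ≤ E :=
  (abs_le_of_sq_le_sq' ((Comp.norm_D_sq_le _).trans ((comp_nsq_le (Θ - Θ') i).trans hE)) hE0).2

/-- The squared error of the coefficient matrices. -/
def coefErr (Θ Θ' : Params p d s) : ℝ :=
  ‖(Θ 0).coef - (Θ' 0).coef‖ ^ 2 + ‖(Θ 1).coef - (Θ' 1).coef‖ ^ 2

theorem coefErr_nonneg (Θ Θ' : Params p d s) : 0 ≤ coefErr Θ Θ' := by unfold coefErr; positivity

theorem Orbit.coefErr_eq (ho : Orbit Θ' Θ'') : coefErr Θ Θ'' = coefErr Θ Θ' := by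
  rw [coefErr, coefErr, ho.coef_eq, ho.coef_eq]

namespace Truth

theorem near (hT : Truth K G h κ b Θ') (hE0 : 0 ≤ E) (hE : nsq (Θ - Θ') ≤ E ^ 2) (hEh : E ≤ h)
    (i : Fin 2) : Comp.Near (nearConst K) h E (Θ i) (Θ' i) := by
  have hK := hT.one_le_K
  have hh := hT.h_pos
  have hb : b ≤ (K ^ 2 + 1) * h := hT.b_le.trans
    (mul_le_mul_of_nonneg_right (by nlinarith) hh.le)
  refine Comp.near_of_bounds (by positivity) hh hEh
    ((opBound_of_gram hT.b_pos.le (hT.ident i).1).mono hb)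
    ((opBound_of_gram hT.b_pos.le (hT.ident i).2).mono hb)
    ((hT.norm_D_le i).trans (by nlinarith)) (norm_U_sub_le hE0 hE i) (norm_V_sub_le hE0 hE i)
    (norm_D_sub_le hE0 hE i)

/-- The aligning rotations of the two modes compose with those leading from `Θs` to `Θ'`, so the
aligned point is still in the orbit of `Θs`. -/
theorem distSq_le (hT : Truth K G h κ b Θ') (ho : Orbit Θs Θ') (hE0 : 0 ≤ E) (hE : nsq (Θ - Θ') ≤ E ^ 2)
    (hEh : E ≤ h / K) :
    distSq Θ Θs ≤ Comp.geomConst K G * (κ ^ 2 / h ^ 4 * coefErr Θ Θ' + reg₂ b Θ / h ^ 2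
      + 2 * (κ ^ 2 / h ^ 2 * E ^ 4)) := by
  have key : ∀ i, ∃ Q : Matrix.orthogonalGroup (Fin (d i)) ℝ ×
      Matrix.orthogonalGroup (Fin (s i)) ℝ × Matrix.orthogonalGroup (Fin (s i)) ℝ,
      (Θ i - (Θ' i).rot (Q.1 : Matrix (Fin (d i)) (Fin (d i)) ℝ)
        (Q.2.1 : Matrix (Fin (s i)) (Fin (s i)) ℝ)
        (Q.2.2 : Matrix (Fin (s i)) (Fin (s i)) ℝ)).nsq ≤ Comp.geomConst K G *
        (κ ^ 2 / h ^ 4 * ‖(Θ i).coef - (Θ' i).coef‖ ^ 2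
          + (‖(Θ i).Uᵀ * (Θ i).U - b ^ 2 • 1‖ ^ 2
            + ‖(Θ i).Vᵀ * (Θ i).V - b ^ 2 • 1‖ ^ 2) / h ^ 2
          + κ ^ 2 / h ^ 2 * E ^ 4) := fun i => by
    obtain ⟨m, σ, h1, h2, h3, h4⟩ := hT.base i
    obtain ⟨Q₁, o₁, Q₂, o₂, Q₃, o₃, hQ⟩ := h4.exists_rot_nsq_le hT.one_le_K hT.h_pos hT.one_le_κ
      hT.G_pos hT.le_b hT.b_le h1 h2 h3 (hT.norm_D_le i) hE0
      ((comp_nsq_le (Θ - Θ') i).trans hE) hEh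
    exact ⟨(⟨Q₁, o₁⟩, ⟨Q₂, o₂⟩, ⟨Q₃, o₃⟩), hQ⟩
  choose Q hQ using key
  refine (distSq_le_of_orbit (ho.trans ⟨Q, rfl⟩)).trans ?_
  rw [nsq, Fin.sum_univ_two]
  refine (add_le_add (hQ 0) (hQ 1)).trans_eq ?_
  rw [coefErr, reg₂, Fin.sum_univ_two]
  ring

theorem coefErr_le (hT : Truth K G h κ b Θ') (hE0 : 0 ≤ E) (hE : nsq (Θ - Θ') ≤ E ^ 2)
    (hEh : E ≤ h) : coefErr Θ Θ' ≤ 18 * nearConst K ^ 2 * h ^ 4 * E ^ 2 := by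
  have h1 : ∀ i, ‖(Θ i).coef - (Θ' i).coef‖ ^ 2 ≤ (3 * nearConst K * h ^ 2 * E) ^ 2 := fun i =>
    pow_le_pow_left₀ (norm_nonneg _) (hT.near hE0 hE hEh i).diff.norm_le 2
  have := h1 0
  have := h1 1
  rw [coefErr]; linarith

/-- The Kronecker product is blind to moving a scalar from one factor to the other; the imbalance
term detects exactly this. -/
theorem le_kron (hT : Truth K G h κ b Θ') (hS : coefErr Θ Θ' ≤ 2 * h ^ 6) :
    h ^ 6 / 2 * coefErr Θ Θ' ≤ ‖kron Θ - kron Θ'‖ ^ 2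
      + 1 / 4 * (‖(Θ 0).coef‖ ^ 2 - ‖(Θ 1).coef‖ ^ 2) ^ 2 := by
  have hS0 := coefErr_nonneg Θ Θ'
  have e : ∀ i, ‖(Θ i).coef - (Θ' i).coef‖ ^ 2 =
      ‖(Θ i).coef‖ ^ 2 - 2 * frobInner (Θ i).coef (Θ' i).coef + h ^ 6 := fun i => by
    rw [norm_sub_sq_frob, hT.norm_coef]; ring
  have hk : ‖kron Θ - kron Θ'‖ ^ 2 = ‖(Θ 1).coef‖ ^ 2 * ‖(Θ 0).coef‖ ^ 2
      - 2 * (frobInner (Θ 1).coef (Θ' 1).coef * frobInner (Θ 0).coef (Θ' 0).coef) + h ^ 12 := by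
    rw [norm_sub_sq_frob, norm_kron, norm_kron, hT.norm_coef, hT.norm_coef, kron, kron,
      frobInner_kronecker]
    ring
  rw [hk]
  rw [coefErr, e, e] at hS hS0 ⊢
  set x := ‖(Θ 0).coef‖ ^ 2
  set y := ‖(Θ 1).coef‖ ^ 2
  set u := frobInner (Θ 0).coef (Θ' 0).coef
  set v := frobInner (Θ 1).coef (Θ' 1).coef
  set t := x - 2 * u + h ^ 6 + (y - 2 * v + h ^ 6) with ht
  have h1 : t * t ≤ t * (2 * h ^ 6) := mul_le_mul_of_nonneg_left hS hS0
  -- Completing squares leaves `h⁶ t - t² / 4`, which is at least `h⁶ t / 2` since `t ≤ 2 h⁶`.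
  have h2 : y * x - 2 * (v * u) + h ^ 12 + 1 / 4 * (x - y) ^ 2 =
      h ^ 6 * t - t ^ 2 / 4 + 1 / 2 * (u + v - 2 * h ^ 6 + t) ^ 2
        + 1 / 2 * (u - v) ^ 2 := by
    rw [ht]; ring
  rw [h2]
  nlinarith [sq_nonneg (u + v - 2 * h ^ 6 + t), sq_nonneg (u - v)]

theorem kron_le (hT : Truth K G h κ b Θ') (hS : coefErr Θ Θ' ≤ 2 * h ^ 6) :
    ‖kron Θ - kron Θ'‖ ^ 2 ≤ 14 * h ^ 6 * coefErr Θ Θ' := by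
  have e : kron Θ - kron Θ' = (Θ 1).coef ⊗ₖ ((Θ 0).coef - (Θ' 0).coef)
      + ((Θ 1).coef - (Θ' 1).coef) ⊗ₖ (Θ' 0).coef := by
    rw [kron, kron, sub_eq_add_neg (Θ 0).coef, sub_eq_add_neg (Θ 1).coef, Matrix.kronecker_add,
      Matrix.add_kronecker, ← neg_one_smul ℝ (Θ' 0).coef, ← neg_one_smul ℝ (Θ' 1).coef,
      Matrix.kronecker_smul, Matrix.smul_kronecker]
    module
  have hh := hT.h_pos
  have h1 : ‖kron Θ - kron Θ'‖ ≤ ‖(Θ 1).coef‖ * ‖(Θ 0).coef - (Θ' 0).coef‖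
      + ‖(Θ 1).coef - (Θ' 1).coef‖ * h ^ 3 := by
    rw [e]
    refine (norm_add_le _ _).trans_eq ?_
    rw [norm_kronecker, norm_kronecker, hT.norm_coef]
  have h2 : ‖(Θ 1).coef‖ ≤ h ^ 3 + ‖(Θ 1).coef - (Θ' 1).coef‖ := by
    rw [← hT.norm_coef 1]
    have := norm_add_le (Θ' 1).coef ((Θ 1).coef - (Θ' 1).coef)
    rwa [add_sub_cancel] at this
  rw [coefErr] at hS ⊢
  set x := ‖(Θ 0).coef - (Θ' 0).coef‖
  set y := ‖(Θ 1).coef - (Θ' 1).coef‖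
  have hx : 0 ≤ x := norm_nonneg _
  have hy : 0 ≤ y := norm_nonneg _
  have h3 : ‖(Θ 1).coef‖ ^ 2 ≤ 6 * h ^ 6 := by
    have := pow_le_pow_left₀ (norm_nonneg _) h2 2
    nlinarith [sq_nonneg (h ^ 3 - y), sq_nonneg x]
  have h4 := pow_le_pow_left₀ (norm_nonneg _) h1 2
  have h5 : ‖(Θ 1).coef‖ ^ 2 * x ^ 2 ≤ 6 * h ^ 6 * x ^ 2 :=
    mul_le_mul_of_nonneg_right h3 (sq_nonneg x)
  nlinarith [sq_nonneg (‖(Θ 1).coef‖ * x - y * h ^ 3), mul_nonneg (pow_nonneg hh.le 6) (sq_nonneg y),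
    mul_nonneg (pow_nonneg hh.le 6) (sq_nonneg x)]

end Truth

end

end MARCF

/-! ### Contraction of one gradient step. -/

namespace MARCF

noncomputable section

variable {p d s : Fin 2 → ℕ} {T : ℕ} {K G h κ b E : ℝ} {Θ Θ' Θ'' Θs : Params p d s}
  {Y : Fin (T + 1) → Matrix (Fin (p 0)) (Fin (p 1)) ℝ} {α β lam₁ lam₂ η₀ η ξ : ℝ}

/-- The largest admissible normalized step size. -/
def stepConst (K : ℝ) : ℝ := (128 * nearConst K ^ 4 * K)⁻¹

/-- Assumptions on the data, the tuning parameters and the step size around `Θ'`. -/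
structure Regime (K h κ α β lam₁ lam₂ η₀ η ξ : ℝ)
    (Y : Fin (T + 1) → Matrix (Fin (p 0)) (Fin (p 1)) ℝ) (Θ' : Params p d s) : Prop where
  curv : RSCRSS d s Y α β
  ξ_nonneg : 0 ≤ ξ
  dev : ∀ F : Params p d s, |frobInner (matGrad (lossKron Y) (kron Θ')) (kron F)| ≤
      ξ * (‖(F 1).coef‖ * ‖(F 0).coef‖)
  le_lam₁ : K⁻¹ * α ≤ lam₁
  lam₁_le : lam₁ ≤ K * α
  le_lam₂ : K⁻¹ * (h ^ 8 * α / κ ^ 2) ≤ lam₂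
  lam₂_le : lam₂ ≤ K * (h ^ 8 * α / κ ^ 2)
  η₀_pos : 0 < η₀
  η₀_le : η₀ ≤ stepConst K
  η_eq : η * (h ^ 10 * β) = η₀

namespace Regime

theorem orbit (hR : Regime K h κ α β lam₁ lam₂ η₀ η ξ Y Θ') (ho : Orbit Θ' Θ'') :
    Regime K h κ α β lam₁ lam₂ η₀ η ξ Y Θ'' := by
  obtain ⟨h1, h2, h3, h4, h5, h6, h7, h8, h9, h10⟩ := hR
  exact ⟨h1, h2, by rw [ho.kron_eq]; exact h3, h4, h5, h6, h7, h8, h9, h10⟩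

theorem α_pos (hR : Regime K h κ α β lam₁ lam₂ η₀ η ξ Y Θ') : 0 < α := hR.curv.1

theorem β_pos (hR : Regime K h κ α β lam₁ lam₂ η₀ η ξ Y Θ') : 0 < β :=
  hR.curv.1.trans_le hR.curv.2.1

theorem η_pos (hR : Regime K h κ α β lam₁ lam₂ η₀ η ξ Y Θ') (hT : Truth K G h κ b Θ') :
    0 < η := by
  have h1 : 0 < h ^ 10 * β := mul_pos (pow_pos hT.h_pos 10) hR.β_pos
  exact pos_of_mul_pos_left (hR.η_eq ▸ hR.η₀_pos) h1.le

theorem lam₁_pos (hR : Regime K h κ α β lam₁ lam₂ η₀ η ξ Y Θ') (hT : Truth K G h κ b Θ') :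
    0 < lam₁ :=
  (mul_pos (inv_pos.mpr (by linarith [hT.one_le_K])) hR.α_pos).trans_le hR.le_lam₁

theorem lam₂_pos (hR : Regime K h κ α β lam₁ lam₂ η₀ η ξ Y Θ') (hT : Truth K G h κ b Θ') :
    0 < lam₂ := by
  refine lt_of_lt_of_le ?_ hR.le_lam₂
  have := hT.one_le_K
  have := hT.one_le_κ
  have := hT.h_pos
  have := hR.α_pos
  positivity

theorem lam₁_le' (hR : Regime K h κ α β lam₁ lam₂ η₀ η ξ Y Θ') (hT : Truth K G h κ b Θ') :
    lam₁ ≤ K * β :=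
  hR.lam₁_le.trans (mul_le_mul_of_nonneg_left hR.curv.2.1 (by linarith [hT.one_le_K]))

theorem lam₂_le' (hR : Regime K h κ α β lam₁ lam₂ η₀ η ξ Y Θ') (hT : Truth K G h κ b Θ') :
    lam₂ ≤ K * (h ^ 8 * β) := by
  refine hR.lam₂_le.trans (mul_le_mul_of_nonneg_left ?_ (by linarith [hT.one_le_K]))
  have h1 := hR.curv.2.1
  have h2 : 1 ≤ κ ^ 2 := one_le_pow₀ hT.one_le_κ
  have hh := hT.h_pos
  have hα := hR.α_pos
  calc h ^ 8 * α / κ ^ 2 ≤ h ^ 8 * α := div_le_self (by positivity) h2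
    _ ≤ _ := by gcongr

theorem pairing_lower (hR : Regime K h κ α β lam₁ lam₂ η₀ η ξ Y Θ') (hT : Truth K G h κ b Θ')
    (hE0 : 0 ≤ E) (hE : nsq (Θ - Θ') ≤ E ^ 2) (hEh : E ≤ h) :
    1 / 2 * ‖(kron Θ - kron Θ') * lagMat Y‖ ^ 2
      + 1 / 4 * lam₁ * (‖(Θ 0).coef‖ ^ 2 - ‖(Θ 1).coef‖ ^ 2) ^ 2 + 1 / 2 * lam₂ * reg₂ b Θ
      - 167 * K * nearConst K ^ 4 * (β * h ^ 8) * E ^ 4 - 2 * nearConst K ^ 2 * h ^ 5 * ξ * E ≤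
    pairing (grad Y lam₁ lam₂ b Θ) (Θ - Θ') := by
  have hN := hT.near hE0 hE hEh
  have hM := two_le_nearConst K
  set M := nearConst K
  rw [pairing_grad, objDeriv]
  have h1 := data_lower hR.curv hR.ξ_nonneg hR.dev hN (norm_U_sub_le hE0 hE)
    (norm_V_sub_le hE0 hE) (norm_D_sub_le hE0 hE)
  have h2 := mul_le_mul_of_nonneg_left (reg₁_lower hN (by rw [hT.norm_coef, hT.norm_coef]))
    (hR.lam₁_pos hT).le
  have h3 := mul_le_mul_of_nonneg_left (reg₂_lower (b := b) (Θ := Θ) hT.ident)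
    (hR.lam₂_pos hT).le
  have h4 : lam₂ * nsq (Θ - Θ') ^ 2 ≤ K * (h ^ 8 * β) * E ^ 4 := by
    have e : E ^ 4 = (E ^ 2) ^ 2 := by ring
    rw [e]
    exact mul_le_mul (hR.lam₂_le' hT) (pow_le_pow_left₀ (nsq_nonneg _) hE 2) (sq_nonneg _)
      ((hR.lam₂_pos hT).le.trans (hR.lam₂_le' hT))
  have hh := hT.h_pos
  have hβ := hR.β_pos
  have hK := hT.one_le_K
  have h5 : lam₁ * (M ^ 4 * h ^ 8 * E ^ 4) ≤ K * β * (M ^ 4 * h ^ 8 * E ^ 4) :=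
    mul_le_mul_of_nonneg_right (hR.lam₁_le' hT) (by positivity)
  have h6 : 1 * (β * h ^ 8 * E ^ 4) * K ≤ M ^ 4 * (β * h ^ 8 * E ^ 4) * K := by
    have : 1 ≤ M ^ 4 := one_le_pow₀ (by linarith)
    gcongr
  have h7 : 1 * (M ^ 4 * (β * h ^ 8 * E ^ 4)) ≤ K * (M ^ 4 * (β * h ^ 8 * E ^ 4)) := by
    gcongr
  simp only [Pi.sub_apply] at h3 ⊢
  rw [mul_assoc lam₁]
  nlinarith

theorem nsq_grad_le (hR : Regime K h κ α β lam₁ lam₂ η₀ η ξ Y Θ') (hT : Truth K G h κ b Θ')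
    (hE0 : 0 ≤ E) (hE : nsq (Θ - Θ') ≤ E ^ 2) (hEh : E ≤ h) :
    η * nsq (grad Y lam₁ lam₂ b Θ) ≤ 1 / 2 * ‖(kron Θ - kron Θ') * lagMat Y‖ ^ 2
      + 1 / 4 * lam₁ * (‖(Θ 0).coef‖ ^ 2 - ‖(Θ 1).coef‖ ^ 2) ^ 2 + 1 / 2 * lam₂ * reg₂ b Θ
      + κ ^ 2 * ξ ^ 2 / α := by
  have hN := hT.near hE0 hE hEh
  have hM := two_le_nearConst K
  have hh := hT.h_pos
  have hβ := hR.β_pos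
  have hα := hR.α_pos
  have hK := hT.one_le_K
  have hη := hR.η_pos hT
  have hl₁ := hR.lam₁_pos hT
  have hl₂ := hR.lam₂_pos hT
  have h1 := mul_le_mul_of_nonneg_left (MARCF.nsq_grad_le (b := b) hR.curv hR.ξ_nonneg hl₁.le
    hl₂.le (by linarith) hh.le hR.dev hN) hη.le
  have hs := hR.η₀_le
  rw [stepConst] at hs
  set M := nearConst K
  set z := ‖(kron Θ - kron Θ') * lagMat Y‖ ^ 2
  set δ := (‖(Θ 0).coef‖ ^ 2 - ‖(Θ 1).coef‖ ^ 2) ^ 2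
  set w := reg₂ b Θ
  have hz : 0 ≤ z := sq_nonneg _
  have hδ : 0 ≤ δ := sq_nonneg _
  have hw : 0 ≤ w := reg₂_nonneg _ _
  have hM0 : 0 < M := by linarith
  -- The factor `128` in `stepConst` is set by the Gram regularizer, whose gradient bound carries
  -- `64` and must be half absorbed.
  have hηM : 128 * (η * h ^ 10 * β) * (M ^ 4 * K) ≤ 1 := by
    have h2 := mul_le_mul_of_nonneg_right hs (show 0 ≤ 128 * M ^ 4 * K by positivity)
    rw [inv_mul_cancel₀ (by positivity), ← hR.η_eq] at h2
    linarith
  have hq : 128 * (η * h ^ 10 * M ^ 4) * (K * β) ≤ 1 := by linarith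
  have hq1 : 128 * (η * h ^ 10 * M ^ 4) * β ≤ 1 := by
    refine le_trans ?_ hq
    have : β ≤ K * β := le_mul_of_one_le_left hβ.le hK
    gcongr
  have t1 : 16 * (η * h ^ 10 * M ^ 4) * (β * z) ≤ 1 / 2 * z := by nlinarith
  have t2 : 16 * (η * h ^ 10 * M ^ 4) * ξ ^ 2 ≤ κ ^ 2 * ξ ^ 2 / α := by
    have h3 : ξ ^ 2 / α ≤ κ ^ 2 * ξ ^ 2 / α := by
      have : 1 ≤ κ ^ 2 := one_le_pow₀ hT.one_le_κ
      gcongr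
      exact le_mul_of_one_le_left (sq_nonneg ξ) this
    refine le_trans ?_ h3
    rw [le_div_iff₀ hα]
    have h4 : 16 * (η * h ^ 10 * M ^ 4) * α ≤ 1 := by
      have : 16 * (η * h ^ 10 * M ^ 4) * α ≤ 128 * (η * h ^ 10 * M ^ 4) * β := by
        have := hR.curv.2.1
        gcongr
        norm_num
      linarith
    nlinarith [sq_nonneg ξ]
  have t3 : 16 * (η * h ^ 10 * M ^ 4) * (lam₁ ^ 2 * δ) ≤ 1 / 4 * lam₁ * δ := by
    have h3 : 16 * (η * h ^ 10 * M ^ 4) * lam₁ ≤ 1 / 8 := by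
      have : 16 * (η * h ^ 10 * M ^ 4) * lam₁ ≤ 16 * (η * h ^ 10 * M ^ 4) * (K * β) :=
        mul_le_mul_of_nonneg_left (hR.lam₁_le' hT) (by positivity)
      linarith
    have := mul_le_mul_of_nonneg_right h3 (show 0 ≤ lam₁ * δ by positivity)
    nlinarith [show 0 ≤ lam₁ * δ by positivity]
  have t4 : η * (64 * M ^ 2 * h ^ 2 * lam₂ ^ 2 * w) ≤ 1 / 2 * lam₂ * w := by
    have h3 : 64 * (η * h ^ 2 * M ^ 2) * lam₂ ≤ 1 / 2 := by
      have h4 : 64 * (η * h ^ 2 * M ^ 2) * lam₂ ≤ 64 * (η * h ^ 2 * M ^ 4) * (K * (h ^ 8 * β)) := by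
        refine mul_le_mul ?_ (hR.lam₂_le' hT) hl₂.le (by positivity)
        have : M ^ 2 ≤ M ^ 4 := pow_le_pow_right₀ (by linarith) (by norm_num)
        gcongr
      have h5 : 64 * (η * h ^ 2 * M ^ 4) * (K * (h ^ 8 * β)) =
          1 / 2 * (128 * (η * h ^ 10 * M ^ 4) * (K * β)) := by ring
      linarith
    have := mul_le_mul_of_nonneg_right h3 (show 0 ≤ lam₂ * w by positivity)
    nlinarith
  refine h1.trans ?_
  linarith

end Regime

/-- The contraction constant. -/
def rateConst (K G : ℝ) : ℝ := (4 * K * Comp.geomConst K G)⁻¹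

/-- The constant of the basin of attraction. -/
def basinConst (K G : ℝ) : ℝ := rateConst K G / (5360 * K * nearConst K ^ 4)

/-- The constant of the statistical error in one step. -/
def noiseConst (K G : ℝ) : ℝ := 32 * nearConst K ^ 4 / rateConst K G + 1

theorem rateConst_pos (hK : 1 ≤ K) (G : ℝ) : 0 < rateConst K G := by
  have := geomConst_ge_one hK G
  rw [rateConst]; positivity

theorem rateConst_le (hK : 1 ≤ K) (G : ℝ) : rateConst K G ≤ 1 / 4 := by
  have := one_le_mul_of_one_le_of_one_le hK (geomConst_ge_one hK G)
  rw [rateConst, inv_eq_one_div, mul_assoc]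
  exact one_div_le_one_div_of_le (by norm_num) (by linarith)

theorem basinConst_pos (hK : 1 ≤ K) (G : ℝ) : 0 < basinConst K G := by
  have := rateConst_pos hK G
  have := two_le_nearConst K
  rw [basinConst]; positivity

theorem basinConst_mul (hK : 1 ≤ K) (G : ℝ) :
    5360 * K * nearConst K ^ 4 * basinConst K G = rateConst K G := by
  have := two_le_nearConst K
  rw [basinConst]
  field_simp

theorem noiseConst_pos (hK : 1 ≤ K) (G : ℝ) : 0 < noiseConst K G := by
  have := rateConst_pos hK G
  rw [noiseConst]; positivity

theorem basinConst_le (hK : 1 ≤ K) (G : ℝ) : 18 * nearConst K ^ 2 * basinConst K G ≤ 1 := by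
  have h1 := basinConst_mul hK G
  have h2 := rateConst_le hK G
  have h3 := basinConst_pos hK G
  have hM := two_le_nearConst K
  have h4 : nearConst K ^ 2 ≤ nearConst K ^ 4 := pow_le_pow_right₀ (by linarith) (by norm_num)
  have h5 : 1 * (nearConst K ^ 2 * basinConst K G) ≤
      K * (nearConst K ^ 4 * basinConst K G) := by gcongr
  nlinarith

/-- The squared radius of the basin of attraction. -/
def basin (K G h κ α β : ℝ) : ℝ := basinConst K G * (h ^ 2 * α / (κ ^ 2 * β))

namespace Regime

theorem basin_pos (hR : Regime K h κ α β lam₁ lam₂ η₀ η ξ Y Θ') (hT : Truth K G h κ b Θ') :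
    0 < basin K G h κ α β := by
  have := basinConst_pos hT.one_le_K G
  have := hT.h_pos
  have := hT.one_le_κ
  have := hR.α_pos
  have := hR.β_pos
  rw [basin]; positivity

theorem basin_le (hR : Regime K h κ α β lam₁ lam₂ η₀ η ξ Y Θ') (hT : Truth K G h κ b Θ') :
    κ ^ 2 * basin K G h κ α β ≤ basinConst K G * h ^ 2 := by
  have h1 := basinConst_pos hT.one_le_K G
  have hκ : 0 < κ := by linarith [hT.one_le_κ]
  have hβ := hR.β_pos
  have e : κ ^ 2 * basin K G h κ α β = basinConst K G * h ^ 2 * (α / β) := by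
    rw [basin]; field_simp
  rw [e]
  exact mul_le_of_le_one_right (by positivity) ((div_le_one hβ).mpr hR.curv.2.1)

theorem le_h_of_basin (hR : Regime K h κ α β lam₁ lam₂ η₀ η ξ Y Θ') (hT : Truth K G h κ b Θ')
    (hEB : E ^ 2 ≤ 2 * basin K G h κ α β) : nearConst K * E ≤ h := by
  have h1 := hR.basin_le hT
  have h2 : 1 ≤ κ ^ 2 := one_le_pow₀ hT.one_le_κ
  have h3 := hR.basin_pos hT
  have h4 := basinConst_le hT.one_le_K G
  have h5 : E ^ 2 ≤ 2 * (basinConst K G * h ^ 2) := by nlinarith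
  refine (abs_le_of_sq_le_sq' ?_ hT.h_pos.le).2
  have h6 := mul_le_mul_of_nonneg_left h5 (sq_nonneg (nearConst K))
  have h7 := mul_le_mul_of_nonneg_right h4 (sq_nonneg h)
  have h8 := sq_nonneg h
  rw [mul_pow]; nlinarith

theorem coefErr_le_of_basin (hR : Regime K h κ α β lam₁ lam₂ η₀ η ξ Y Θ')
    (hT : Truth K G h κ b Θ') (hE0 : 0 ≤ E) (hE : nsq (Θ - Θ') ≤ E ^ 2)
    (hEB : E ^ 2 ≤ 2 * basin K G h κ α β) : coefErr Θ Θ' ≤ 2 * h ^ 6 := by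
  have hM := two_le_nearConst K
  have hEh : E ≤ h := le_trans (by nlinarith) (hR.le_h_of_basin hT hEB)
  refine (hT.coefErr_le hE0 hE hEh).trans ?_
  have h1 := hR.basin_le hT
  have h2 : 1 ≤ κ ^ 2 := one_le_pow₀ hT.one_le_κ
  have h3 := hR.basin_pos hT
  have h4 := basinConst_le hT.one_le_K G
  have h5 : E ^ 2 ≤ 2 * (basinConst K G * h ^ 2) := by nlinarith
  have h6 := mul_le_mul_of_nonneg_left h5
    (show 0 ≤ 18 * nearConst K ^ 2 * h ^ 4 by have := hT.h_pos; positivity)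
  have h7 := mul_le_mul_of_nonneg_right h4 (show 0 ≤ h ^ 6 by have := hT.h_pos; positivity)
  nlinarith

/-- Strong convexity turns prediction error into Kronecker error, balancing turns that into
coefficient error, and geometry turns coefficient error and Gram defect into distance. The scaling
of `λ₂` by `h⁸ α / κ²` matches the weights in `Truth.distSq_le`. -/
theorem regularity_lower (hR : Regime K h κ α β lam₁ lam₂ η₀ η ξ Y Θ')
    (hT : Truth K G h κ b Θ') (ho : Orbit Θs Θ') (hE0 : 0 ≤ E) (hE : nsq (Θ - Θ') ≤ E ^ 2)
    (hEB : E ^ 2 ≤ 2 * basin K G h κ α β) :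
    α * h ^ 10 / κ ^ 2 * (rateConst K G * distSq Θ Θs) - β * h ^ 8 * E ^ 4 ≤
    1 / 2 * ‖(kron Θ - kron Θ') * lagMat Y‖ ^ 2
      + 1 / 4 * lam₁ * (‖(Θ 0).coef‖ ^ 2 - ‖(Θ 1).coef‖ ^ 2) ^ 2 + 1 / 2 * lam₂ * reg₂ b Θ := by
  have hM := two_le_nearConst K
  have hK := hT.one_le_K
  have hh := hT.h_pos
  have hκ := hT.one_le_κ
  have hα := hR.α_pos
  have hK0 : 0 < K := by linarith
  have hMh := hR.le_h_of_basin hT hEB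
  have hEK : E ≤ h / K := by
    rw [le_div_iff₀ hK0]
    nlinarith [le_nearConst hK]
  have hd := hT.distSq_le ho hE0 hE hEK
  have hk := hT.le_kron (hR.coefErr_le_of_basin hT hE0 hE hEB)
  have hz := hR.curv.lower Θ Θ'
  have hw := reg₂_nonneg b Θ
  have hC := geomConst_ge_one hK G
  set c := Comp.geomConst K G with hc
  set S := coefErr Θ Θ'
  set z := ‖(kron Θ - kron Θ') * lagMat Y‖ ^ 2
  set q := ‖kron Θ - kron Θ'‖ ^ 2
  set δ := (‖(Θ 0).coef‖ ^ 2 - ‖(Θ 1).coef‖ ^ 2) ^ 2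
  set w := reg₂ b Θ
  have hδ : 0 ≤ δ := sq_nonneg _
  have hq : 0 ≤ q := sq_nonneg _
  have e1 : α * h ^ 10 / κ ^ 2 * (rateConst K G * distSq Θ Θs) ≤
      K⁻¹ * α * (h ^ 6 / 4 * S) + K⁻¹ * (h ^ 8 * α / κ ^ 2) * w / 4
        + K⁻¹ * α * h ^ 8 * E ^ 4 / 2 := by
    have h1 : rateConst K G * distSq Θ Θs ≤ rateConst K G *
        (c * (κ ^ 2 / h ^ 4 * S + w / h ^ 2 + 2 * (κ ^ 2 / h ^ 2 * E ^ 4))) :=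
      mul_le_mul_of_nonneg_left hd (rateConst_pos hK G).le
    refine (mul_le_mul_of_nonneg_left h1 (by positivity)).trans_eq ?_
    rw [rateConst, ← hc]
    field_simp
    ring
  have e2 : K⁻¹ * α * (h ^ 6 / 4 * S) ≤ 1 / 2 * z + 1 / 4 * lam₁ * δ := by
    have h1 : K⁻¹ * α * (h ^ 6 / 2 * S) ≤ K⁻¹ * α * (q + 1 / 4 * δ) :=
      mul_le_mul_of_nonneg_left hk (by positivity)
    have h2 : K⁻¹ * α * δ ≤ lam₁ * δ := mul_le_mul_of_nonneg_right hR.le_lam₁ hδ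
    have h3 : K⁻¹ * (α * q) ≤ α * q :=
      mul_le_of_le_one_left (by positivity) (inv_le_one_of_one_le₀ hK)
    have h4 : 0 ≤ lam₁ * δ := mul_nonneg (hR.lam₁_pos hT).le hδ
    linarith
  have e3 : K⁻¹ * (h ^ 8 * α / κ ^ 2) * w / 4 ≤ 1 / 2 * lam₂ * w := by
    have := mul_le_mul_of_nonneg_right hR.le_lam₂ hw
    have : 0 ≤ lam₂ * w := mul_nonneg (hR.lam₂_pos hT).le hw
    linarith
  have e4 : K⁻¹ * α * h ^ 8 * E ^ 4 / 2 ≤ β * h ^ 8 * E ^ 4 := by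
    have h1 : K⁻¹ * (α * h ^ 8 * E ^ 4) ≤ α * h ^ 8 * E ^ 4 :=
      mul_le_of_le_one_left (by positivity) (inv_le_one_of_one_le₀ hK)
    have h2 : α * h ^ 8 * E ^ 4 ≤ β * h ^ 8 * E ^ 4 := by
      have := hR.curv.2.1
      gcongr
    have h3 : 0 ≤ α * h ^ 8 * E ^ 4 := by positivity
    linarith
  linarith

/-- The gain `2 W` from the pairing pays for the gradient norm, which costs `W`, and the surplus `W`
is turned into distance. The gain involves the true distance, the losses only `E`, which later tends
to it. -/
theorem nsq_step_le (hR : Regime K h κ α β lam₁ lam₂ η₀ η ξ Y Θ')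
    (hT : Truth K G h κ b Θ') (ho : Orbit Θs Θ') (hE0 : 0 ≤ E) (hE : nsq (Θ - Θ') ≤ E ^ 2)
    (hEB : E ^ 2 ≤ 2 * basin K G h κ α β) :
    nsq (gdStep Y lam₁ lam₂ b η Θ - Θ') ≤ E ^ 2
      - η * (α * h ^ 10 / κ ^ 2) * rateConst K G * (distSq Θ Θs - E ^ 2 / 4)
      + η * (noiseConst K G * (κ ^ 2 * ξ ^ 2 / α)) := by
  have hM := two_le_nearConst K
  have hK := hT.one_le_K
  have hh := hT.h_pos
  have hκ := hT.one_le_κ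
  have hα := hR.α_pos
  have hβ := hR.β_pos
  have hη := hR.η_pos hT
  have hν := rateConst_pos hK G
  have hMh := hR.le_h_of_basin hT hEB
  have hEh : E ≤ h := by nlinarith
  have h1 := hR.regularity_lower hT ho hE0 hE hEB
  have h2 := hR.pairing_lower hT hE0 hE hEh
  have h3 := hR.nsq_grad_le hT hE0 hE hEh
  have hb := basinConst_mul hK G
  have e0 : gdStep Y lam₁ lam₂ b η Θ - Θ' = Θ - Θ' - η • grad Y lam₁ lam₂ b Θ := by
    rw [gdStep_eq]; abel
  rw [e0, nsq_sub_smul]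
  set W := 1 / 2 * ‖(kron Θ - kron Θ') * lagMat Y‖ ^ 2
      + 1 / 4 * lam₁ * (‖(Θ 0).coef‖ ^ 2 - ‖(Θ 1).coef‖ ^ 2) ^ 2 + 1 / 2 * lam₂ * reg₂ b Θ
  set M := nearConst K
  set ν := rateConst K G
  set a := α * h ^ 10 / κ ^ 2 with ha
  have ha0 : 0 < a := by positivity
  have q1 : β * h ^ 8 * E ^ 4 ≤ 2 * (basinConst K G * (a * E ^ 2)) := by
    have h4 : β * h ^ 8 * E ^ 2 * E ^ 2 ≤ β * h ^ 8 * E ^ 2 * (2 * basin K G h κ α β) := by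
      gcongr
    have h5 : β * h ^ 8 * E ^ 2 * (2 * basin K G h κ α β) =
        2 * (basinConst K G * (a * E ^ 2)) := by
      rw [basin, ha]; field_simp
    nlinarith
  -- Here `335 = 2 * 167 + 1` collects the quartic errors, and `5360 = 8 * 2 * 335` in `basinConst`
  -- makes them cost at most `ν / 8`.
  have q2 : 335 * K * M ^ 4 * (β * h ^ 8 * E ^ 4) ≤ ν / 8 * (a * E ^ 2) := by
    refine (mul_le_mul_of_nonneg_left q1 (by positivity)).trans_eq ?_
    rw [← hb]; ring
  have q3 : β * h ^ 8 * E ^ 4 ≤ K * M ^ 4 * (β * h ^ 8 * E ^ 4) := by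
    refine le_mul_of_one_le_left (by positivity) ?_
    exact one_le_mul_of_one_le_of_one_le hK (one_le_pow₀ (by linarith))
  -- Young's inequality, written as a complete square; it produces the first term of `noiseConst`.
  have q4 : 4 * M ^ 2 * h ^ 5 * ξ * E ≤ ν / 8 * (a * E ^ 2)
      + 32 * M ^ 4 / ν * (κ ^ 2 * ξ ^ 2 / α) := by
    have h4 : ν / 8 * (a * E ^ 2) + 32 * M ^ 4 / ν * (κ ^ 2 * ξ ^ 2 / α)
        - 4 * M ^ 2 * h ^ 5 * ξ * E =
        ν / (8 * α * κ ^ 2) * (α * h ^ 5 * E - 16 * M ^ 2 * κ ^ 2 * ξ / ν) ^ 2 := by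
      rw [ha]; field_simp; ring
    have h5 : 0 ≤ ν / (8 * α * κ ^ 2) * (α * h ^ 5 * E - 16 * M ^ 2 * κ ^ 2 * ξ / ν) ^ 2 := by
      positivity
    linarith
  have p2 := mul_le_mul_of_nonneg_left h2 hη.le
  have p3 := mul_le_mul_of_nonneg_left h3 hη.le
  have p1 := mul_le_mul_of_nonneg_left
    (show a * (ν * distSq Θ Θs) - ν / 4 * (a * E ^ 2) + 4 * M ^ 2 * h ^ 5 * ξ * E
      - 32 * M ^ 4 / ν * (κ ^ 2 * ξ ^ 2 / α) + 334 * K * M ^ 4 * (β * h ^ 8 * E ^ 4) ≤ W by linarith) hη.le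
  rw [noiseConst]
  linarith

theorem distSq_step_le (hR : Regime K h κ α β lam₁ lam₂ η₀ η ξ Y Θs)
    (hT : Truth K G h κ b Θs) (hB : distSq Θ Θs ≤ basin K G h κ α β) :
    distSq (gdStep Y lam₁ lam₂ b η Θ) Θs ≤
      (1 - rateConst K G / 2 * (η * (α * h ^ 10 / κ ^ 2))) * distSq Θ Θs
      + η * (noiseConst K G * (κ ^ 2 * ξ ^ 2 / α)) := by
  have hd := distSq_nonneg Θ Θs
  have key := le_of_forall_right_near (x := distSq Θ Θs)
      (y := distSq (gdStep Y lam₁ lam₂ b η Θ) Θs) (f := fun u : ℝ => u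
      - η * (α * h ^ 10 / κ ^ 2) * rateConst K G * (distSq Θ Θs - u / 4)
      + η * (noiseConst K G * (κ ^ 2 * ξ ^ 2 / α))) (hR.basin_pos hT) (by fun_prop)
      fun u hu hu' => by
    obtain ⟨Θ', ho, hn⟩ := exists_orbit_of_distSq_lt hu
    have e : √u ^ 2 = u := Real.sq_sqrt (by linarith)
    have := (hR.orbit ho).nsq_step_le (hT.orbit ho) ho (Real.sqrt_nonneg u) (Θ := Θ)
      (by rw [e]; exact hn.le) (by rw [e]; linarith)
    rw [e] at this
    exact (distSq_le_of_orbit ho).trans this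
  refine key.trans ?_
  have h1 : 0 ≤ η * (α * h ^ 10 / κ ^ 2) * rateConst K G * distSq Θ Θs := by
    have := hR.η_pos hT
    have := hR.α_pos
    have := hT.h_pos
    have := hT.one_le_κ
    have := rateConst_pos hT.one_le_K G
    positivity
  linarith

end Regime

end

end MARCF

/-! ### Iteration, error bounds and the theorem. -/

namespace MARCF

noncomputable section

variable {p d s : Fin 2 → ℕ} {T : ℕ} {K G h κ b : ℝ} {Θ Θs Θ₀ : Params p d s}
  {Y : Fin (T + 1) → Matrix (Fin (p 0)) (Fin (p 1)) ℝ} {α β lam₁ lam₂ η₀ η ξ : ℝ}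

theorem stepConst_pos (hK : 1 ≤ K) : 0 < stepConst K := by
  have := two_le_nearConst K
  rw [stepConst]; positivity

theorem stepConst_le_one (hK : 1 ≤ K) : stepConst K ≤ 1 := by
  have h1 : 1 ≤ nearConst K ^ 4 := one_le_pow₀ (by linarith [two_le_nearConst K])
  have := one_le_mul_of_one_le_of_one_le h1 hK
  rw [stepConst]
  exact inv_le_one_of_one_le₀ (by linarith)

namespace Regime

theorem rate_eq (hR : Regime K h κ α β lam₁ lam₂ η₀ η ξ Y Θs) (hT : Truth K G h κ b Θs) :
    η * (α * h ^ 10 / κ ^ 2) = η₀ * α / (β * κ ^ 2) := by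
  have := hR.β_pos
  have := hT.one_le_κ
  rw [← hR.η_eq]
  field_simp

theorem rate_nonneg (hR : Regime K h κ α β lam₁ lam₂ η₀ η ξ Y Θs) (hT : Truth K G h κ b Θs) :
    0 ≤ 1 - rateConst K G / 2 * (η * (α * h ^ 10 / κ ^ 2)) := by
  have hβ := hR.β_pos
  have hα := hR.α_pos
  have hη := hR.η₀_pos
  have h1 : η₀ * α ≤ 1 * (β * κ ^ 2) := by
    have h2 : 1 ≤ κ ^ 2 := one_le_pow₀ hT.one_le_κ
    have h3 : α ≤ β * κ ^ 2 := hR.curv.2.1.trans (le_mul_of_one_le_right hβ.le h2)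
    exact mul_le_mul (hR.η₀_le.trans (stepConst_le_one hT.one_le_K)) h3 hα.le zero_le_one
  have hκ := hT.one_le_κ
  rw [hR.rate_eq hT]
  have h4 : η₀ * α / (β * κ ^ 2) ≤ 1 := by rwa [div_le_iff₀ (by positivity)]
  have h5 : 0 ≤ η₀ * α / (β * κ ^ 2) := by positivity
  nlinarith [rateConst_pos hT.one_le_K G, rateConst_le hT.one_le_K G]

theorem distSq_iterate_le (hR : Regime K h κ α β lam₁ lam₂ η₀ η ξ Y Θs)
    (hT : Truth K G h κ b Θs) (hB : distSq Θ₀ Θs ≤ basin K G h κ α β)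
    (hξ : noiseConst K G * (κ ^ 4 / h ^ 10 / α ^ 2 * ξ ^ 2) ≤
      rateConst K G / 2 * basin K G h κ α β) (j : ℕ) :
    distSq (iterate Y lam₁ lam₂ b η Θ₀ j) Θs ≤ basin K G h κ α β ∧
    distSq (iterate Y lam₁ lam₂ b η Θ₀ j) Θs ≤
      (1 - rateConst K G / 2 * (η * (α * h ^ 10 / κ ^ 2))) ^ j * distSq Θ₀ Θs
      + 2 * noiseConst K G / rateConst K G * (κ ^ 4 / h ^ 10 / α ^ 2 * ξ ^ 2) := by
  have hν := rateConst_pos hT.one_le_K G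
  have hC := noiseConst_pos hT.one_le_K G
  have hα := hR.α_pos
  have hκ := hT.one_le_κ
  have hh := hT.h_pos
  have hη := hR.η_pos hT
  have hρ := hR.rate_nonneg hT
  have ht : 0 < η * (α * h ^ 10 / κ ^ 2) := by positivity
  induction j with
  | zero =>
    refine ⟨hB, ?_⟩
    rw [pow_zero, one_mul, iterate, Function.iterate_zero, id]
    exact le_add_of_nonneg_right (by positivity)
  | succ j ih =>
    obtain ⟨h1, h2⟩ := ih
    have h3 := hR.distSq_step_le hT h1
    rw [iterate, Function.iterate_succ_apply']
    rw [iterate] at h1 h2 h3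
    set D := distSq ((gdStep Y lam₁ lam₂ b η)^[j] Θ₀) Θs
    have e1 : η * (noiseConst K G * (κ ^ 2 * ξ ^ 2 / α)) = η * (α * h ^ 10 / κ ^ 2)
        * (noiseConst K G * (κ ^ 4 / h ^ 10 / α ^ 2 * ξ ^ 2)) := by
      field_simp
    rw [e1] at h3
    set t := η * (α * h ^ 10 / κ ^ 2)
    set ρ := 1 - rateConst K G / 2 * t with hρt
    refine ⟨h3.trans ?_, h3.trans ?_⟩
    -- The bound on the noise is chosen so that the contraction leaves exactly enough room for it,
    -- so the basin is invariant.
    · have h4 := mul_le_mul_of_nonneg_left h1 hρ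
      have h5 := mul_le_mul_of_nonneg_left hξ ht.le
      have : ρ * basin K G h κ α β + t * (rateConst K G / 2 * basin K G h κ α β) =
        basin K G h κ α β := by rw [hρt]; ring
      linarith
    · have h4 := mul_le_mul_of_nonneg_left h2 hρ
      refine (add_le_add_left h4 _).trans_eq ?_
      rw [hρt, pow_succ]
      field_simp
      ring

theorem coefErr_le_distSq (hR : Regime K h κ α β lam₁ lam₂ η₀ η ξ Y Θs)
    (hT : Truth K G h κ b Θs) (hB : distSq Θ Θs ≤ basin K G h κ α β) :
    coefErr Θ Θs ≤ 18 * nearConst K ^ 2 * h ^ 4 * distSq Θ Θs ∧ coefErr Θ Θs ≤ 2 * h ^ 6 := by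
  have hd := distSq_nonneg Θ Θs
  have hM := two_le_nearConst K
  have hb := hR.basin_pos hT
  have key : ∀ u, distSq Θ Θs < u → u ≤ distSq Θ Θs + basin K G h κ α β →
      coefErr Θ Θs ≤ 18 * nearConst K ^ 2 * h ^ 4 * u ∧ coefErr Θ Θs ≤ 2 * h ^ 6 := by
    intro u hu hu'
    obtain ⟨Θ', ho, hn⟩ := exists_orbit_of_distSq_lt hu
    have e : √u ^ 2 = u := Real.sq_sqrt (by linarith)
    have hMh := hR.le_h_of_basin hT (E := √u) (by rw [e]; linarith)
    have h0 := Real.sqrt_nonneg u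
    have h1 := (hT.orbit ho).coefErr_le h0 (Θ := Θ) (by rw [e]; exact hn.le)
      (by nlinarith)
    have h2 := (hR.orbit ho).coefErr_le_of_basin (hT.orbit ho) h0 (Θ := Θ)
      (by rw [e]; exact hn.le) (by rw [e]; linarith)
    rw [ho.coefErr_eq, e] at h1
    rw [ho.coefErr_eq] at h2
    exact ⟨h1, h2⟩
  exact ⟨le_of_forall_right_near (f := fun u => 18 * nearConst K ^ 2 * h ^ 4 * u) hb
    (by fun_prop) fun u hu hu' => (key u hu hu').1, (key _ (by linarith) le_rfl).2⟩

/-- For an identified parameter the Gram defect vanishes, and in the basin the term quadratic in the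
squared distance is at most half of the left side, so it is absorbed. -/
theorem distSq_le_coefErr (hR : Regime K h κ α β lam₁ lam₂ η₀ η ξ Y Θs)
    (hT : Truth K G h κ b Θs) (hB : distSq Θ Θs ≤ basin K G h κ α β)
    (hI : ∀ i, (Θ i).Identified b) :
    distSq Θ Θs ≤ 2 * Comp.geomConst K G * (κ ^ 2 / h ^ 4 * coefErr Θ Θs) := by
  have hd := distSq_nonneg Θ Θs
  have hK := hT.one_le_K
  have hK0 : 0 < K := by linarith
  have hb := hR.basin_pos hT
  have hw : reg₂ b Θ = 0 := by
    rw [reg₂]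
    refine Finset.sum_eq_zero fun i _ => ?_
    rw [(hI i).1, (hI i).2]
    simp
  have key := le_of_forall_right_near (x := distSq Θ Θs) (y := distSq Θ Θs) (f := fun u =>
      Comp.geomConst K G * (κ ^ 2 / h ^ 4 * coefErr Θ Θs + 2 * (κ ^ 2 / h ^ 2 * u ^ 2))) hb
      (by fun_prop) fun u hu hu' => by
    obtain ⟨Θ', ho, hn⟩ := exists_orbit_of_distSq_lt hu
    have e : √u ^ 2 = u := Real.sq_sqrt (by linarith)
    have e4 : √u ^ 4 = u ^ 2 := by rw [show √u ^ 4 = (√u ^ 2) ^ 2 by ring, e]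
    have hMh := hR.le_h_of_basin hT (E := √u) (by rw [e]; linarith)
    have h0 := Real.sqrt_nonneg u
    have h1 := (hT.orbit ho).distSq_le ho h0 (Θ := Θ) (by rw [e]; exact hn.le)
      (by rw [le_div_iff₀ hK0]; nlinarith [le_nearConst hK])
    rw [ho.coefErr_eq, e4, hw, zero_div, add_zero] at h1
    exact h1
  have h1 : Comp.geomConst K G * (2 * (κ ^ 2 / h ^ 2 * distSq Θ Θs ^ 2)) ≤ 1 / 2 * distSq Θ Θs := by
    have hh := hT.h_pos
    have hC := geomConst_ge_one hK G
    have h2 : κ ^ 2 / h ^ 2 * distSq Θ Θs ≤ basinConst K G := by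
      rw [div_mul_eq_mul_div, div_le_iff₀ (by positivity)]
      exact (mul_le_mul_of_nonneg_left hB (sq_nonneg κ)).trans (hR.basin_le hT)
    have h3 : Comp.geomConst K G * basinConst K G ≤ 1 / 4 := by
      have hM : 1 ≤ nearConst K ^ 4 := one_le_pow₀ (by linarith [two_le_nearConst K])
      have h4 : basinConst K G ≤ rateConst K G := by
        rw [basinConst]
        exact div_le_self (rateConst_pos hK G).le
          (by nlinarith [one_le_mul_of_one_le_of_one_le hK hM])
      calc _ ≤ Comp.geomConst K G * rateConst K G := by gcongr
        _ = K⁻¹ / 4 := by rw [rateConst]; field_simp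
        _ ≤ 1 / 4 := by linarith [inv_le_one_of_one_le₀ hK]
    have h4 := mul_le_mul_of_nonneg_right (mul_le_mul_of_nonneg_left h2
      (show 0 ≤ Comp.geomConst K G by linarith)) hd
    nlinarith
  linarith

end Regime

/-- The constant in the error bounds. -/
def errConst (K G : ℝ) : ℝ :=
  1008 * nearConst K ^ 2 * (Comp.geomConst K G + noiseConst K G / rateConst K G)

theorem error_bounds (hR : Regime K h κ α β lam₁ lam₂ η₀ η ξ Y Θs)
    (hT : Truth K G h κ b Θs) (hB : distSq Θ₀ Θs ≤ basin K G h κ α β)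
    (hξ : noiseConst K G * (κ ^ 4 / h ^ 10 / α ^ 2 * ξ ^ 2) ≤
      rateConst K G / 2 * basin K G h κ α β) (j : ℕ) {ρ : ℝ}
    (hρ : ρ = 1 - rateConst K G / 2 * (η * (α * h ^ 10 / κ ^ 2)))
    (hΘ : Θ = iterate Y lam₁ lam₂ b η Θ₀ j) :
    distSq Θ Θs ≤ ρ ^ j * distSq Θ₀ Θs + errConst K G * (κ ^ 4 / h ^ 10 / α ^ 2 * ξ ^ 2) ∧
    ((∀ i, (Θ₀ i).Identified b) → coefErr Θ Θs ≤ errConst K G *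
      (κ ^ 2 * ρ ^ j * coefErr Θ₀ Θs + κ ^ 4 / (h ^ 6 * α ^ 2) * ξ ^ 2)) ∧
    ((∀ i, (Θ₀ i).Identified b) → ‖(Θ₀ 0).coef‖ = ‖(Θ₀ 1).coef‖ →
      ‖kron Θ - kron Θs‖ ^ 2 ≤ errConst K G *
        (κ ^ 2 * ρ ^ j * ‖kron Θ₀ - kron Θs‖ ^ 2 + κ ^ 4 / α ^ 2 * ξ ^ 2)) := by
  have hK := hT.one_le_K
  have hν := rateConst_pos hK G
  have hC := noiseConst_pos hK G
  have hg := geomConst_ge_one hK G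
  have hα := hR.α_pos
  have hκ := hT.one_le_κ
  have hh := hT.h_pos
  have hM : 1 ≤ nearConst K ^ 2 := one_le_pow₀ (by linarith [two_le_nearConst K])
  have hρ0 : 0 ≤ ρ ^ j := pow_nonneg (hρ ▸ hR.rate_nonneg hT) j
  obtain ⟨h1, h2⟩ := hR.distSq_iterate_le hT hB hξ j
  rw [← hΘ, ← hρ] at h2
  rw [← hΘ] at h1
  obtain ⟨h3, h4⟩ := hR.coefErr_le_distSq hT h1
  have h4' := (hR.coefErr_le_distSq hT hB).2
  set N := κ ^ 4 / h ^ 10 / α ^ 2 * ξ ^ 2 with hN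
  have hN0 : 0 ≤ N := by positivity
  set c := Comp.geomConst K G
  set q := noiseConst K G / rateConst K G with hq
  have hq0 : 0 < q := by positivity
  have e2 : 2 * noiseConst K G / rateConst K G = 2 * q := by rw [hq]; ring
  rw [e2] at h2
  have bound : (∀ i, (Θ₀ i).Identified b) → coefErr Θ Θs ≤ 36 * nearConst K ^ 2 * (c + q) *
      (κ ^ 2 * ρ ^ j * coefErr Θ₀ Θs + κ ^ 4 / (h ^ 6 * α ^ 2) * ξ ^ 2) := fun hI => by
    have h5 := hR.distSq_le_coefErr hT hB hI
    have hS := coefErr_nonneg Θ₀ Θs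
    set S := coefErr Θ₀ Θs
    have h6 : distSq Θ Θs ≤ ρ ^ j * (2 * c * (κ ^ 2 / h ^ 4 * S)) + 2 * q * N :=
      h2.trans (by gcongr)
    have h7 := h3.trans (mul_le_mul_of_nonneg_left h6
      (show 0 ≤ 18 * nearConst K ^ 2 * h ^ 4 by positivity))
    have e : 18 * nearConst K ^ 2 * h ^ 4 *
        (ρ ^ j * (2 * c * (κ ^ 2 / h ^ 4 * S)) + 2 * q * N) =
        36 * nearConst K ^ 2 * (c * (κ ^ 2 * ρ ^ j * S)
          + q * (κ ^ 4 / (h ^ 6 * α ^ 2) * ξ ^ 2)) := by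
      rw [hN]; field_simp; ring
    rw [e] at h7
    have a1 : 0 ≤ 36 * nearConst K ^ 2 * (q * (κ ^ 2 * ρ ^ j * S)) := by positivity
    have a2 : 0 ≤ 36 * nearConst K ^ 2 * (c * (κ ^ 4 / (h ^ 6 * α ^ 2) * ξ ^ 2)) := by positivity
    linarith
  refine ⟨h2.trans ?_, fun hI => (bound hI).trans ?_, fun hI hbal => ?_⟩
  · have : 2 * q ≤ errConst K G := by
      rw [errConst, ← hq]
      nlinarith [mul_nonneg (sub_nonneg.mpr hM) hq0.le,
        mul_nonneg (by linarith : 0 ≤ nearConst K ^ 2) (by linarith : 0 ≤ Comp.geomConst K G)]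
    gcongr
  · have hS := coefErr_nonneg Θ₀ Θs
    rw [errConst, ← hq]
    gcongr
    norm_num
  · have h5 := hT.le_kron h4'
    rw [hbal, sub_self, zero_pow two_ne_zero, mul_zero, add_zero] at h5
    have h6 := (hT.kron_le h4).trans (mul_le_mul_of_nonneg_left (bound hI)
      (show 0 ≤ 14 * h ^ 6 by positivity))
    refine h6.trans ?_
    -- The factor `h⁶ / 2` is split off to match `le_kron` at the balanced start; hence `1008 = 2 *
    -- 14 * 36` in `errConst`.
    have e : 14 * h ^ 6 * (36 * nearConst K ^ 2 * (c + q) *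
        (κ ^ 2 * ρ ^ j * coefErr Θ₀ Θs + κ ^ 4 / (h ^ 6 * α ^ 2) * ξ ^ 2)) =
        1008 * nearConst K ^ 2 * (c + q) *
        (κ ^ 2 * ρ ^ j * (h ^ 6 / 2 * coefErr Θ₀ Θs) + 1 / 2 * (κ ^ 4 / α ^ 2 * ξ ^ 2)) := by
      field_simp; ring
    rw [e, errConst, ← hq]
    have a1 : 0 ≤ κ ^ 4 / α ^ 2 * ξ ^ 2 := by positivity
    exact mul_le_mul_of_nonneg_left (add_le_add (by gcongr) (by linarith)) (by positivity)

theorem deviation_nonneg (hp : ∀ i, d i + s i ≤ p i) {φ : ℝ} (hφ : 0 < φ)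
    (hn : ∀ i, ‖(Θs i).coef‖ = φ) : 0 ≤ deviation d s Y (kron Θs) := by
  have h := (abs_nonneg _).trans (abs_frobInner_kron_le_deviation hp Y (kron Θs) Θs)
  rw [hn, hn] at h
  exact nonneg_of_mul_nonneg_left h (by positivity)

/-- The true parameter satisfies `Truth` with `h ^ 3 = φ`. -/
theorem truth_of_params {g : ℝ} (hK : 1 ≤ K) (hg : 0 < g) (hh : 0 < h)
    (hn : ∀ i, ‖(Θs i).coef‖ = h ^ 3) (hr : ∀ i, (Θs i).coef.rank = d i + s i)
    (hI : ∀ i, (Θs i).Identified b) (hs : ∀ i, 0 < d i → g ≤ (Θs i).sinTheta b)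
    (hκ : κ = h ^ 3 / min (Θs 0).sigmaR (Θs 1).sigmaR) (hbl : h / K ≤ b) (hbu : b ≤ K * h) :
    Truth K (min g 1) h κ b Θs := by
  have hK0 : 0 < K := by linarith
  have hb : 0 < b := lt_of_lt_of_le (by positivity) hbl
  -- Positive norm forces positive rank, so index `r - 1` really is that of the last nonzero
  -- singular value.
  have hpos : ∀ i, 0 < d i + s i := fun i => by
    rw [← hr i, Nat.pos_iff_ne_zero]
    intro h0
    have : IsEmpty (Fin (d i) ⊕ Fin (s i)) := by
      rw [← Fintype.card_eq_zero_iff]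
      simpa [hr i] using h0
    have h1 : (Θs i).coef = 0 := by
      ext x y
      simp [Comp.coef, Matrix.mul_apply]
    have h2 := hn i
    rw [h1, norm_zero] at h2
    exact (pow_pos hh 3).ne h2
  have hσ : 0 < min (Θs 0).sigmaR (Θs 1).sigmaR :=
    lt_min (Comp.sigmaR_pos (hr 0) (hpos 0)) (Comp.sigmaR_pos (hr 1) (hpos 1))
  have hle : ∀ i, min (Θs 0).sigmaR (Θs 1).sigmaR ≤ (Θs i).sigmaR := by
    intro i
    fin_cases i
    · exact min_le_left _ _
    · exact min_le_right _ _
  refine ⟨hK, lt_min hg one_pos, hh, ?_, hbl, hbu, hn, fun i => ?_⟩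
  · rw [hκ, one_le_div hσ, ← hn 0]
    exact (hle 0).trans (Comp.sigmaR_le_norm hb (hI 0) (hr 0) (hpos 0))
  · obtain ⟨σ, h1, h2, h3⟩ := Comp.exists_base (g := min g 1) (lt_min hg one_pos) (min_le_right _ _)
      hb (hI i) (hr i) (fun hd => (min_le_left _ _).trans (hs i hd))
    refine ⟨_, σ, h1, h2, ?_, h3⟩
    have h4 := hle i
    have e : h / (κ * K ^ 2) = min (Θs 0).sigmaR (Θs 1).sigmaR / (K * h) ^ 2 := by
      rw [hκ]; field_simp
    rw [e]
    gcongr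
    exact hσ.le.trans h4

end

end MARCF

open MARCF in
theorem theorem1 (K g : ℝ) (hK : 1 ≤ K) (hg : 0 < g) :
    ∃ ηbar c₀ cξ c C : ℝ, 0 < ηbar ∧ 0 < c₀ ∧ 0 < cξ ∧ 0 < c ∧ 0 < C ∧ c * ηbar < 1 ∧
    ∀ (p d s : Fin 2 → ℕ) (T : ℕ) (Y : Fin (T + 1) → Matrix (Fin (p 0)) (Fin (p 1)) ℝ)
      (Θs Θ₀ : Params p d s) (φ κ α β lam₁ lam₂ b η₀ ξ : ℝ),
      -- the true parameter
      0 < φ → (∀ i, ‖(Θs i).coef‖ = φ) → (∀ i, (Θs i).coef.rank = d i + s i) →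
      (∀ i, (Θs i).Identified b) → (∀ i, 0 < d i → g ≤ (Θs i).sinTheta b) →
      κ = φ / min (Θs 0).sigmaR (Θs 1).sigmaR →
      -- curvature of the loss, tuning parameters and step size
      RSCRSS d s Y α β →
      K⁻¹ * α ≤ lam₁ → lam₁ ≤ K * α →
      K⁻¹ * (φ ^ (8 / 3 : ℝ) * α / κ ^ 2) ≤ lam₂ → lam₂ ≤ K * (φ ^ (8 / 3 : ℝ) * α / κ ^ 2) →
      K⁻¹ * φ ^ (1 / 3 : ℝ) ≤ b → b ≤ K * φ ^ (1 / 3 : ℝ) →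
      0 < η₀ → η₀ ≤ ηbar →
      -- statistical deviation and initialization error
      ξ = deviation d s Y (kron Θs) →
      ξ ^ 2 ≤ cξ * (φ ^ 4 * α ^ 3 / (κ ^ 6 * β)) →
      distSq Θ₀ Θs ≤ c₀ * (φ ^ (2 / 3 : ℝ) * α / (κ ^ 2 * β)) →
      ∀ Θ : ℕ → Params p d s,
        Θ = iterate Y lam₁ lam₂ b (η₀ * φ ^ (-(10 / 3) : ℝ) / β) Θ₀ →
      ∀ j : ℕ, 1 ≤ j →
        distSq (Θ j) Θs ≤ (1 - c * η₀ * α / (β * κ ^ 2)) ^ j * distSq Θ₀ Θs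
            + C * (κ ^ 4 * φ ^ (-(10 / 3) : ℝ) / α ^ 2 * ξ ^ 2) ∧
        ((∀ i, (Θ₀ i).Identified b) →
          ‖(Θ j 0).coef - (Θs 0).coef‖ ^ 2 + ‖(Θ j 1).coef - (Θs 1).coef‖ ^ 2 ≤
            C * (κ ^ 2 * (1 - c * η₀ * α / (β * κ ^ 2)) ^ j *
                (‖(Θ₀ 0).coef - (Θs 0).coef‖ ^ 2 + ‖(Θ₀ 1).coef - (Θs 1).coef‖ ^ 2)
              + κ ^ 4 / (φ ^ 2 * α ^ 2) * ξ ^ 2)) ∧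
        ((∀ i, (Θ₀ i).Identified b) → ‖(Θ₀ 0).coef‖ = ‖(Θ₀ 1).coef‖ →
          ‖kron (Θ j) - kron Θs‖ ^ 2 ≤
            C * (κ ^ 2 * (1 - c * η₀ * α / (β * κ ^ 2)) ^ j * ‖kron Θ₀ - kron Θs‖ ^ 2
              + κ ^ 4 / α ^ 2 * ξ ^ 2)) := by
  -- The gap is truncated to `min g 1`, so that `σ = 0` satisfies the angle inequality when there is
  -- no common subspace.
  refine ⟨stepConst K, basinConst K (min g 1),
    rateConst K (min g 1) / 2 * basinConst K (min g 1) / noiseConst K (min g 1),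
    rateConst K (min g 1) / 2, errConst K (min g 1), stepConst_pos hK, basinConst_pos hK _, ?_, ?_,
    ?_, ?_, ?_⟩
  · exact div_pos (mul_pos (half_pos (rateConst_pos hK _)) (basinConst_pos hK _))
      (noiseConst_pos hK _)
  · exact half_pos (rateConst_pos hK _)
  · have := geomConst_ge_one hK (min g 1)
    have := div_pos (noiseConst_pos hK (min g 1)) (rateConst_pos hK (min g 1))
    have := two_le_nearConst K
    rw [errConst]
    positivity
  · nlinarith [rateConst_le hK (min g 1), rateConst_pos hK (min g 1), stepConst_le_one hK,
      stepConst_pos hK]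
  intro p d s T Y Θs Θ₀ φ κ α β lam₁ lam₂ b η₀ ξ hφ hn hr hI hs hκ hC hl₁ hl₁' hl₂ hl₂' hbl hbu
    hη hη' hξ hξ' hB Θ hΘ j _
  -- Passing to the cube root turns every fractional power of `φ` into an integer power of `h`.
  obtain ⟨h, hh, rfl⟩ : ∃ h : ℝ, 0 < h ∧ φ = h ^ 3 :=
    ⟨φ ^ (1 / 3 : ℝ), Real.rpow_pos_of_pos hφ _, by
      rw [← Real.rpow_natCast, ← Real.rpow_mul hφ.le]; norm_num⟩
  have pow_eq : ∀ (x : ℝ) (n : ℕ), 3 * x = n → (h ^ 3) ^ x = h ^ n := fun x n hx => by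
    rw [← Real.rpow_natCast h 3, ← Real.rpow_mul hh.le, ← Real.rpow_natCast h n, ← hx]
    norm_num
  have p8 : (h ^ 3) ^ (8 / 3 : ℝ) = h ^ 8 := pow_eq _ 8 (by norm_num)
  have p1 : (h ^ 3) ^ (1 / 3 : ℝ) = h := (pow_eq _ 1 (by norm_num)).trans (pow_one h)
  have p2 : (h ^ 3) ^ (2 / 3 : ℝ) = h ^ 2 := pow_eq _ 2 (by norm_num)
  have p10 : (h ^ 3) ^ (-(10 / 3) : ℝ) = (h ^ 10)⁻¹ := by
    rw [Real.rpow_neg (by positivity), pow_eq _ 10 (by norm_num)]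
  rw [p8] at hl₂ hl₂'
  rw [p1] at hbl hbu
  rw [p2] at hB
  rw [p10] at hΘ ⊢
  have hT := truth_of_params hK hg hh hn hr hI hs hκ (by rwa [div_eq_inv_mul]) hbu
  have hp : ∀ i, d i + s i ≤ p i := fun i => by
    rw [← hr i]; simpa using (Θs i).coef.rank_le_height
  have hβ : 0 < β := hC.1.trans_le hC.2.1
  have hκ1 := hT.one_le_κ
  have hR : Regime K h κ α β lam₁ lam₂ η₀ (η₀ * (h ^ 10)⁻¹ / β) ξ Y Θs :=
    ⟨hC, hξ ▸ deviation_nonneg hp hφ hn,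
      fun F => hξ ▸ abs_frobInner_kron_le_deviation hp Y (kron Θs) F, hl₁, hl₁', hl₂, hl₂', hη, hη',
      by field_simp⟩
  have hN : noiseConst K (min g 1) * (κ ^ 4 / h ^ 10 / α ^ 2 * ξ ^ 2) ≤
      rateConst K (min g 1) / 2 * basin K (min g 1) h κ α β := by
    have h0 := noiseConst_pos hK (min g 1)
    have hα := hC.1
    have h1 : noiseConst K (min g 1) * (κ ^ 4 / h ^ 10 / α ^ 2 * ξ ^ 2) ≤
        noiseConst K (min g 1) * (κ ^ 4 / h ^ 10 / α ^ 2 * _) :=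
      mul_le_mul_of_nonneg_left (mul_le_mul_of_nonneg_left hξ' (by positivity)) h0.le
    refine h1.trans_eq ?_
    rw [basin]
    field_simp
  have hρ : 1 - rateConst K (min g 1) / 2 * η₀ * α / (β * κ ^ 2) =
      1 - rateConst K (min g 1) / 2 * (η₀ * (h ^ 10)⁻¹ / β * (α * h ^ 10 / κ ^ 2)) := by
    rw [hR.rate_eq hT]; ring
  have key := error_bounds hR hT hB hN j hρ (congrFun hΘ j)
  have e6 : (h ^ 3) ^ 2 = h ^ 6 := by ring
  rw [e6]
  exact key
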